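/- Let $k$ be an algebraically closed field of characteristic $p\ge 5$, and let $O=k[X,Y]/(X^p,Y^p)$, where $x,y$ are the images of $X,Y$ and $x^{(i)}=x^i/i!$, $y^{(j)}=y^j/j!$ for $0\le i,j\le p-1$, with $x^{(-1)}=y^{(-1)}=0$. In the Lie algebra $W=\operatorname{Der}_k(O)$ let $H=H(2;(1,1);\Phi(1))$ be the subalgebra with basis $$\{\,y^{(j-1)}\partial_x-x^{(p-1)}y^{(j)}\partial_y,\ \ x^{(i-1)}y^{(j)}\partial_y-x^{(i)}y^{(j-1)}\partial_x \;:\; 1\le i\le p-1,\ 0\le j\le p-1\,\},$$ and let $\widehat H=H+k(x\partial_x+y\partial_y)$ be its minimal $p$-envelope, with $D^{[p]}=D^p$ (the $p$-th power of the operator $D$). For $n\ge 0$ let $\widehat H_{(n)}$ be the set of those $f\partial_x+g\partial_y\in\widehat H$ for which all monomials of $f$ and $g$ have degree at least $n+1$. Put $N=\widehat H_{(1)}+k\,x\partial_y$. A vector $v$ of a module over a Lie subalgebra of $\widehat H$ containing $N$, $x\partial_x$ and $y\partial_y$ is called maximal, of weight $(c,d)\in k^2$, if $v\neq 0$, $x\partial_x\cdot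 v=cv$, $y\partial_y\cdot v=dv$ and $N\cdot v=0$. Let $a,b$ be integers with $2\le a-b\le p-1$. Let $M=L_0(a,b)$ be the simple restricted module over $\widehat H_{(0)}/\widehat H_{(1)}\cong\mathfrak{gl}_2$ of highest weight $(a,b)$ modulo $p$; that is, $M$ is a simple restricted $\widehat H_{(0)}$-module with $\widehat H_{(1)}\cdot M=0$ that has a maximal vector $m$ of weight $(a,b)$ modulo $p$. Let $$Z(a,b)=\mathfrak u(\widehat H)\otimes_{\mathfrak u(\widehat H_{(0)})}M$$ be the induced $\widehat H$-module, where $\mathfrak u$ denotes the restricted universal enveloping algebra. Then the maximal vectors of $Z(a,b)$ (of any weight) are exactly the nonzero multiples of $1\otimes m$. Moreover, $Z(a,b)$ is a simple $\widehat H$-module, of dimension $p^2(a-b+1)$ over $k$. -/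

import Mathlib

open scoped TensorProduct

noncomputable section

namespace HamPhi

/-! ### The truncated polynomial ring and its derivations -/

section TruncatedPolynomials

variable (k : Type*) [Field k] (p : ℕ)

/-- The ideal `(X ^ p, Y ^ p)` of `k[X, Y]`. -/
abbrev truncIdeal : Ideal (MvPolynomial (Fin 2) k) :=
  Ideal.span (Set.range fun i : Fin 2 => (MvPolynomial.X i : MvPolynomial (Fin 2) k) ^ p)

/-- The truncated polynomial ring `O(2; (1,1)) = k[X, Y] / (X ^ p, Y ^ p)`. -/
def TruncPoly : Type _ := MvPolynomial (Fin 2) k ⧸ truncIdeal k p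

instance : CommRing (TruncPoly k p) :=
  inferInstanceAs (CommRing (MvPolynomial (Fin 2) k ⧸ truncIdeal k p))

instance : Algebra k (TruncPoly k p) :=
  inferInstanceAs (Algebra k (MvPolynomial (Fin 2) k ⧸ truncIdeal k p))

/-- The quotient map `k[X, Y] → O(2; (1,1))`. -/
def TruncPoly.mk : MvPolynomial (Fin 2) k →ₐ[k] TruncPoly k p :=
  Ideal.Quotient.mkₐ k (truncIdeal k p)

theorem TruncPoly.mk_surjective : Function.Surjective (TruncPoly.mk k p) :=
  Ideal.Quotient.mkₐ_surjective k (truncIdeal k p)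

variable {k p} in
theorem TruncPoly.mk_eq_zero {f : MvPolynomial (Fin 2) k} :
    TruncPoly.mk k p f = 0 ↔ f ∈ truncIdeal k p :=
  Ideal.Quotient.eq_zero_iff_mem

/-- The Lie algebra `W(2; (1,1))` of `k`-derivations of `O(2; (1,1))`. -/
abbrev Witt : Type _ := Derivation k (TruncPoly k p) (TruncPoly k p)

/-- The images `x` (index `0`) and `y` (index `1`) of the variables. -/
def gen (i : Fin 2) : TruncPoly k p := TruncPoly.mk k p (MvPolynomial.X i)

/-- The divided power `x^(n) = x ^ n / n!` (index `0`) or `y^(n) = y ^ n / n!` (index `1`),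
for `n < p`; it is zero for negative `n`. -/
def dpow (i : Fin 2) (n : ℤ) : TruncPoly k p :=
  if n < 0 then 0 else ((n.toNat.factorial : k)⁻¹) • gen k p i ^ n.toNat

section

variable {k p}

theorem gen_pow (i : Fin 2) : gen k p i ^ p = 0 := by
  rw [gen, ← map_pow, TruncPoly.mk_eq_zero]
  exact Ideal.subset_span ⟨i, rfl⟩

/-- Derivations of `O(2; (1,1))` agree if they agree on `x` and `y`. -/
theorem witt_ext {D E : Witt k p} (h : ∀ i, D (gen k p i) = E (gen k p i)) : D = E := by
  ext f
  obtain ⟨f, rfl⟩ := TruncPoly.mk_surjective k p f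
  induction f using MvPolynomial.induction_on with
  | C a =>
    have : TruncPoly.mk k p (MvPolynomial.C a) = algebraMap k (TruncPoly k p) a :=
      (TruncPoly.mk k p).commutes a
    rw [this, Derivation.map_algebraMap, Derivation.map_algebraMap]
  | add f g hf hg => rw [map_add, map_add, map_add, hf, hg]
  | mul_X f i hf =>
    rw [map_mul, Derivation.leibniz, Derivation.leibniz, hf]
    have := h i
    rw [gen] at this
    rw [this]

theorem dpow_nat (i : Fin 2) (n : ℕ) :
    dpow k p i n = ((n.factorial : k)⁻¹) • gen k p i ^ n := by
  simp [dpow]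

theorem dpow_neg (i : Fin 2) {n : ℤ} (h : n < 0) : dpow k p i n = 0 := if_pos h

theorem dpow_zero (i : Fin 2) : dpow k p i 0 = 1 := by simp [dpow]

theorem dpow_one (i : Fin 2) : dpow k p i 1 = gen k p i := by simp [dpow]

end

variable {k p} in
theorem pderiv_mem_truncIdeal [CharP k p] (i : Fin 2) (f : MvPolynomial (Fin 2) k)
    (hf : f ∈ truncIdeal k p) : MvPolynomial.pderiv i f ∈ truncIdeal k p := by
  refine Submodule.span_induction (p := fun f _ => MvPolynomial.pderiv i f ∈ truncIdeal k p)
    ?_ ?_ ?_ ?_ hf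
  · rintro _ ⟨j, rfl⟩
    simp [Derivation.leibniz_pow, ← Nat.cast_smul_eq_nsmul (MvPolynomial (Fin 2) k)]
  · simp
  · intro f g _ _ hf hg
    rw [map_add]
    exact add_mem hf hg
  · intro a f hf' hf
    rw [smul_eq_mul, Derivation.leibniz]
    exact add_mem (Ideal.mul_mem_left _ _ hf)
      (by rw [smul_eq_mul]; exact Ideal.mul_mem_right _ _ hf')

/-- The partial derivatives `∂_x` (index `0`) and `∂_y` (index `1`) of `O(2; (1,1))`. -/
def del [CharP k p] (i : Fin 2) : Witt k p :=
  Derivation.liftOfSurjective (f := TruncPoly.mk k p) (TruncPoly.mk_surjective k p)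
    (d := MvPolynomial.pderiv (R := k) i)
    (fun f hf => TruncPoly.mk_eq_zero.2 (pderiv_mem_truncIdeal i f (TruncPoly.mk_eq_zero.1 hf)))

variable {k p} in
theorem del_mk [CharP k p] (i : Fin 2) (f : MvPolynomial (Fin 2) k) :
    del k p i (TruncPoly.mk k p f) = TruncPoly.mk k p (MvPolynomial.pderiv i f) :=
  Derivation.liftOfSurjective_apply (TruncPoly.mk_surjective k p)
    (fun g hg => TruncPoly.mk_eq_zero.2 (pderiv_mem_truncIdeal i g (TruncPoly.mk_eq_zero.1 hg))) f

end TruncatedPolynomials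

/-! ### The Lie algebra `H(2; (1,1); Φ(1))` and its minimal `p`-envelope -/

section Hamiltonian

set_option linter.unusedSectionVars false

variable (k : Type*) [Field k] (p : ℕ) [CharP k p]

/-- The basis of `H(2; (1,1); Φ(1))`, consisting of the derivations
`y^(j-1) ∂_x - x^(p-1) y^(j) ∂_y` and `x^(i-1) y^(j) ∂_y - x^(i) y^(j-1) ∂_x`
for `1 ≤ i ≤ p - 1` and `0 ≤ j ≤ p - 1`. -/
def hamBasis : Set (Witt k p) :=
  {D | ∃ j : ℤ, 0 ≤ j ∧ j ≤ p - 1 ∧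
    D = dpow k p 1 (j - 1) • del k p 0 - (dpow k p 0 (p - 1) * dpow k p 1 j) • del k p 1} ∪
  {D | ∃ i j : ℤ, 1 ≤ i ∧ i ≤ p - 1 ∧ 0 ≤ j ∧ j ≤ p - 1 ∧
    D = (dpow k p 0 (i - 1) * dpow k p 1 j) • del k p 1
      - (dpow k p 0 i * dpow k p 1 (j - 1)) • del k p 0}

/-- The derivation `x ∂_x`. -/
def xdx : Witt k p := gen k p 0 • del k p 0

/-- The derivation `y ∂_y`. -/
def ydy : Witt k p := gen k p 1 • del k p 1

/-- The derivation `x ∂_y`. -/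
def xdy : Witt k p := gen k p 0 • del k p 1

/-- The linear map `g ↦ (∂_x g + x^(p-1) g) ∂_y - (∂_y g) ∂_x`, used to see that the span of
`hamBasis` is closed under the Lie bracket. -/
def ham : TruncPoly k p →ₗ[k] Witt k p where
  toFun g := (del k p 0 g + dpow k p 0 (p - 1) * g) • del k p 1 - del k p 1 g • del k p 0
  map_add' f g := by simp only [map_add, mul_add, add_smul]; abel
  map_smul' c g := by
    simp only [Derivation.map_smul, mul_smul_comm, RingHom.id_apply, smul_sub, ← smul_add,
      smul_assoc]

variable {k p}

theorem ham_apply (g h : TruncPoly k p) : ham k p g h =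
    (del k p 0 g + dpow k p 0 (p - 1) * g) * del k p 1 h - del k p 1 g * del k p 0 h := by
  simp [ham]

theorem del_gen (i j : Fin 2) : del k p i (gen k p j) = if i = j then 1 else 0 := by
  rw [gen, del_mk, MvPolynomial.pderiv_X]
  by_cases hij : i = j
  · subst hij; simp
  · simp [hij, eq_comm]

theorem del_comm (f : TruncPoly k p) : del k p 1 (del k p 0 f) = del k p 0 (del k p 1 f) := by
  have h : ⁅del k p 1, del k p 0⁆ = 0 := by
    refine witt_ext fun i => ?_
    rw [Derivation.commutator_apply, del_gen, del_gen]
    split_ifs <;> simp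
  have := congrArg (fun D : Witt k p => D f) h
  simpa [Derivation.commutator_apply, sub_eq_zero] using this

theorem del_dpow_ne {i j : Fin 2} (h : i ≠ j) (n : ℤ) : del k p i (dpow k p j n) = 0 := by
  rw [dpow]
  split_ifs
  · simp
  · rw [Derivation.map_smul, Derivation.leibniz_pow, del_gen, if_neg h]
    simp

theorem del_dpow [Fact p.Prime] (i : Fin 2) {n : ℤ} (hn : n ≤ p - 1) :
    del k p i (dpow k p i n) = dpow k p i (n - 1) := by
  rcases lt_or_ge n 0 with h | h
  · rw [dpow_neg i h, dpow_neg i (by omega), map_zero]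
  lift n to ℕ using h
  cases n with
  | zero => rw [Nat.cast_zero, dpow_zero, dpow_neg i (by omega)]; simp
  | succ n =>
    have e : ((n + 1 : ℕ) : ℤ) - 1 = (n : ℕ) := by push_cast; ring
    have hc : ((n + 1 : ℕ) : k) ≠ 0 := by
      rw [Ne, CharP.cast_eq_zero_iff k p]
      exact fun hd => absurd (Nat.le_of_dvd (Nat.succ_pos n) hd) (by omega)
    rw [e, dpow_nat, dpow_nat, Derivation.map_smul, Derivation.leibniz_pow, del_gen, if_pos rfl,
      Nat.factorial_succ, Nat.cast_mul, mul_inv, Nat.add_sub_cancel, smul_eq_mul, mul_one,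
      ← Nat.cast_smul_eq_nsmul k, smul_smul]
    congr 1
    field_simp

theorem gen_mul_dpow_top [Fact p.Prime] (i : Fin 2) : gen k p i * dpow k p i (p - 1) = 0 := by
  have hp := (Fact.out : p.Prime).pos
  have e : ((p : ℤ) - 1) = ((p - 1 : ℕ) : ℤ) := by omega
  rw [e, dpow_nat, mul_smul_comm, ← pow_succ', Nat.sub_add_cancel hp, gen_pow, smul_zero]

theorem dpow_top_mul_dpow [Fact p.Prime] (i : Fin 2) {n : ℤ} (hn : 1 ≤ n) :
    dpow k p i (p - 1) * dpow k p i n = 0 := by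
  lift n to ℕ using by omega
  obtain ⟨n, rfl⟩ := Nat.exists_eq_succ_of_ne_zero (n := n) (by rintro rfl; simp at hn)
  rw [dpow_nat, mul_smul_comm, pow_succ', ← mul_assoc, mul_comm _ (gen k p i), gen_mul_dpow_top,
    zero_mul, smul_zero]

theorem lie_ham [Fact p.Prime] (f g : TruncPoly k p) : ⁅ham k p f, ham k p g⁆ =
    ham k p ((del k p 0 f + dpow k p 0 (p - 1) * f) * del k p 1 g
      - del k p 1 f * (del k p 0 g + dpow k p 0 (p - 1) * g)) := by
  have hu : del k p 1 (dpow k p 0 (p - 1)) = 0 := del_dpow_ne (by decide) _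
  refine witt_ext fun i => ?_
  fin_cases i
  · simp [Derivation.commutator_apply, ham_apply, del_gen, del_comm, hu]
    ring
  · simp [Derivation.commutator_apply, ham_apply, del_gen, del_comm, hu]
    ring

theorem lie_euler_ham [Fact p.Prime] (g : TruncPoly k p) : ⁅xdx k p + ydy k p, ham k p g⁆ =
    ham k p ((xdx k p + ydy k p) g - (2 : k) • g) := by
  have hu : del k p 1 (dpow k p 0 (p - 1)) = 0 := del_dpow_ne (by decide) _
  have hu' : gen k p 0 * del k p 0 (dpow k p 0 (p - 1)) = - dpow k p 0 (p - 1) := by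
    have h := congrArg (del k p 0) (gen_mul_dpow_top (k := k) (p := p) 0)
    rw [Derivation.leibniz, del_gen, if_pos rfl, map_zero, smul_eq_mul, smul_eq_mul, mul_one] at h
    exact eq_neg_of_add_eq_zero_left h
  have h2 : ∀ h : TruncPoly k p, (2 : k) • h = h + h := two_smul k
  refine witt_ext fun i => ?_
  fin_cases i
  · simp [Derivation.commutator_apply, ham_apply, del_gen, del_comm, xdx, ydy, h2]
    ring
  · simp [Derivation.commutator_apply, ham_apply, del_gen, del_comm, hu, xdx, ydy, h2]
    linear_combination g * hu'

theorem ham_dpow_one [Fact p.Prime] {j : ℤ} (hj : j ≤ p - 1) : ham k p (dpow k p 1 j) =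
    -(dpow k p 1 (j - 1) • del k p 0 - (dpow k p 0 (p - 1) * dpow k p 1 j) • del k p 1) := by
  simp [ham, del_dpow 1 hj, del_dpow_ne (k := k) (p := p) (show (0 : Fin 2) ≠ 1 by decide) j]

theorem ham_dpow [Fact p.Prime] {i j : ℤ} (hi : 1 ≤ i) (hi' : i ≤ p - 1) (hj : j ≤ p - 1) :
    ham k p (dpow k p 0 i * dpow k p 1 j) =
      (dpow k p 0 (i - 1) * dpow k p 1 j) • del k p 1
        - (dpow k p 0 i * dpow k p 1 (j - 1)) • del k p 0 := by
  simp [ham, Derivation.leibniz, del_dpow 1 hj, del_dpow 0 hi',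
    del_dpow_ne (k := k) (p := p) (show (0 : Fin 2) ≠ 1 by decide) j,
    del_dpow_ne (k := k) (p := p) (show (1 : Fin 2) ≠ 0 by decide) i,
    ← mul_assoc, dpow_top_mul_dpow 0 hi, mul_comm (dpow k p 1 j)]

theorem span_dpow [Fact p.Prime] : Submodule.span k {f : TruncPoly k p | ∃ i j : ℤ,
    0 ≤ i ∧ i ≤ p - 1 ∧ 0 ≤ j ∧ j ≤ p - 1 ∧ f = dpow k p 0 i * dpow k p 1 j} = ⊤ := by
  refine eq_top_iff.2 fun f _ => ?_
  obtain ⟨f, rfl⟩ := TruncPoly.mk_surjective k p f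
  induction f using MvPolynomial.induction_on' with
  | add f g hf hg => rw [map_add]; exact add_mem (hf trivial) (hg trivial)
  | monomial u c =>
    have e : TruncPoly.mk k p (MvPolynomial.monomial u c) =
        c • (gen k p 0 ^ u 0 * gen k p 1 ^ u 1) := by
      rw [MvPolynomial.monomial_eq, Finsupp.prod_fintype _ _ (by simp), Fin.prod_univ_two,
        ← MvPolynomial.smul_eq_C_mul, map_smul, map_mul, map_pow, map_pow, gen, gen]
    rw [e]
    refine Submodule.smul_mem _ _ ?_
    rcases le_or_gt p (u 0) with h0 | h0
    · rw [pow_eq_zero_of_le h0 (gen_pow 0), zero_mul]; exact zero_mem _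
    rcases le_or_gt p (u 1) with h1 | h1
    · rw [pow_eq_zero_of_le h1 (gen_pow 1), mul_zero]; exact zero_mem _
    have hf : ∀ n : ℕ, n < p → (n.factorial : k) ≠ 0 := fun n hn => by
      rw [Ne, CharP.cast_eq_zero_iff k p, (Fact.out : p.Prime).dvd_factorial]
      omega
    have e' : gen k p 0 ^ u 0 * gen k p 1 ^ u 1 = (((u 0).factorial : k) * (u 1).factorial) •
        (dpow k p 0 (u 0 : ℕ) * dpow k p 1 (u 1 : ℕ)) := by
      rw [dpow_nat, dpow_nat, smul_mul_smul_comm, smul_smul]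
      have h0' := hf _ h0
      have h1' := hf _ h1
      rw [show ((u 0).factorial : k) * (u 1).factorial *
        (((u 0).factorial : k)⁻¹ * ((u 1).factorial : k)⁻¹) = 1 by field_simp, one_smul]
    rw [e']
    exact Submodule.smul_mem _ _ (Submodule.subset_span
      ⟨u 0, u 1, by omega, by omega, by omega, by omega, rfl⟩)

theorem span_hamBasis [Fact p.Prime] :
    Submodule.span k (hamBasis k p) = LinearMap.range (ham k p) := by
  apply le_antisymm
  · rw [Submodule.span_le]
    rintro _ (⟨j, -, hj, rfl⟩ | ⟨i, j, hi, hi', -, hj, rfl⟩)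
    · exact ⟨-dpow k p 1 j, by rw [map_neg, ham_dpow_one hj, neg_neg]⟩
    · exact ⟨dpow k p 0 i * dpow k p 1 j, ham_dpow hi hi' hj⟩
  · rw [LinearMap.range_eq_map, ← span_dpow, Submodule.map_span, Submodule.span_le]
    rintro _ ⟨_, ⟨i, j, hi, hi', hj, hj', rfl⟩, rfl⟩
    rcases hi.eq_or_lt with rfl | hi
    · rw [dpow_zero, one_mul, ham_dpow_one hj']
      exact neg_mem (Submodule.subset_span (Or.inl ⟨j, hj, hj', rfl⟩))
    · exact Submodule.subset_span (Or.inr ⟨i, j, hi, hi', hj, hj', ham_dpow hi hi' hj'⟩)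

variable (k p) [Fact p.Prime]

/-- The minimal `p`-envelope of `H(2; (1,1); Φ(1))`: the Lie subalgebra of `W(2; (1,1))` spanned
by `H(2; (1,1); Φ(1))` and `x ∂_x + y ∂_y`. -/
def Hhat : LieSubalgebra k (Witt k p) where
  toSubmodule := Submodule.span k (hamBasis k p) ⊔ Submodule.span k {xdx k p + ydy k p}
  lie_mem' := by
    intro D E hD hE
    rw [span_hamBasis] at *
    have key : ∀ (g : TruncPoly k p) (c : k), ⁅c • (xdx k p + ydy k p), ham k p g⁆ ∈ LinearMap.range (ham k p) :=
      fun g c => by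
        rw [smul_lie, lie_euler_ham]
        exact Submodule.smul_mem _ _ ⟨_, rfl⟩
    obtain ⟨_, ⟨f, rfl⟩, _, hs, rfl⟩ := Submodule.mem_sup.1 hD
    obtain ⟨c, rfl⟩ := Submodule.mem_span_singleton.1 hs
    obtain ⟨_, ⟨g, rfl⟩, _, ht, rfl⟩ := Submodule.mem_sup.1 hE
    obtain ⟨d, rfl⟩ := Submodule.mem_span_singleton.1 ht
    refine Submodule.mem_sup_left ?_
    have hz : ⁅c • (xdx k p + ydy k p), d • (xdx k p + ydy k p)⁆ = 0 := by
      rw [smul_lie, ← lie_skew, smul_lie, lie_self, smul_zero, neg_zero, smul_zero]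
    rw [add_lie, lie_add, lie_add, hz, add_zero]
    refine add_mem (add_mem ⟨_, (lie_ham f g).symm⟩ ?_) (key g c)
    rw [← lie_skew]
    exact neg_mem (key f d)

/-- The ideal `(x, y)` of `O(2; (1,1))`. -/
def maxIdeal : Ideal (TruncPoly k p) := Ideal.span (Set.range (gen k p))

variable {k p} in
theorem witt_apply_mem (I : Ideal (TruncPoly k p)) (D : Witt k p)
    (h : ∀ i, D (gen k p i) ∈ I) (f : TruncPoly k p) : D f ∈ I := by
  obtain ⟨f, rfl⟩ := TruncPoly.mk_surjective k p f
  induction f using MvPolynomial.induction_on with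
  | C a =>
    have : TruncPoly.mk k p (MvPolynomial.C a) = algebraMap k (TruncPoly k p) a :=
      (TruncPoly.mk k p).commutes a
    rw [this, Derivation.map_algebraMap]
    exact zero_mem _
  | add f g hf hg => rw [map_add, map_add]; exact add_mem hf hg
  | mul_X f i hf =>
    rw [map_mul, Derivation.leibniz]
    exact add_mem (Ideal.mul_mem_left _ _ (h i)) (Ideal.mul_mem_left _ _ hf)

/-- For `n ≥ 0`, the `n`-th term `W(2; (1,1))_(n)` of the filtration of `W(2; (1,1))` given by the
natural grading: the derivations `f ∂_x + g ∂_y` such that all monomials of `f` and `g` have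
degree at least `n + 1`. -/
def wittFilt (n : ℕ) : LieSubalgebra k (Witt k p) where
  carrier := {D | ∀ i, D (gen k p i) ∈ maxIdeal k p ^ (n + 1)}
  add_mem' hD hE i := add_mem (hD i) (hE i)
  zero_mem' i := zero_mem _
  smul_mem' c D hD i := by
    rw [Derivation.smul_apply]
    exact Submodule.smul_of_tower_mem _ c (hD i)
  lie_mem' {D E} hD hE i := by
    rw [Derivation.commutator_apply]
    exact sub_mem (witt_apply_mem _ D hD _) (witt_apply_mem _ E hE _)

/-- The subalgebra `Ĥ_(n)`, for `n ≥ 0`. -/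
def HhatFilt (n : ℕ) : LieSubalgebra k (Witt k p) := Hhat k p ⊓ wittFilt k p n

theorem HhatFilt_le (n : ℕ) : HhatFilt k p n ≤ Hhat k p := inf_le_left

/-- The space `N = Ĥ_(1) + k x ∂_y`. -/
def nilpart : Submodule k (Witt k p) :=
  (HhatFilt k p 1).toSubmodule ⊔ Submodule.span k {xdy k p}

/-- The space `B = N + T`, with `T` spanned by `x ∂_x` and `y ∂_y`. -/
def borel : Submodule k (Witt k p) :=
  nilpart k p ⊔ Submodule.span k {xdx k p, ydy k p}

variable {k p}

theorem smul_del_mem_wittFilt_zero (i j : Fin 2) : gen k p i • del k p j ∈ wittFilt k p 0 := by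
  intro l
  rw [Derivation.smul_apply, zero_add, pow_one, smul_eq_mul]
  exact Ideal.mul_mem_right _ _ (Ideal.subset_span ⟨i, rfl⟩)

theorem borel_le_HhatFilt (hp : 5 ≤ p) : borel k p ≤ (HhatFilt k p 0).toSubmodule := by
  have hb : hamBasis k p ⊆ Hhat k p := fun D hD =>
    Submodule.mem_sup_left (Submodule.subset_span hD)
  have he : xdx k p + ydy k p ∈ Hhat k p :=
    Submodule.mem_sup_right (Submodule.mem_span_singleton_self _)
  have hxy : xdy k p ∈ Hhat k p := hb <| Or.inr ⟨2, 0, by omega, by omega, by omega, by omega, by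
    norm_num [dpow_zero, dpow_one, dpow_neg, xdy]⟩
  have hd : ydy k p - xdx k p ∈ Hhat k p :=
    hb <| Or.inr ⟨1, 1, by omega, by omega, by omega, by omega, by
      norm_num [dpow_zero, dpow_one, xdx, ydy]⟩
  have h2 : (2 : k) ≠ 0 := fun h => by
    have := (CharP.cast_eq_zero_iff k p 2).1 (by exact_mod_cast h)
    exact absurd (Nat.le_of_dvd two_pos this) (by omega)
  have hx : xdx k p ∈ Hhat k p := by
    have : xdx k p = (2 : k)⁻¹ • ((xdx k p + ydy k p) - (ydy k p - xdx k p)) := by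
      rw [show xdx k p + ydy k p - (ydy k p - xdx k p) = xdx k p + xdx k p by abel,
        ← two_smul k, smul_smul, inv_mul_cancel₀ h2, one_smul]
    rw [this]
    exact (Hhat k p).smul_mem _ (sub_mem he hd)
  have hy : ydy k p ∈ Hhat k p := by
    rw [← add_sub_cancel_left (xdx k p) (ydy k p)]
    exact sub_mem he hx
  refine sup_le (sup_le ?_ ?_) ?_
  · rintro D ⟨h, h'⟩
    exact ⟨h, fun i => Ideal.pow_le_pow_right (by omega) (h' i)⟩
  · rw [Submodule.span_le, Set.singleton_subset_iff]
    exact ⟨hxy, smul_del_mem_wittFilt_zero 0 1⟩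
  · rw [Submodule.span_le, Set.insert_subset_iff, Set.singleton_subset_iff]
    exact ⟨⟨hx, smul_del_mem_wittFilt_zero 0 0⟩, ⟨hy, smul_del_mem_wittFilt_zero 1 1⟩⟩

theorem borel_le_Hhat (hp : 5 ≤ p) : borel k p ≤ (Hhat k p).toSubmodule :=
  (borel_le_HhatFilt hp).trans (HhatFilt_le k p 0)

theorem nilpart_le_borel : nilpart k p ≤ borel k p := le_sup_left

theorem xdx_mem_borel : xdx k p ∈ borel k p :=
  Submodule.mem_sup_right (Submodule.subset_span (Set.mem_insert _ _))

theorem ydy_mem_borel : ydy k p ∈ borel k p :=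
  Submodule.mem_sup_right (Submodule.subset_span (Set.mem_insert_of_mem _ rfl))

/-- Let `V` be a module over a Lie algebra `L` containing `B`. A vector `v` of `V` is maximal of
weight `(a, b)` if it is nonzero, `x ∂_x` and `y ∂_y` act on it by `a` and `b`, and `N v = 0`. -/
structure IsMaximalVector (L : LieSubalgebra k (Witt k p)) (hL : borel k p ≤ L.toSubmodule)
    {V : Type*} [AddCommGroup V] [Module k V] [LieRingModule L V] (a b : k) (v : V) : Prop where
  ne_zero : v ≠ 0
  xdx_lie : ⁅(⟨xdx k p, hL xdx_mem_borel⟩ : L), v⁆ = a • v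
  ydy_lie : ⁅(⟨ydy k p, hL ydy_mem_borel⟩ : L), v⁆ = b • v
  nil_lie : ∀ D (hD : D ∈ nilpart k p), ⁅(⟨D, hL (nilpart_le_borel hD)⟩ : L), v⁆ = 0

end Hamiltonian

/-! ### Restricted enveloping algebras, restricted modules and induced modules

The `p`-map of a restricted Lie algebra of derivations is the `p`-th power of operators. -/

section Restricted

attribute [local instance 100] LieRing.ofAssociativeRing

variable {k : Type*} [Field k] {p : ℕ}

/-- The relations `D ^ p = D^[p]` in the universal enveloping algebra of a Lie algebra `L` of
derivations, where `D^[p]` is the `p`-th power of the operator `D`. -/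
inductive PowRel (L : LieSubalgebra k (Witt k p)) :
    UniversalEnvelopingAlgebra k L → UniversalEnvelopingAlgebra k L → Prop
  | pow (D E : L)
      (h : ((E : Witt k p) : TruncPoly k p →ₗ[k] TruncPoly k p) =
        ((D : Witt k p) : Module.End k (TruncPoly k p)) ^ p) :
      PowRel L (UniversalEnvelopingAlgebra.ι k D ^ p) (UniversalEnvelopingAlgebra.ι k E)

/-- The restricted universal enveloping algebra of `L`. -/
def RestrictedEnv (L : LieSubalgebra k (Witt k p)) : Type _ := RingQuot (PowRel L)

variable (L : LieSubalgebra k (Witt k p))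

instance : Ring (RestrictedEnv L) := inferInstanceAs (Ring (RingQuot (PowRel L)))

instance : Algebra k (RestrictedEnv L) := inferInstanceAs (Algebra k (RingQuot (PowRel L)))

/-- The quotient map from the universal enveloping algebra. -/
def RestrictedEnv.mk : UniversalEnvelopingAlgebra k L →ₐ[k] RestrictedEnv L :=
  RingQuot.mkAlgHom k (PowRel L)

/-- The canonical map of `L` to its restricted universal enveloping algebra. -/
def RestrictedEnv.ι : L →ₗ⁅k⁆ RestrictedEnv L :=
  (RestrictedEnv.mk L : UniversalEnvelopingAlgebra k L →ₗ⁅k⁆ RestrictedEnv L).comp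
    (UniversalEnvelopingAlgebra.ι k)

variable {L} in
theorem RestrictedEnv.ι_pow (D E : L)
    (h : ((E : Witt k p) : TruncPoly k p →ₗ[k] TruncPoly k p) =
        ((D : Witt k p) : Module.End k (TruncPoly k p)) ^ p) :
    RestrictedEnv.ι L D ^ p = RestrictedEnv.ι L E := by
  have := RingQuot.mkAlgHom_rel k (PowRel.pow D E h)
  rwa [map_pow] at this

/-- The algebra homomorphism out of the restricted universal enveloping algebra given by a
homomorphism of restricted Lie algebras. -/
def RestrictedEnv.lift {A : Type*} [Ring A] [Algebra k A] (φ : L →ₗ⁅k⁆ A)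
    (hφ : ∀ D E : L, ((E : Witt k p) : TruncPoly k p →ₗ[k] TruncPoly k p) =
        ((D : Witt k p) : Module.End k (TruncPoly k p)) ^ p → φ D ^ p = φ E) :
    RestrictedEnv L →ₐ[k] A :=
  RingQuot.liftAlgHom k ⟨UniversalEnvelopingAlgebra.lift k φ, by
    rintro _ _ ⟨D, E, h⟩
    rw [map_pow, UniversalEnvelopingAlgebra.lift_ι_apply, UniversalEnvelopingAlgebra.lift_ι_apply]
    exact hφ D E h⟩

theorem RestrictedEnv.lift_ι {A : Type*} [Ring A] [Algebra k A] (φ : L →ₗ⁅k⁆ A)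
    (hφ : ∀ D E : L, ((E : Witt k p) : TruncPoly k p →ₗ[k] TruncPoly k p) =
        ((D : Witt k p) : Module.End k (TruncPoly k p)) ^ p → φ D ^ p = φ E) (D : L) :
    RestrictedEnv.lift L φ hφ (RestrictedEnv.ι L D) = φ D := by
  change RingQuot.liftAlgHom k _ (RingQuot.mkAlgHom k _ _) = _
  rw [RingQuot.liftAlgHom_mkAlgHom_apply]
  exact UniversalEnvelopingAlgebra.lift_ι_apply k φ D

/-- The homomorphism `u(L') → u(L)` for a subalgebra `L'` of `L`. -/
def RestrictedEnv.incl {L' L : LieSubalgebra k (Witt k p)} (h : L' ≤ L) :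
    RestrictedEnv L' →ₐ[k] RestrictedEnv L :=
  RestrictedEnv.lift L' ((RestrictedEnv.ι L).comp (LieSubalgebra.inclusion h))
    fun D E hDE => RestrictedEnv.ι_pow (LieSubalgebra.inclusion h D)
      (LieSubalgebra.inclusion h E) hDE

theorem RestrictedEnv.incl_ι {L' L : LieSubalgebra k (Witt k p)} (h : L' ≤ L) (D : L') :
    RestrictedEnv.incl h (RestrictedEnv.ι L' D) =
      RestrictedEnv.ι L (LieSubalgebra.inclusion h D) :=
  RestrictedEnv.lift_ι L' _ _ D

/-- An `L`-module `V` is restricted if `D^[p]` acts on `V` as the `p`-th power of `D`. -/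
def IsRestricted (V : Type*) [AddCommGroup V] [Module k V] [LieRingModule L V]
    [LieModule k L V] : Prop :=
  ∀ D E : L, ((E : Witt k p) : TruncPoly k p →ₗ[k] TruncPoly k p) =
    ((D : Witt k p) : Module.End k (TruncPoly k p)) ^ p →
    LieModule.toEnd k L V D ^ p = LieModule.toEnd k L V E

variable {L} {L' : LieSubalgebra k (Witt k p)}
  {V : Type*} [AddCommGroup V] [Module k V] [LieRingModule L' V] [LieModule k L' V]

/-- The action of `u(L')` on a restricted `L'`-module. -/
def IsRestricted.rep (hV : IsRestricted L' V) : RestrictedEnv L' →ₐ[k] Module.End k V :=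
  RestrictedEnv.lift L' (LieModule.toEnd k L' V) hV

theorem IsRestricted.rep_ι (hV : IsRestricted L' V) (D : L') (v : V) :
    hV.rep (RestrictedEnv.ι L' D) v = ⁅D, v⁆ :=
  LinearMap.congr_fun (RestrictedEnv.lift_ι L' _ _ D) v

/-- The relations `a w ⊗ v = a ⊗ w v`, for `a ∈ u(L)`, `w ∈ u(L')` and `v ∈ V`, as a
`u(L)`-submodule of `u(L) ⊗_k V`. -/
def balancing (h : L' ≤ L) (hV : IsRestricted L' V) :
    Submodule (RestrictedEnv L) (RestrictedEnv L ⊗[k] V) :=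
  Submodule.span (RestrictedEnv L)
    {z | ∃ (a : RestrictedEnv L) (w : RestrictedEnv L') (v : V),
      z = (a * RestrictedEnv.incl h w) ⊗ₜ[k] v - a ⊗ₜ[k] (hV.rep w v)}

/-- The induced module `u(L) ⊗_{u(L')} V` of a restricted `L'`-module `V`. -/
def Induced (h : L' ≤ L) (hV : IsRestricted L' V) : Type _ :=
  (RestrictedEnv L ⊗[k] V) ⧸ balancing h hV

namespace Induced

variable (h : L' ≤ L) (hV : IsRestricted L' V)

instance : AddCommGroup (Induced h hV) :=
  inferInstanceAs (AddCommGroup ((RestrictedEnv L ⊗[k] V) ⧸ balancing h hV))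

instance : Module (RestrictedEnv L) (Induced h hV) :=
  inferInstanceAs (Module (RestrictedEnv L) ((RestrictedEnv L ⊗[k] V) ⧸ balancing h hV))

instance : Module k (Induced h hV) :=
  inferInstanceAs (Module k ((RestrictedEnv L ⊗[k] V) ⧸ balancing h hV))

instance : IsScalarTower k (RestrictedEnv L) (Induced h hV) :=
  inferInstanceAs
    (IsScalarTower k (RestrictedEnv L) ((RestrictedEnv L ⊗[k] V) ⧸ balancing h hV))

/-- The element `a ⊗ v` of the induced module. -/
def tmul (a : RestrictedEnv L) (v : V) : Induced h hV :=
  (balancing h hV).mkQ (a ⊗ₜ[k] v)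

/-- `L` acts on the induced module by `D (a ⊗ v) = D a ⊗ v`. -/
instance : LieRingModule L (Induced h hV) where
  bracket D z := RestrictedEnv.ι L D • z
  add_lie D E z := by
    change RestrictedEnv.ι L (D + E) • z = RestrictedEnv.ι L D • z + RestrictedEnv.ι L E • z
    rw [map_add, add_smul]
  lie_add D z z' := smul_add (RestrictedEnv.ι L D) z z'
  leibniz_lie D E z := by
    change RestrictedEnv.ι L D • RestrictedEnv.ι L E • z =
      RestrictedEnv.ι L ⁅D, E⁆ • z + RestrictedEnv.ι L E • RestrictedEnv.ι L D • z
    rw [LieHom.map_lie, LieRing.of_associative_ring_bracket, sub_smul, mul_smul, mul_smul,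
      sub_add_cancel]

instance : LieModule k L (Induced h hV) where
  smul_lie c D z := by
    change RestrictedEnv.ι L (c • D) • z = c • RestrictedEnv.ι L D • z
    rw [map_smul, smul_assoc]
  lie_smul c D z := by
    change RestrictedEnv.ι L D • c • z = c • RestrictedEnv.ι L D • z
    rw [← algebraMap_smul (RestrictedEnv L) c z, ← algebraMap_smul (RestrictedEnv L) c
      (RestrictedEnv.ι L D • z), smul_smul, smul_smul, Algebra.commutes]

theorem lie_tmul (D : L) (a : RestrictedEnv L) (v : V) :
    ⁅D, tmul h hV a v⁆ = tmul h hV (RestrictedEnv.ι L D * a) v := rfl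

end Induced

variable [CharP k p] [Fact p.Prime]

/-- The induced module `Z(M) = u(Ĥ) ⊗_{u(Ĥ_(0))} M`. -/
abbrev Z {M : Type*} [AddCommGroup M] [Module k M] [LieRingModule (HhatFilt k p 0) M]
    [LieModule k (HhatFilt k p 0) M] (hM : IsRestricted (HhatFilt k p 0) M) : Type _ :=
  Induced (HhatFilt_le k p 0) hM

end Restricted

end HamPhi

end

noncomputable section

namespace HamPhi

set_option linter.unusedSectionVars false

/-! ### Coefficients of truncated polynomials -/

section Coefficients

variable {k : Type*} [Field k] {p : ℕ}

/-! The induced module is realised inside a module of tensor fields, where being killed by `N`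
becomes a short list of equations for truncated polynomials. Put `r = a - b` and choose a natural
number `c` with `c = b + 1` in `k`. Derivations act by Lie derivatives on sections of `Sym^r Ω^1 ⊗
(Ω^2)^c`, written as polynomials in `t = dy/dx` (`tensorRep`). This action is restricted
(`tensorRep_pow_char`) and respects the degree filtration. The deepest layer, spanned by `x^(p-1)
y^(p-1) t^l` with `l ≤ r`, is killed by `Ĥ_(1)` and is a copy of `M`. The shift from `b` to `c`
compensates for `x ∂_x` and `y ∂_y` acting on that monomial by `p - 1 = -1`. The universal property
of induction (`Induced.exists_lift`) extends `M → layer` to an equivariant map `T` on `Z(M)`.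

Injectivity of `T` and the dimension come from one count. Let `D₁ = -∂_x + x^(p-1) y ∂_y` (divided
power) and `D₂ = ∂_y`. They span `Ĥ` modulo `Ĥ_(0)`, with `D₂^p = 0` and `D₁^p = y ∂_y` in `Ĥ_(0)`,
so the vectors `D₁^i D₂^j ⊗ v` with `i, j < p` span `Z(M)` (`span_zMon_basis`). Conversely `D₁` and
`D₂` differentiate the deepest layer down to every monomial (`monomial_mem_of_stable`). Both bounds
are `p^2 (r+1)`.

The vectors killed by `N` are found by testing `x ∂_y` and the Hamiltonians `x^3`, `x^2 y`, `x y^2`,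
`x y^3`; these are divisible by `x`, so the term with `x^(p-1)` disappears from their fields.
Comparing coefficients eliminates everything but `x^(p-1) y^(p-1)` (`tensorCoeff_eq_of_singular`).
The eliminations at the boundary exponents leave the factors `r` and `r - 1`, which are invertible
precisely because `2 ≤ r ≤ p - 1`.

Simplicity follows (`isIrreducible_of_singular`): in a nonzero submodule take a nonzero vector whose
image lies as deep as possible. The algebra `Ĥ_(1)` would push it deeper, hence kills it, while `x
∂_y` keeps the depth and is nilpotent. So the submodule contains a nonzero vector killed by `N`,
that is, a multiple of `1 ⊗ m`, and this generates `Z(M)`. -/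

theorem mem_truncIdeal_iff {f : MvPolynomial (Fin 2) k} :
    f ∈ truncIdeal k p ↔ ∀ m : Fin 2 →₀ ℕ, m 0 < p → m 1 < p → f.coeff m = 0 := by
  have h : (Set.range fun i : Fin 2 => (MvPolynomial.X i : MvPolynomial (Fin 2) k) ^ p) =
      (fun s => MvPolynomial.monomial s (1 : k)) ''
        (Set.range fun i : Fin 2 => Finsupp.single i p) := by
    rw [← Set.range_comp]
    congr 1
    funext i
    simp [MvPolynomial.X_pow_eq_monomial]
  rw [truncIdeal, h, MvPolynomial.mem_ideal_span_monomial_image]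
  simp only [Set.exists_range_iff, Finsupp.single_le_iff, Fin.exists_fin_two,
    MvPolynomial.mem_support_iff]
  refine forall_congr' fun m => ?_
  constructor
  · intro h h0 h1
    by_contra hc
    rcases h hc with h | h <;> omega
  · intro h hc
    by_contra! hn
    exact hc (h hn.1 hn.2)

/-- The exponent vector of `x ^ i y ^ j`. -/
def expo (i j : ℕ) : Fin 2 →₀ ℕ := Finsupp.single 0 i + Finsupp.single 1 j

@[simp] theorem expo_zero (i j : ℕ) : expo i j 0 = i := by simp [expo]

@[simp] theorem expo_one (i j : ℕ) : expo i j 1 = j := by simp [expo]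

theorem eq_expo (m : Fin 2 →₀ ℕ) : m = expo (m 0) (m 1) := by
  ext i
  fin_cases i <;> simp

theorem expo_inj {i j i' j' : ℕ} : expo i j = expo i' j' ↔ i = i' ∧ j = j' :=
  ⟨fun h => ⟨by simpa using DFunLike.congr_fun h 0, by simpa using DFunLike.congr_fun h 1⟩,
    fun h => by rw [h.1, h.2]⟩

theorem ker_mk_le_ker_lcoeff {i j : ℕ} (h : i < p ∧ j < p) :
    LinearMap.ker (TruncPoly.mk k p).toLinearMap ≤
      LinearMap.ker (MvPolynomial.lcoeff k (expo i j)) := by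
  intro f hf
  rw [LinearMap.mem_ker, AlgHom.toLinearMap_apply, TruncPoly.mk_eq_zero, mem_truncIdeal_iff] at hf
  exact hf _ (by simpa using h.1) (by simpa using h.2)

/-- The coefficient of `x ^ i y ^ j` in a truncated polynomial, which is zero unless
`i, j < p`. -/
def cf (i j : ℕ) : TruncPoly k p →ₗ[k] k :=
  if h : i < p ∧ j < p then
    (Submodule.liftQ _ _ (ker_mk_le_ker_lcoeff (k := k) h)).comp
      ((TruncPoly.mk k p).toLinearMap.quotKerEquivOfSurjective
        (TruncPoly.mk_surjective k p)).symm.toLinearMap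
  else 0

theorem cf_mk (i j : ℕ) (f : MvPolynomial (Fin 2) k) :
    cf i j (TruncPoly.mk k p f) = if i < p ∧ j < p then f.coeff (expo i j) else 0 := by
  rw [cf]
  split_ifs with h
  · have e : ((TruncPoly.mk k p).toLinearMap.quotKerEquivOfSurjective
        (TruncPoly.mk_surjective k p)).symm (TruncPoly.mk k p f) = Submodule.Quotient.mk f := by
      rw [LinearEquiv.symm_apply_eq]
      rfl
    rw [LinearMap.comp_apply, LinearEquiv.coe_coe, e]
    rfl
  · rfl

theorem cf_eq_zero {i j : ℕ} (h : p ≤ i ∨ p ≤ j) (f : TruncPoly k p) : cf i j f = 0 := by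
  rw [cf, dif_neg (by omega)]
  rfl

theorem eq_zero_of_cf {f : TruncPoly k p} (h : ∀ i < p, ∀ j < p, cf i j f = 0) : f = 0 := by
  obtain ⟨f, rfl⟩ := TruncPoly.mk_surjective k p f
  rw [TruncPoly.mk_eq_zero, mem_truncIdeal_iff]
  intro m h0 h1
  have := h _ h0 _ h1
  rwa [cf_mk, if_pos ⟨h0, h1⟩, ← eq_expo] at this

theorem cf_zero_gen_mul (j : ℕ) (f : TruncPoly k p) : cf 0 j (gen k p 0 * f) = 0 := by
  obtain ⟨f, rfl⟩ := TruncPoly.mk_surjective k p f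
  rw [gen, ← map_mul, cf_mk, MvPolynomial.coeff_X_mul']
  simp

theorem cf_gen_mul_zero (i : ℕ) (f : TruncPoly k p) : cf i 0 (gen k p 1 * f) = 0 := by
  obtain ⟨f, rfl⟩ := TruncPoly.mk_surjective k p f
  rw [gen, ← map_mul, cf_mk, MvPolynomial.coeff_X_mul']
  simp

theorem cf_gen_zero_mul {i : ℕ} (hi : i + 1 < p) (j : ℕ) (f : TruncPoly k p) :
    cf (i + 1) j (gen k p 0 * f) = cf i j f := by
  obtain ⟨f, rfl⟩ := TruncPoly.mk_surjective k p f
  rw [gen, ← map_mul, cf_mk, cf_mk, show expo (i + 1) j = Finsupp.single 0 1 + expo i j by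
      rw [expo, expo, ← add_assoc, ← Finsupp.single_add, add_comm 1], MvPolynomial.coeff_X_mul]
  congr 1
  simp only [eq_iff_iff]
  omega

theorem cf_gen_one_mul (i : ℕ) {j : ℕ} (hj : j + 1 < p) (f : TruncPoly k p) :
    cf i (j + 1) (gen k p 1 * f) = cf i j f := by
  obtain ⟨f, rfl⟩ := TruncPoly.mk_surjective k p f
  rw [gen, ← map_mul, cf_mk, cf_mk, show expo i (j + 1) = Finsupp.single 1 1 + expo i j by
      rw [expo, expo, add_left_comm, ← Finsupp.single_add, add_comm 1], MvPolynomial.coeff_X_mul]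
  congr 1
  simp only [eq_iff_iff]
  omega

/-- No bound on `i` is needed: at `i + 1 = p` the right side is zero by the convention in `cf`, and
the derivative produces the factor `p = 0`. -/
theorem cf_del_zero [CharP k p] (i j : ℕ) (f : TruncPoly k p) :
    cf i j (del k p 0 f) = (i + 1) * cf (i + 1) j f := by
  obtain ⟨f, rfl⟩ := TruncPoly.mk_surjective k p f
  rw [del_mk, cf_mk, cf_mk, MvPolynomial.coeff_pderiv,
    show expo i j + Finsupp.single 0 1 = expo (i + 1) j by
      rw [expo, expo, add_right_comm, ← Finsupp.single_add], expo_zero]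
  split_ifs with h h' h'
  · ring
  · have : i + 1 = p := by omega
    have : (i : k) + 1 = 0 := by rw [← Nat.cast_succ, Nat.succ_eq_add_one, this, CharP.cast_eq_zero]
    rw [this]; ring
  · omega
  · ring

theorem cf_del_one [CharP k p] (i j : ℕ) (f : TruncPoly k p) :
    cf i j (del k p 1 f) = (j + 1) * cf i (j + 1) f := by
  obtain ⟨f, rfl⟩ := TruncPoly.mk_surjective k p f
  rw [del_mk, cf_mk, cf_mk, MvPolynomial.coeff_pderiv,
    show expo i j + Finsupp.single 1 1 = expo i (j + 1) by
      rw [expo, expo, add_assoc, ← Finsupp.single_add], expo_one]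
  split_ifs with h h' h'
  · ring
  · have : j + 1 = p := by omega
    have : (j : k) + 1 = 0 := by rw [← Nat.cast_succ, Nat.succ_eq_add_one, this, CharP.cast_eq_zero]
    rw [this]; ring
  · omega
  · ring

theorem cf_pow_mul_pow {a b : ℕ} (ha : a < p) (hb : b < p) (i j : ℕ) :
    cf i j (gen k p 0 ^ a * gen k p 1 ^ b) = if i = a ∧ j = b then 1 else 0 := by
  classical
  rw [gen, gen, ← map_pow, ← map_pow, ← map_mul, cf_mk, MvPolynomial.X_pow_eq_monomial,
    MvPolynomial.X_pow_eq_monomial, MvPolynomial.monomial_mul, MvPolynomial.coeff_monomial,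
    ← expo, one_mul]
  simp only [expo_inj]
  by_cases h : i = a ∧ j = b
  · rw [if_pos h, if_pos (by omega), if_pos ⟨h.1.symm, h.2.symm⟩]
  · rw [if_neg h, if_neg (fun h' : a = i ∧ b = j => h ⟨h'.1.symm, h'.2.symm⟩), ite_self]

/-- A truncated polynomial is congruent to its constant term modulo `(x, y)`. -/
theorem sub_algebraMap_cf_mem_maxIdeal [Fact p.Prime] (f : TruncPoly k p) :
    f - algebraMap k _ (cf 0 0 f) ∈ maxIdeal k p := by
  have hp := (Fact.out : p.Prime).pos
  obtain ⟨f, rfl⟩ := TruncPoly.mk_surjective k p f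
  induction f using MvPolynomial.induction_on with
  | C a =>
    have : TruncPoly.mk k p (MvPolynomial.C a) = algebraMap k (TruncPoly k p) a :=
      (TruncPoly.mk k p).commutes a
    rw [cf_mk, if_pos ⟨hp, hp⟩, this, MvPolynomial.coeff_C, if_pos (by simp [expo]), sub_self]
    exact zero_mem _
  | add f g hf hg =>
    rw [map_add, map_add, map_add, add_sub_add_comm]
    exact add_mem hf hg
  | mul_X f i hf =>
    have h0 : cf 0 0 (TruncPoly.mk k p (f * MvPolynomial.X i)) = 0 := by
      rw [mul_comm, map_mul]
      fin_cases i
      · exact cf_zero_gen_mul 0 _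
      · exact cf_gen_mul_zero 0 _
    rw [h0, map_zero, sub_zero, map_mul]
    exact Ideal.mul_mem_left _ _ (Ideal.subset_span ⟨i, rfl⟩)

theorem mem_maxIdeal_iff [Fact p.Prime] {f : TruncPoly k p} :
    f ∈ maxIdeal k p ↔ cf 0 0 f = 0 := by
  constructor
  · intro h
    rw [maxIdeal, Ideal.span, Submodule.mem_span_range_iff_exists_fun] at h
    obtain ⟨c, rfl⟩ := h
    rw [Fin.sum_univ_two, smul_eq_mul, smul_eq_mul, mul_comm (c 0), mul_comm (c 1), map_add,
      cf_zero_gen_mul, cf_gen_mul_zero, add_zero]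
  · intro h
    simpa [h] using sub_algebraMap_cf_mem_maxIdeal f

theorem gen_mem_maxIdeal (i : Fin 2) : gen k p i ∈ maxIdeal k p := Ideal.subset_span ⟨i, rfl⟩

/-- An element of `(x, y)` is a linear combination of `x` and `y` modulo `(x, y) ^ 2`. -/
theorem exists_sub_mem_maxIdeal_sq [Fact p.Prime] {f : TruncPoly k p} (hf : f ∈ maxIdeal k p) :
    ∃ a b : k, f - (a • gen k p 0 + b • gen k p 1) ∈ maxIdeal k p ^ 2 := by
  rw [maxIdeal, Ideal.span, Submodule.mem_span_range_iff_exists_fun] at hf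
  obtain ⟨c, rfl⟩ := hf
  -- In `c 0 * x + c 1 * y` only the constant terms of the `c i` matter modulo degree two.
  refine ⟨cf 0 0 (c 0), cf 0 0 (c 1), ?_⟩
  have h : ∀ i, (c i - algebraMap k _ (cf 0 0 (c i))) * gen k p i ∈ maxIdeal k p ^ 2 := fun i => by
    rw [pow_two]
    exact Ideal.mul_mem_mul (sub_algebraMap_cf_mem_maxIdeal _) (gen_mem_maxIdeal i)
  convert add_mem (h 0) (h 1) using 1
  rw [Fin.sum_univ_two, smul_eq_mul, smul_eq_mul, Algebra.smul_def, Algebra.smul_def]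
  ring

end Coefficients

/-! ### Powers of operators satisfying a Leibniz rule -/

section Pairing

variable {k : Type*} [Field k] {p : ℕ} [CharP k p] [Fact p.Prime]
  {V₁ V₂ V₃ : Type*} [AddCommGroup V₁] [Module k V₁] [AddCommGroup V₂] [Module k V₂]
  [AddCommGroup V₃] [Module k V₃]

/-- In characteristic `p`, the `p`-th powers of operators satisfying a Leibniz rule satisfy the
same Leibniz rule. -/
theorem pow_char_leibniz (μ : V₁ →ₗ[k] V₂ →ₗ[k] V₃) {A : Module.End k V₁} {B : Module.End k V₂}
    {C : Module.End k V₃} (h : ∀ v w, C (μ v w) = μ (A v) w + μ v (B w)) (v : V₁) (w : V₂) :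
    (C ^ p) (μ v w) = μ ((A ^ p) v) w + μ v ((B ^ p) w) := by
  -- On the tensor product `A ⊗ 1` and `1 ⊗ B` commute, and the Leibniz rule says that `μ`
  -- intertwines their sum with `C`. The claim is then `(S + T)^p = S^p + T^p`.
  set S : Module.End k (V₁ ⊗[k] V₂) := LinearMap.rTensor V₂ A with hS
  set T : Module.End k (V₁ ⊗[k] V₂) := LinearMap.lTensor V₁ B with hT
  have hc : Commute S T := by
    rw [commute_iff_eq]
    exact TensorProduct.ext' fun _ _ => rfl
  have hn : ∀ (n : ℕ) (z), (C ^ n) (TensorProduct.lift μ z) =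
      TensorProduct.lift μ (((S + T) ^ n) z) := by
    intro n
    induction n with
    | zero => intro z; rfl
    | succ n ih =>
      intro z
      rw [pow_succ, pow_succ, Module.End.mul_apply, Module.End.mul_apply, ← ih]
      congr 1
      induction z with
      | zero => simp
      | add z z' hz hz' => simp only [map_add, hz, hz']
      | tmul v w => simp [hS, hT, h]
  have hST : (S + T) ^ p = S ^ p + T ^ p := by
    obtain ⟨R, hR⟩ := hc.exists_add_pow_prime_eq (Fact.out : p.Prime)
    rw [hR]
    have : (p : Module.End k (V₁ ⊗[k] V₂)) = 0 := by
      rw [← map_natCast (algebraMap k _), CharP.cast_eq_zero, map_zero]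
    rw [this]
    simp
  have hSp : ∀ n : ℕ, (S ^ n) (v ⊗ₜ[k] w) = (A ^ n) v ⊗ₜ[k] w := fun n => by
    rw [hS, LinearMap.rTensor_pow, LinearMap.rTensor_tmul]
  have hTp : ∀ n : ℕ, (T ^ n) (v ⊗ₜ[k] w) = v ⊗ₜ[k] (B ^ n) w := fun n => by
    rw [hT, LinearMap.lTensor_pow, LinearMap.lTensor_tmul]
  have := hn p (v ⊗ₜ[k] w)
  rwa [TensorProduct.lift.tmul, hST, LinearMap.add_apply, hSp, hTp, map_add, TensorProduct.lift.tmul,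
    TensorProduct.lift.tmul] at this

/-- An intertwining relation is inherited by powers. -/
theorem pow_intertwine {A : Module.End k V₁} {B : Module.End k V₂} (φ : V₁ →ₗ[k] V₂)
    (h : ∀ v, φ (A v) = B (φ v)) (n : ℕ) (v : V₁) : φ ((A ^ n) v) = (B ^ n) (φ v) := by
  induction n generalizing v with
  | zero => rfl
  | succ n ih => rw [pow_succ, pow_succ, Module.End.mul_apply, Module.End.mul_apply, ih, h]

end Pairing

/-! ### Tensor modules

The polynomial `φ 0 + φ 1 t + ⋯ + φ r t ^ r` over the truncated polynomial ring stands for the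
section `∑ φ l (dx) ^ (r - l) (dy) ^ l (dx ∧ dy) ^ c` of the bundle of symmetric differentials
twisted by a power of the canonical bundle, so that `W(2; (1,1))` acts by Lie derivatives. -/

section TensorModules

open Polynomial

attribute [local instance 100] LieRing.ofAssociativeRing

variable {k : Type*} [Field k] {p : ℕ} [CharP k p]

/-- The derivation `D` applied to the coefficients of a polynomial. -/
def coefDer (D : Witt k p) : Derivation k (TruncPoly k p)[X] (TruncPoly k p)[X] :=
  (PolynomialModule.equivPolynomialSelf.toLinearMap).compDer D.mapCoeffs

theorem coefDer_monomial (D : Witt k p) (n : ℕ) (f : TruncPoly k p) :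
    coefDer D (monomial n f) = monomial n (D f) := by
  change PolynomialModule.equivPolynomialSelf (D.mapCoeffs (monomial n f)) = _
  rw [Derivation.mapCoeffs_monomial]
  exact PolynomialModule.equivPolynomial_single n (D f)

theorem coefDer_C (D : Witt k p) (f : TruncPoly k p) : coefDer D (C f) = C (D f) :=
  coefDer_monomial D 0 f

theorem coefDer_X (D : Witt k p) : coefDer D X = 0 := by
  rw [X, coefDer_monomial, Derivation.map_one_eq_zero, monomial_zero_right]

theorem coeff_coefDer (D : Witt k p) (φ : (TruncPoly k p)[X]) (n : ℕ) :
    (coefDer D φ).coeff n = D (φ.coeff n) := by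
  induction φ using Polynomial.induction_on' with
  | add φ ψ hφ hψ => simp only [map_add, coeff_add, hφ, hψ]
  | monomial m f => rw [coefDer_monomial, coeff_monomial, coeff_monomial]; split_ifs <;> simp

/-- Both sides of the formula for the bracket of `∂_i` with `D` are derivations, so checking them on
`x` and `y` suffices. This is the normal form used in every cocycle computation below. -/
theorem del_apply_comm (D : Witt k p) (i : Fin 2) (h : TruncPoly k p) :
    del k p i (D h) = D (del k p i h) + del k p i (D (gen k p 0)) * del k p 0 h
      + del k p i (D (gen k p 1)) * del k p 1 h := by
  have : ⁅del k p i, D⁆ = del k p i (D (gen k p 0)) • del k p 0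
      + del k p i (D (gen k p 1)) • del k p 1 := by
    refine witt_ext fun j => ?_
    rw [Derivation.commutator_apply, del_gen]
    fin_cases j <;> fin_cases i <;> simp [del_gen]
  have := congrArg (fun E : Witt k p => E h) this
  simp only [Derivation.commutator_apply, Derivation.add_apply, Derivation.smul_apply,
    smul_eq_mul] at this
  linear_combination this

variable (k p) in
/-- The image of `t = dy / dx` under the Lie derivative along `D`. -/
def slope : Witt k p →ₗ[k] (TruncPoly k p)[X] where
  -- For `D = u ∂_x + v ∂_y` one has `L_D dx = (u_x + u_y t) dx` and `L_D dy = (v_x + v_y t) dx`;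
  -- the quotient rule for `dy/dx` gives `v_x + v_y t - t (u_x + u_y t)`.
  toFun D := C (del k p 0 (D (gen k p 1)))
    + C (del k p 1 (D (gen k p 1)) - del k p 0 (D (gen k p 0))) * X
    - C (del k p 1 (D (gen k p 0))) * X ^ 2
  map_add' D E := by simp only [Derivation.add_apply, map_add, map_sub]; ring
  map_smul' a D := by
    simp only [Derivation.smul_apply, Derivation.map_smul, ← smul_sub, ← smul_C, smul_mul_assoc,
      RingHom.id_apply, ← smul_add]

variable (k p) in
/-- The factor by which the Lie derivative along `D` multiplies `dx`, in terms of `t = dy / dx`. -/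
def factor : Witt k p →ₗ[k] (TruncPoly k p)[X] where
  toFun D := C (del k p 0 (D (gen k p 0))) + C (del k p 1 (D (gen k p 0))) * X
  map_add' D E := by simp only [Derivation.add_apply, map_add]; ring
  map_smul' a D := by
    simp only [Derivation.smul_apply, Derivation.map_smul, ← smul_C, smul_mul_assoc,
      RingHom.id_apply, ← smul_add]

variable (k p) in
/-- The divergence. -/
def divergence : Witt k p →ₗ[k] TruncPoly k p where
  toFun D := del k p 0 (D (gen k p 0)) + del k p 1 (D (gen k p 1))
  map_add' D E := by simp only [Derivation.add_apply, map_add]; ring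
  map_smul' a D := by
    simp only [Derivation.smul_apply, Derivation.map_smul, RingHom.id_apply, ← smul_add]

theorem slope_apply (D : Witt k p) : slope k p D = C (del k p 0 (D (gen k p 1)))
    + C (del k p 1 (D (gen k p 1)) - del k p 0 (D (gen k p 0))) * X
    - C (del k p 1 (D (gen k p 0))) * X ^ 2 := rfl

theorem factor_apply (D : Witt k p) : factor k p D =
    C (del k p 0 (D (gen k p 0))) + C (del k p 1 (D (gen k p 0))) * X := rfl

theorem divergence_apply (D : Witt k p) : divergence k p D =
    del k p 0 (D (gen k p 0)) + del k p 1 (D (gen k p 1)) := rfl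

/-- The Lie derivative along `D` on functions of `x`, `y` and `t = dy / dx`. -/
def prolong (D : Witt k p) : Derivation k (TruncPoly k p)[X] (TruncPoly k p)[X] :=
  coefDer D + slope k p D • (derivative'.restrictScalars k)

theorem prolong_apply (D : Witt k p) (φ : (TruncPoly k p)[X]) :
    prolong D φ = coefDer D φ + slope k p D * derivative φ := rfl

@[simp] theorem prolong_C (D : Witt k p) (f : TruncPoly k p) : prolong D (C f) = C (D f) := by
  rw [prolong_apply, coefDer_C, derivative_C, mul_zero, add_zero]

@[simp] theorem prolong_X (D : Witt k p) : prolong D X = slope k p D := by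
  rw [prolong_apply, coefDer_X, derivative_X, mul_one, zero_add]

/-- Derivations of a polynomial ring over the truncated polynomials agree if they agree on the
coefficients and on the variable. -/
theorem poly_der_ext {A B : Derivation k (TruncPoly k p)[X] (TruncPoly k p)[X]}
    (hC : ∀ f, A (C f) = B (C f)) (hX : A X = B X) : A = B := by
  refine Derivation.ext fun φ => ?_
  induction φ using Polynomial.induction_on with
  | C f => exact hC f
  | add φ ψ hφ hψ => rw [map_add, map_add, hφ, hψ]
  | monomial n f h =>
    rw [pow_succ, ← mul_assoc, A.leibniz, B.leibniz, h, hX]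

/-- Two derivations of functions of `x`, `y`, `t` need comparing only on functions of `x`, `y`,
where this is the definition of the bracket, and on `t`. -/
theorem lie_prolong (D E : Witt k p) : prolong ⁅D, E⁆ = ⁅prolong D, prolong E⁆ := by
  refine poly_der_ext (fun f => ?_) ?_
  · simp [Derivation.commutator_apply]
  · simp only [Derivation.commutator_apply, prolong_X, slope_apply, map_add, map_sub,
      Derivation.leibniz, Derivation.leibniz_pow, prolong_C, smul_eq_mul, del_apply_comm D _ (E (gen k p _)),
      del_apply_comm E _ (D (gen k p _)), map_mul, nsmul_eq_mul]
    ring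

/-- The cocycle identity for the twist by `dx`; with `divergence_lie`, its analogue for `dx ∧ dy`,
it makes `tensorRep` respect brackets. -/
theorem factor_lie (D E : Witt k p) : factor k p ⁅D, E⁆ =
    prolong D (factor k p E) - prolong E (factor k p D) := by
  simp only [Derivation.commutator_apply, factor_apply, prolong_X, slope_apply, map_add, map_sub,
      Derivation.leibniz, prolong_C, smul_eq_mul, del_apply_comm D _ (E (gen k p _)),
      del_apply_comm E _ (D (gen k p _)), map_mul]
  ring

theorem divergence_lie (D E : Witt k p) : divergence k p ⁅D, E⁆ =
    D (divergence k p E) - E (divergence k p D) := by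
  simp only [Derivation.commutator_apply, divergence_apply, map_add, map_sub, del_apply_comm D _ (E (gen k p _)),
    del_apply_comm E _ (D (gen k p _))]
  ring

/-- The `0`-cocycle defining the twist by `(dx) ^ r (dx ∧ dy) ^ c`. -/
def twist (r c : ℕ) (D : Witt k p) : (TruncPoly k p)[X] :=
  r • factor k p D + c • C (divergence k p D)

/-- The Lie derivative along `D` on the symmetric differentials of degree `r` twisted by the
`c`-th power of the canonical bundle. -/
def lieDer (r c : ℕ) (D : Witt k p) : Module.End k (TruncPoly k p)[X] :=
  (prolong D : (TruncPoly k p)[X] →ₗ[k] (TruncPoly k p)[X]) + LinearMap.mulLeft k (twist r c D)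

theorem lieDer_apply (r c : ℕ) (D : Witt k p) (φ : (TruncPoly k p)[X]) :
    lieDer r c D φ = prolong D φ + twist r c D * φ := rfl

variable (k p) in
/-- The action of `W(2; (1,1))` on a tensor module. -/
def tensorRep (r c : ℕ) : Witt k p →ₗ⁅k⁆ Module.End k (TruncPoly k p)[X] where
  toFun := lieDer r c
  map_add' D E := by
    ext φ : 1
    have : coefDer (D + E) φ = coefDer D φ + coefDer E φ := by
      ext n; simp [coeff_coefDer]
    simp only [lieDer_apply, prolong_apply, twist, map_add, LinearMap.add_apply, this, smul_add]
    ring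
  map_smul' a D := by
    ext φ : 1
    have : coefDer (a • D) φ = a • coefDer D φ := by
      ext n; simp [coeff_coefDer]
    simp only [lieDer_apply, prolong_apply, twist, map_smul, LinearMap.smul_apply, this,
      RingHom.id_apply, smul_add, smul_mul_assoc, ← smul_C, smul_comm _ a, add_mul]
  map_lie' {D E} := by
    ext φ : 1
    rw [LieRing.of_associative_ring_bracket, LinearMap.sub_apply, Module.End.mul_apply,
      Module.End.mul_apply]
    simp only [lieDer_apply, twist, lie_prolong, factor_lie, divergence_lie, map_add,
      Derivation.leibniz, map_sub, Derivation.commutator_apply, smul_eq_mul, prolong_C,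
      nsmul_eq_mul]
    have h : ∀ (F : Witt k p) (n : ℕ), prolong F (n : (TruncPoly k p)[X]) = 0 := fun F n =>
      Derivation.map_natCast _ n
    simp only [h]
    ring

theorem tensorRep_apply (r c : ℕ) (D : Witt k p) (φ : (TruncPoly k p)[X]) :
    tensorRep k p r c D φ = prolong D φ + twist r c D * φ := rfl

/-! ### Tensor modules are restricted -/

/-- The Lie derivative along `D` on differentials `a dx + b dy`. -/
def lieDerForm (D : Witt k p) : Module.End k (TruncPoly k p × TruncPoly k p) where
  toFun w := (D w.1 + del k p 0 (D (gen k p 0)) * w.1 + del k p 0 (D (gen k p 1)) * w.2,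
    D w.2 + del k p 1 (D (gen k p 0)) * w.1 + del k p 1 (D (gen k p 1)) * w.2)
  map_add' v w := by
    refine Prod.ext ?_ ?_ <;> simp only [Prod.fst_add, Prod.snd_add, map_add] <;> ring
  map_smul' a w := by
    refine Prod.ext ?_ ?_ <;>
      simp only [Prod.smul_fst, Prod.smul_snd, Derivation.map_smul, mul_smul_comm, smul_add,
        RingHom.id_apply]

variable (k p) in
/-- The exterior derivative of a function. -/
def extDer : TruncPoly k p →ₗ[k] TruncPoly k p × TruncPoly k p :=
  LinearMap.prod (del k p 0 : TruncPoly k p →ₗ[k] TruncPoly k p)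
    (del k p 1 : TruncPoly k p →ₗ[k] TruncPoly k p)

theorem extDer_apply (f : TruncPoly k p) : extDer k p f = (del k p 0 f, del k p 1 f) := rfl

theorem extDer_lieDer (D : Witt k p) (f : TruncPoly k p) :
    extDer k p (D f) = lieDerForm D (extDer k p f) := by
  refine Prod.ext ?_ ?_
  · exact del_apply_comm D 0 f
  · exact del_apply_comm D 1 f

variable (k p) in
/-- The wedge product of differentials. -/
def wedge : TruncPoly k p × TruncPoly k p →ₗ[k] TruncPoly k p × TruncPoly k p →ₗ[k]
    TruncPoly k p :=
  LinearMap.mk₂ k (fun v w => v.1 * w.2 - v.2 * w.1)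
    (fun _ _ _ => by simp only [Prod.fst_add, Prod.snd_add]; ring)
    (fun _ _ _ => by simp only [Prod.smul_fst, Prod.smul_snd, smul_mul_assoc, smul_sub])
    (fun _ _ _ => by simp only [Prod.fst_add, Prod.snd_add]; ring)
    (fun _ _ _ => by simp only [Prod.smul_fst, Prod.smul_snd, mul_smul_comm, smul_sub])

theorem wedge_apply (v w : TruncPoly k p × TruncPoly k p) :
    wedge k p v w = v.1 * w.2 - v.2 * w.1 := rfl

/-- Lie derivatives commute with `d`, hence so do their powers, and the `p`-th power is therefore
known on exact forms. All tensor fields are reached from these by products. -/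
theorem extDer_pow_char {D E : Witt k p}
    (h : (E : TruncPoly k p →ₗ[k] TruncPoly k p) = (D : Module.End k (TruncPoly k p)) ^ p)
    (f : TruncPoly k p) :
    (lieDerForm D ^ p) (extDer k p f) = extDer k p (E f) := by
  have := pow_intertwine (A := (D : Module.End k (TruncPoly k p))) (extDer k p)
    (extDer_lieDer D) p f
  rw [← this, ← h]
  rfl

variable [Fact p.Prime]

/-- The constant `1` stands for `dx ∧ dy`, a wedge of exact forms, and the wedge satisfies a Leibniz
rule that passes to `p`-th powers. -/
theorem divergence_pow_char {D E : Witt k p}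
    (h : (E : TruncPoly k p →ₗ[k] TruncPoly k p) = (D : Module.End k (TruncPoly k p)) ^ p) :
    (((D : Module.End k (TruncPoly k p)) + LinearMap.mulLeft k (divergence k p D)) ^ p) 1 =
      divergence k p E := by
  have := pow_char_leibniz (p := p) (wedge k p) (A := lieDerForm D) (B := lieDerForm D)
    (C := (D : Module.End k (TruncPoly k p)) + LinearMap.mulLeft k (divergence k p D))
    (fun v w => by
      simp only [wedge_apply, lieDerForm, divergence_apply, LinearMap.add_apply,
        LinearMap.mulLeft_apply, LinearMap.coe_mk, AddHom.coe_mk, Derivation.coeFn_coe, map_sub,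
        Derivation.leibniz, smul_eq_mul]
      ring) (extDer k p (gen k p 0)) (extDer k p (gen k p 1))
  rw [extDer_pow_char h, extDer_pow_char h] at this
  simpa [wedge_apply, extDer_apply, del_gen, divergence_apply] using this

/-- The product of sections is a Leibniz pairing for Lie derivatives, so its `p`-th power is. -/
theorem lieDer_pow_char_mul (D : Witt k p) (r c r' c' : ℕ) (φ ψ : (TruncPoly k p)[X]) :
    (lieDer (r + r') (c + c') D ^ p) (φ * ψ) =
      (lieDer r c D ^ p) φ * ψ + φ * (lieDer r' c' D ^ p) ψ :=
  pow_char_leibniz (LinearMap.mul k (TruncPoly k p)[X]) (fun φ ψ => by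
    simp only [LinearMap.mul_apply', lieDer_apply, twist, Derivation.leibniz, smul_eq_mul,
      add_smul]
    ring) φ ψ

theorem lieDer_zero_zero_apply (D : Witt k p) (φ : (TruncPoly k p)[X]) :
    lieDer 0 0 D φ = prolong D φ := by
  rw [lieDer_apply, twist, zero_smul, zero_smul, add_zero, zero_mul, add_zero]

variable (k p) in
/-- The differential `a dx + b dy` as the polynomial `a + b t`. -/
def formPoly : TruncPoly k p × TruncPoly k p →ₗ[k] (TruncPoly k p)[X] where
  toFun w := C w.1 + C w.2 * X
  map_add' v w := by simp only [Prod.fst_add, Prod.snd_add, map_add]; ring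
  map_smul' a w := by
    simp only [Prod.smul_fst, Prod.smul_snd, ← smul_C, smul_mul_assoc, ← smul_add,
      RingHom.id_apply]

theorem formPoly_lieDerForm (D : Witt k p) (w : TruncPoly k p × TruncPoly k p) :
    formPoly k p (lieDerForm D w) = lieDer 1 0 D (formPoly k p w) := by
  simp only [formPoly, lieDerForm, lieDer_apply, twist, LinearMap.coe_mk, AddHom.coe_mk, map_add,
    map_mul, Derivation.leibniz, prolong_C, prolong_X, slope_apply, factor_apply, smul_eq_mul,
    one_smul, zero_smul, map_sub]
  ring

section

variable {D E : Witt k p}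

theorem lieDer_one_zero_pow_char
    (h : (E : TruncPoly k p →ₗ[k] TruncPoly k p) = (D : Module.End k (TruncPoly k p)) ^ p)
    (f : TruncPoly k p) : (lieDer 1 0 D ^ p) (formPoly k p (extDer k p f)) =
      lieDer 1 0 E (formPoly k p (extDer k p f)) := by
  rw [← pow_intertwine (formPoly k p) (formPoly_lieDerForm D), extDer_pow_char h, extDer_lieDer,
    formPoly_lieDerForm]

theorem lieDer_one_zero_pow_char_one
    (h : (E : TruncPoly k p →ₗ[k] TruncPoly k p) = (D : Module.End k (TruncPoly k p)) ^ p) :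
    (lieDer 1 0 D ^ p) 1 = factor k p E := by
  have := lieDer_one_zero_pow_char h (gen k p 0)
  have e : formPoly k p (extDer k p (gen k p 0)) = 1 := by
    simp [formPoly, extDer_apply, del_gen]
  rw [e] at this
  simpa [lieDer_apply, twist] using this

/-- In characteristic `p` the left side is a derivation in `φ`, so functions and `t` suffice. The
value on `t` is extracted from the two exact forms in `dy = t dx`. -/
theorem lieDer_zero_zero_pow_char
    (h : (E : TruncPoly k p →ₗ[k] TruncPoly k p) = (D : Module.End k (TruncPoly k p)) ^ p)
    (φ : (TruncPoly k p)[X]) : (lieDer 0 0 D ^ p) φ = prolong E φ := by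
  let A : Derivation k (TruncPoly k p)[X] (TruncPoly k p)[X] :=
    Derivation.mk' (lieDer 0 0 D ^ p) fun φ ψ => by
      rw [lieDer_pow_char_mul D 0 0 0 0 φ ψ, smul_eq_mul, smul_eq_mul]; ring
  suffices A = prolong E from congrArg (fun B => B φ) this
  refine poly_der_ext (fun f => ?_) ?_
  · let ι : TruncPoly k p →ₗ[k] (TruncPoly k p)[X] := (CAlgHom (R := k)).toLinearMap
    have := pow_intertwine (A := (D : Module.End k (TruncPoly k p))) (B := lieDer 0 0 D) ι
      (fun f => by
        rw [lieDer_zero_zero_apply]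
        exact (prolong_C D f).symm) p f
    rw [prolong_C]
    refine this.symm.trans ?_
    rw [← h]
    rfl
  · have h1 := lieDer_one_zero_pow_char h (gen k p 1)
    have e : formPoly k p (extDer k p (gen k p 1)) = X := by
      simp [formPoly, extDer_apply, del_gen]
    -- The product is `t · dx`, with `dx` represented by `1`: its left side is the known value on
    -- `dy`, and subtracting the known value on `dx` leaves the value on `t`.
    have h2 := lieDer_pow_char_mul D 0 0 1 0 X 1
    rw [mul_one, mul_one, lieDer_one_zero_pow_char_one h] at h2
    rw [e, lieDer_apply, twist, one_smul, zero_smul, add_zero] at h1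
    change (lieDer 0 0 D ^ p) X = _
    linear_combination h1 - h2

theorem lieDer_zero_one_pow_char_one
    (h : (E : TruncPoly k p →ₗ[k] TruncPoly k p) = (D : Module.End k (TruncPoly k p)) ^ p) :
    (lieDer 0 1 D ^ p) 1 = C (divergence k p E) := by
  let ι : TruncPoly k p →ₗ[k] (TruncPoly k p)[X] := (CAlgHom (R := k)).toLinearMap
  have := pow_intertwine (B := lieDer 0 1 D)
    (A := (D : Module.End k (TruncPoly k p)) + LinearMap.mulLeft k (divergence k p D)) ι
    (fun f => by
      rw [lieDer_apply, twist, zero_smul, one_smul, zero_add]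
      change C (D f + divergence k p D * f) = prolong D (C f) + C (divergence k p D) * C f
      rw [map_add, map_mul, prolong_C]) p 1
  rw [divergence_pow_char h] at this
  rw [show (1 : (TruncPoly k p)[X]) = ι 1 from (map_one C).symm, ← this]
  rfl

/-- Here `1` stands for `(dx)^r (dx ∧ dy)^c`, and the Leibniz rule strips off one factor at a time.
-/
theorem lieDer_pow_char_one
    (h : (E : TruncPoly k p →ₗ[k] TruncPoly k p) = (D : Module.End k (TruncPoly k p)) ^ p)
    (r c : ℕ) : (lieDer r c D ^ p) 1 = twist r c E := by
  have h1 : ∀ r, (lieDer r 0 D ^ p) 1 = twist r 0 E := fun r => by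
    induction r with
    | zero =>
      rw [lieDer_zero_zero_pow_char h, Derivation.map_one_eq_zero, twist, zero_smul, zero_smul,
        add_zero]
    | succ r ih =>
      have := lieDer_pow_char_mul D r 0 1 0 1 1
      rw [mul_one, mul_one, one_mul, ih, lieDer_one_zero_pow_char_one h, add_zero] at this
      rw [this, twist, twist, add_smul, one_smul]
      ring
  induction c with
  | zero => exact h1 r
  | succ c ih =>
    have := lieDer_pow_char_mul D r c 0 1 1 1
    rw [mul_one, mul_one, one_mul, ih, lieDer_zero_one_pow_char_one h, add_zero] at this
    rw [this, twist, twist, add_smul, one_smul]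
    ring

/-- Tensor modules are restricted. -/
theorem tensorRep_pow_char
    (h : (E : TruncPoly k p →ₗ[k] TruncPoly k p) = (D : Module.End k (TruncPoly k p)) ^ p)
    (r c : ℕ) : tensorRep k p r c D ^ p = tensorRep k p r c E := by
  ext φ : 1
  -- Split `φ` as an untwisted function of `x`, `y`, `t` times the section `1`, which carries the
  -- whole twist.
  have := lieDer_pow_char_mul D 0 0 r c φ 1
  rw [mul_one, mul_one, zero_add, zero_add, lieDer_zero_zero_pow_char h,
    lieDer_pow_char_one h] at this
  rw [tensorRep_apply, mul_comm (twist r c E), ← this]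
  rfl

end

end TensorModules

/-! ### The structure of `Ĥ` -/

section Structure

open Polynomial

variable {k : Type*} [Field k] {p : ℕ} [CharP k p] [Fact p.Prime]

theorem ham_mem_Hhat (g : TruncPoly k p) : ham k p g ∈ Hhat k p := by
  refine Submodule.mem_sup_left ?_
  rw [span_hamBasis]
  exact ⟨g, rfl⟩

theorem two_ne_zero_of_le (hp : 5 ≤ p) : (2 : k) ≠ 0 := fun h => by
  have := (CharP.cast_eq_zero_iff k p 2).1 (by exact_mod_cast h)
  exact absurd (Nat.le_of_dvd two_pos this) (by omega)

theorem xdx_apply (f : TruncPoly k p) : xdx k p f = gen k p 0 * del k p 0 f := rfl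

theorem ydy_apply (f : TruncPoly k p) : ydy k p f = gen k p 1 * del k p 1 f := rfl

theorem xdy_apply (f : TruncPoly k p) : xdy k p f = gen k p 0 * del k p 1 f := rfl

variable (k p) in
/-- The derivation `- ∂_x + x^(p-1) y ∂_y` in `Ĥ`. -/
def hamX : Witt k p := ham k p (gen k p 1)

variable (k p) in
/-- The derivation `∂_y` in `Ĥ`. -/
def hamY : Witt k p := ham k p (gen k p 0)

variable (k p) in
/-- The derivation `y ∂_x - x^(p-1) y^(2) ∂_y` in `Ĥ`. -/
def lower : Witt k p := ham k p (-((2 : k)⁻¹ • gen k p 1 ^ 2))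

theorem hamX_apply (f : TruncPoly k p) : hamX k p f =
    dpow k p 0 (p - 1) * gen k p 1 * del k p 1 f - del k p 0 f := by
  simp [hamX, ham_apply, del_gen]

theorem hamY_apply (f : TruncPoly k p) : hamY k p f = del k p 1 f := by
  simp [hamY, ham_apply, del_gen, mul_comm _ (gen k p 0), gen_mul_dpow_top]

theorem lower_apply (hp : 5 ≤ p) (f : TruncPoly k p) : lower k p f =
    gen k p 1 * del k p 0 f - (2 : k)⁻¹ • (dpow k p 0 (p - 1) * gen k p 1 ^ 2 * del k p 1 f) := by
  have h2 : (2 : k)⁻¹ • (2 * gen k p 1) = gen k p 1 := by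
    rw [two_mul, ← two_smul k, smul_smul, inv_mul_cancel₀ (two_ne_zero_of_le hp), one_smul]
  have h2' : del k p 1 ((2 : k)⁻¹ • gen k p 1 ^ 2) = gen k p 1 := by
    simp [Derivation.map_smul, Derivation.leibniz_pow, del_gen, h2]
  have h0 : del k p 0 ((2 : k)⁻¹ • gen k p 1 ^ 2) = 0 := by
    simp [Derivation.map_smul, Derivation.leibniz_pow, del_gen]
  rw [lower, map_neg, Derivation.neg_apply, ham_apply, h2', h0, Algebra.smul_def, Algebra.smul_def]
  ring

/-- A derivation whose values on the variables are those of `D ^ p` is `D ^ p`. -/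
theorem eq_pow_char_of_gen {D E : Witt k p}
    (h : ∀ i, E (gen k p i) = ((D : Module.End k (TruncPoly k p)) ^ p) (gen k p i)) :
    (E : TruncPoly k p →ₗ[k] TruncPoly k p) = (D : Module.End k (TruncPoly k p)) ^ p := by
  -- `D^p` is itself a derivation, by the Leibniz rule for the multiplication pairing, so its values
  -- on `x` and `y` determine it.
  let A : Witt k p := Derivation.mk' ((D : Module.End k (TruncPoly k p)) ^ p) fun f g => by
    have := pow_char_leibniz (p := p) (LinearMap.mul k (TruncPoly k p))
      (A := (D : Module.End k (TruncPoly k p))) (B := (D : Module.End k (TruncPoly k p)))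
      (C := (D : Module.End k (TruncPoly k p))) (fun v w => by simp; ring) f g
    rw [LinearMap.mul_apply', LinearMap.mul_apply', LinearMap.mul_apply'] at this
    rw [this, smul_eq_mul, smul_eq_mul]; ring
  have : E = A := witt_ext h
  rw [this]
  rfl

theorem end_pow_eq_zero_of_le {V : Type*} [AddCommGroup V] [Module k V] {A : Module.End k V}
    {v : V} {n m : ℕ} (hnm : n ≤ m) (h : (A ^ n) v = 0) : (A ^ m) v = 0 := by
  rw [← Nat.sub_add_cancel hnm, pow_add, Module.End.mul_apply, h, map_zero]

/-! ### `p`-th powers of the distinguished elements of `Ĥ`. -/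

theorem hamY_pow_char : ((0 : Witt k p) : TruncPoly k p →ₗ[k] TruncPoly k p) =
    (hamY k p : Module.End k (TruncPoly k p)) ^ p := by
  refine eq_pow_char_of_gen fun i => ?_
  refine (end_pow_eq_zero_of_le (n := 2) (Fact.out : p.Prime).two_le ?_).symm
  change hamY k p (hamY k p _) = 0
  rw [hamY_apply, hamY_apply, del_gen]
  split_ifs <;> simp

theorem xdy_pow_char : ((0 : Witt k p) : TruncPoly k p →ₗ[k] TruncPoly k p) =
    (xdy k p : Module.End k (TruncPoly k p)) ^ p := by
  refine eq_pow_char_of_gen fun i => ?_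
  refine (end_pow_eq_zero_of_le (n := 2) (Fact.out : p.Prime).two_le ?_).symm
  change xdy k p (xdy k p _) = 0
  rw [xdy_apply, xdy_apply, del_gen]
  split_ifs <;> simp [del_gen]

/-- Each further application differentiates the divided power of `x`, up to sign; the other term
contains `x^(p-1)` times a positive power of `x` and vanishes. -/
theorem hamX_pow_gen_one {i : ℕ} (hi : i < p) :
    ((hamX k p : Module.End k (TruncPoly k p)) ^ (i + 1)) (gen k p 1) =
      (-1) ^ i * dpow k p 0 (p - 1 - i) * gen k p 1 := by
  induction i with
  | zero => simp [hamX_apply, del_gen]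
  | succ i ih =>
    rw [pow_succ', Module.End.mul_apply, ih (by omega), Derivation.coeFn_coe, hamX_apply]
    have h0 : dpow k p 0 (p - 1) * dpow k p 0 (p - 1 - i) = 0 := dpow_top_mul_dpow 0 (by omega)
    have h1 : del k p 1 (dpow k p 0 (p - 1 - i)) = 0 := del_dpow_ne (by decide) _
    have h2 : del k p 0 (dpow k p 0 (p - 1 - i)) = dpow k p 0 (p - 1 - i - 1) :=
      del_dpow 0 (by omega)
    have h3 : ∀ j, del k p j ((-1) ^ i) = 0 := fun j => by
      rcases neg_one_pow_eq_or (TruncPoly k p) i with h | h <;> rw [h] <;> simp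
    simp only [Derivation.leibniz, h1, h2, h3, del_gen, smul_eq_mul]
    rw [show (p : ℤ) - 1 - (i + 1 : ℕ) = p - 1 - i - 1 by push_cast; ring]
    simp
    linear_combination (-1) ^ i * gen k p 1 * h0

/-- At `i = p - 1` the preceding formula returns `y`, as `p - 1` is even, while `x` dies after two
applications. Thus `D₁^p` is nonzero but falls into `Ĥ_(0)`, which is what the spanning argument for
`Z(M)` needs. -/
theorem hamX_pow_char (hp : 5 ≤ p) : (ydy k p : TruncPoly k p →ₗ[k] TruncPoly k p) =
    (hamX k p : Module.End k (TruncPoly k p)) ^ p := by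
  have hp1 : p = (p - 1) + 1 := by omega
  refine eq_pow_char_of_gen fun i => ?_
  fin_cases i
  · refine Eq.trans (by simp [ydy_apply, del_gen]) (end_pow_eq_zero_of_le (n := 2)
      (Fact.out : p.Prime).two_le ?_).symm
    change hamX k p (hamX k p _) = 0
    simp [hamX_apply, del_gen]
  · have h := hamX_pow_gen_one (k := k) (p := p) (i := p - 1) (by omega)
    have hodd : Even (p - 1) := (Fact.out : p.Prime).even_sub_one (by omega)
    rw [← hp1, hodd.neg_one_pow, one_mul, show (p : ℤ) - 1 - (p - 1 : ℕ) = 0 by omega, dpow_zero,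
      one_mul] at h
    refine Eq.trans ?_ h.symm
    simp [ydy_apply, del_gen]

theorem lower_gen_zero (hp : 5 ≤ p) : lower k p (gen k p 0) = gen k p 1 := by
  simp [lower_apply hp, del_gen]

theorem lower_gen_one (hp : 5 ≤ p) : lower k p (gen k p 1) =
    -((2 : k)⁻¹ • (dpow k p 0 (p - 1) * gen k p 1 ^ 2)) := by
  simp [lower_apply hp, del_gen]

/-- Each application raises the `y`-adic order by one, so `y^p = 0` makes `lower` nilpotent. -/
theorem lower_pow_mul (hp : 5 ≤ p) (n : ℕ) (f : TruncPoly k p) :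
    ∃ g, lower k p (gen k p 1 ^ n * f) = gen k p 1 ^ (n + 1) * g := by
  cases n with
  | zero =>
    refine ⟨del k p 0 f - (2 : k)⁻¹ • (dpow k p 0 (p - 1) * gen k p 1 * del k p 1 f), ?_⟩
    rw [pow_zero, one_mul, zero_add, lower_apply hp, mul_sub, mul_smul_comm]
    ring_nf
  | succ n =>
    refine ⟨del k p 0 f - (2 : k)⁻¹ • (dpow k p 0 (p - 1) * gen k p 1 * del k p 1 f)
      - ((n : TruncPoly k p) + 1) * (2 : k)⁻¹ • (dpow k p 0 (p - 1) * f), ?_⟩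
    rw [Derivation.leibniz, Derivation.leibniz_pow, lower_gen_one hp, lower_apply hp,
      Nat.add_sub_cancel, nsmul_eq_mul]
    simp only [smul_eq_mul, Algebra.smul_def (R := k)]
    push_cast
    ring

theorem lower_pow_gen_one (hp : 5 ≤ p) (n : ℕ) :
    ∃ g, ((lower k p : Module.End k (TruncPoly k p)) ^ n) (gen k p 1) = gen k p 1 ^ (n + 1) * g := by
  induction n with
  | zero => exact ⟨1, by simp⟩
  | succ n ih =>
    obtain ⟨g, hg⟩ := ih
    rw [pow_succ', Module.End.mul_apply, hg]
    exact lower_pow_mul hp (n + 1) g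

theorem lower_pow_char (hp : 5 ≤ p) : ((0 : Witt k p) : TruncPoly k p →ₗ[k] TruncPoly k p) =
    (lower k p : Module.End k (TruncPoly k p)) ^ p := by
  -- Starting from order one, `y` is killed after `p - 1` applications; since `lower` sends `x` to
  -- `y`, exactly one more handles `x`.
  obtain ⟨n, hn⟩ : ∃ n, n + 1 = p := ⟨p - 1, by omega⟩
  have h1 : ((lower k p : Module.End k (TruncPoly k p)) ^ n) (gen k p 1) = 0 := by
    obtain ⟨g, hg⟩ := lower_pow_gen_one (k := k) hp n
    rw [hg, hn, gen_pow, zero_mul]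
  have h0 : ((lower k p : Module.End k (TruncPoly k p)) ^ (n + 1)) (gen k p 0) = 0 := by
    rw [pow_succ, Module.End.mul_apply, Derivation.coeFn_coe, lower_gen_zero hp, h1]
  rw [hn] at h0
  refine eq_pow_char_of_gen fun i => ?_
  fin_cases i
  · exact h0.symm
  · exact (end_pow_eq_zero_of_le (by omega) h1).symm

/-! ### The filtration by degree -/

theorem cf_eq_zero_of_mem_pow {n : ℕ} {f : TruncPoly k p} (hf : f ∈ maxIdeal k p ^ n) {i j : ℕ}
    (hij : i + j < n) : cf i j f = 0 := by
  induction n generalizing f i j with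
  | zero => omega
  | succ n ih =>
    rw [pow_succ'] at hf
    refine Submodule.mul_induction_on hf (fun a ha b hb => ?_) fun a b ha hb => by
      rw [map_add, ha, hb, add_zero]
    rw [maxIdeal, Ideal.span, Submodule.mem_span_range_iff_exists_fun] at ha
    obtain ⟨c, rfl⟩ := ha
    have e : (∑ i, c i • gen k p i) * b = gen k p 0 * (c 0 * b) + gen k p 1 * (c 1 * b) := by
      rw [Fin.sum_univ_two, smul_eq_mul, smul_eq_mul]; ring
    rw [e, map_add]
    have h0 : cf i j (gen k p 0 * (c 0 * b)) = 0 := by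
      rcases i with _ | i
      · exact cf_zero_gen_mul _ _
      rcases lt_or_ge (i + 1) p with h | h
      · rw [cf_gen_zero_mul h]
        exact ih (Ideal.mul_mem_left _ _ hb) (by omega)
      · exact cf_eq_zero (Or.inl h) _
    have h1 : cf i j (gen k p 1 * (c 1 * b)) = 0 := by
      rcases j with _ | j
      · exact cf_gen_mul_zero _ _
      rcases lt_or_ge (j + 1) p with h | h
      · rw [cf_gen_one_mul _ h]
        exact ih (Ideal.mul_mem_left _ _ hb) (by omega)
      · exact cf_eq_zero (Or.inr h) _
    rw [h0, h1, add_zero]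

/-- A monomial with both exponents below `p` has degree at most `2p - 2`. -/
theorem maxIdeal_pow_eq_bot : maxIdeal k p ^ (2 * p - 1) = ⊥ := by
  rw [eq_bot_iff]
  intro f hf
  exact eq_zero_of_cf fun i hi j hj => cf_eq_zero_of_mem_pow hf (by omega)

theorem witt_apply_mem_pow {m n : ℕ} {D : Witt k p} (hD : D ∈ wittFilt k p m) {f : TruncPoly k p}
    (hf : f ∈ maxIdeal k p ^ n) : D f ∈ maxIdeal k p ^ (m + n) := by
  induction n generalizing f with
  | zero => exact Ideal.pow_le_pow_right (by omega) (witt_apply_mem _ D hD f)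
  | succ n ih =>
    rw [pow_succ'] at hf
    refine Submodule.mul_induction_on hf (fun a ha b hb => ?_) fun a b ha hb => by
      rw [map_add]; exact add_mem ha hb
    rw [Derivation.leibniz, smul_eq_mul, smul_eq_mul]
    refine add_mem ?_ ?_
    · rw [← add_assoc, pow_succ']
      exact Ideal.mul_mem_mul ha (ih hb)
    · rw [show m + (n + 1) = n + (m + 1) by omega, pow_add]
      exact Ideal.mul_mem_mul hb (witt_apply_mem _ D hD a)

theorem del_mem_pow {n : ℕ} (D : Witt k p) {f : TruncPoly k p}
    (hf : f ∈ maxIdeal k p ^ (n + 1)) : D f ∈ maxIdeal k p ^ n := by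
  induction n generalizing f with
  | zero => simp
  | succ n ih =>
    rw [pow_succ'] at hf
    refine Submodule.mul_induction_on hf (fun a ha b hb => ?_) fun a b ha hb => by
      rw [map_add]; exact add_mem ha hb
    rw [Derivation.leibniz, smul_eq_mul, smul_eq_mul]
    refine add_mem ?_ (Ideal.mul_mem_right _ _ hb)
    rw [pow_succ']
    exact Ideal.mul_mem_mul ha (ih hb)

theorem dpow_top_mem_maxIdeal (hp : 5 ≤ p) : dpow k p 0 (p - 1) ∈ maxIdeal k p := by
  rw [show (p : ℤ) - 1 = (p - 1 : ℕ) by omega, dpow_nat, Algebra.smul_def]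
  exact Ideal.mul_mem_left _ _ (Ideal.pow_mem_of_mem _ (gen_mem_maxIdeal 0) _ (by omega))

/-- The tensor modules are filtered by degree. -/
theorem tensorRep_mem_map {m n : ℕ} (r c : ℕ) {D : Witt k p} (hD : D ∈ wittFilt k p m)
    {φ : (TruncPoly k p)[X]} (hφ : φ ∈ (maxIdeal k p ^ n).map C) :
    tensorRep k p r c D φ ∈ (maxIdeal k p ^ (m + n)).map C := by
  have hd : ∀ i j, C (del k p i (D (gen k p j))) ∈ (maxIdeal k p ^ m).map C := fun i j =>
    Ideal.mem_map_of_mem _ (del_mem_pow _ (hD j))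
  have hmul : ∀ α ∈ (maxIdeal k p ^ m).map C, ∀ ψ ∈ (maxIdeal k p ^ n).map C,
      α * ψ ∈ (maxIdeal k p ^ (m + n)).map C := fun α hα ψ hψ => by
    rw [pow_add, Ideal.map_mul]
    exact Ideal.mul_mem_mul hα hψ
  rw [tensorRep_apply, prolong_apply]
  refine add_mem (add_mem ?_ (hmul _ ?_ _ ?_)) (hmul _ ?_ _ hφ)
  · rw [Ideal.mem_map_C_iff] at hφ ⊢
    intro l
    rw [coeff_coefDer]
    exact witt_apply_mem_pow hD (hφ l)
  · rw [slope_apply, map_sub]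
    exact sub_mem (add_mem (hd _ _) (Ideal.mul_mem_right _ _ (sub_mem (hd _ _) (hd _ _))))
      (Ideal.mul_mem_right _ _ (hd _ _))
  · rw [Ideal.mem_map_C_iff] at hφ ⊢
    intro l
    rw [coeff_derivative]
    exact Ideal.mul_mem_right _ _ (hφ _)
  · rw [twist, factor_apply, divergence_apply, map_add]
    exact add_mem (nsmul_mem (add_mem (hd _ _) (Ideal.mul_mem_right _ _ (hd _ _))) _)
      (nsmul_mem (add_mem (hd _ _) (hd _ _)) _)

/-- `Ĥ = Ĥ_(0) + k (-∂_x + x^(p-1) y ∂_y) + k ∂_y`. -/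
theorem exists_sub_mem_HhatFilt_zero {D : Witt k p} (hD : D ∈ Hhat k p) :
    ∃ α β : k, D - (α • hamX k p + β • hamY k p) ∈ HhatFilt k p 0 := by
  -- The sign appears because the leading term of `hamX` is `-∂_x`.
  refine ⟨-cf 0 0 (D (gen k p 0)), cf 0 0 (D (gen k p 1)),
    sub_mem hD (add_mem ((Hhat k p).smul_mem _ (ham_mem_Hhat _))
      ((Hhat k p).smul_mem _ (ham_mem_Hhat _))), fun i => ?_⟩
  have hp := (Fact.out : p.Prime).pos
  have h1 : cf (k := k) (p := p) 0 0 1 = 1 := by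
    simpa using cf_pow_mul_pow (k := k) hp hp 0 0
  rw [zero_add, pow_one, mem_maxIdeal_iff]
  fin_cases i
  · simp [hamX_apply, hamY_apply, del_gen, h1]
  · simp [hamX_apply, hamY_apply, del_gen, h1, mul_comm _ (gen k p 1), cf_gen_mul_zero]

variable (k) in
theorem lower_mem (hp : 5 ≤ p) : lower k p ∈ HhatFilt k p 0 := by
  refine ⟨ham_mem_Hhat _, fun i => ?_⟩
  rw [zero_add, pow_one]
  fin_cases i
  · exact (lower_gen_zero (k := k) hp) ▸ gen_mem_maxIdeal 1
  · refine (lower_gen_one (k := k) hp) ▸ neg_mem (Submodule.smul_of_tower_mem _ _ ?_)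
    exact Ideal.mul_mem_right _ _ (dpow_top_mem_maxIdeal hp)

variable (k) in
theorem xdx_mem (hp : 5 ≤ p) : xdx k p ∈ HhatFilt k p 0 := borel_le_HhatFilt hp xdx_mem_borel

variable (k) in
theorem ydy_mem (hp : 5 ≤ p) : ydy k p ∈ HhatFilt k p 0 := borel_le_HhatFilt hp ydy_mem_borel

theorem xdy_mem_nilpart : xdy k p ∈ nilpart k p :=
  Submodule.mem_sup_right (Submodule.mem_span_singleton_self _)

variable (k) in
theorem xdy_mem (hp : 5 ≤ p) : xdy k p ∈ HhatFilt k p 0 :=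
  borel_le_HhatFilt hp (nilpart_le_borel xdy_mem_nilpart)

theorem mul_sq_mem (f : TruncPoly k p) : f * gen k p 1 ^ 2 ∈ maxIdeal k p ^ 2 :=
  Ideal.mul_mem_left _ _ (Ideal.pow_mem_pow (gen_mem_maxIdeal 1) 2)

theorem lower_gen_one_mem (hp : 5 ≤ p) : lower k p (gen k p 1) ∈ maxIdeal k p ^ 2 := by
  rw [lower_gen_one hp]
  exact neg_mem (Submodule.smul_of_tower_mem _ _ (mul_sq_mem _))

/-- `Ĥ_(0) = Ĥ_(1) + gl_2`. -/
theorem exists_sub_mem_HhatFilt_one (hp : 5 ≤ p) {D : Witt k p} (hD : D ∈ HhatFilt k p 0) :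
    ∃ α β γ δ : k, D - (α • xdx k p + β • lower k p + γ • xdy k p + δ • ydy k p) ∈
      HhatFilt k p 1 := by
  have h := fun i => hD.2 i
  simp only [zero_add, pow_one] at h
  obtain ⟨α, β, h0⟩ := exists_sub_mem_maxIdeal_sq (h 0)
  obtain ⟨γ, δ, h1⟩ := exists_sub_mem_maxIdeal_sq (h 1)
  refine ⟨α, β, γ, δ, sub_mem hD.1 (HhatFilt_le k p 0 ?_), fun i => ?_⟩
  · exact add_mem (add_mem (add_mem ((HhatFilt k p 0).smul_mem _ (xdx_mem k hp))
      ((HhatFilt k p 0).smul_mem _ (lower_mem k hp))) ((HhatFilt k p 0).smul_mem _ (xdy_mem k hp)))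
      ((HhatFilt k p 0).smul_mem _ (ydy_mem k hp))
  · fin_cases i
    · convert h0 using 1
      simp [xdx_apply, ydy_apply, xdy_apply, lower_gen_zero hp, del_gen]
    -- `lower` is `y ∂_x` only up to a `∂_y`-term with coefficient in `(x, y)^2`; that term is
    -- restored here.
    · convert add_mem h1 (Submodule.smul_of_tower_mem _ (β * (2 : k)⁻¹)
        (mul_sq_mem (dpow k p 0 (p - 1)))) using 1
      simp [xdx_apply, ydy_apply, xdy_apply, lower_gen_one hp, del_gen, smul_smul]
      ring

/-! ### Commutation relations among the distinguished elements. -/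

/-- As `∂_x` and `∂_y` commute, only the divided power `x^(p-1)` times `∂_y` survives. Reordering
`D₁` and `D₂` in `Z(M)` therefore costs an `Ĥ_(0)`-term only. -/
theorem lie_hamY_hamX_mem (hp : 5 ≤ p) : ⁅hamY k p, hamX k p⁆ ∈ HhatFilt k p 0 := by
  refine ⟨(Hhat k p).lie_mem (ham_mem_Hhat _) (ham_mem_Hhat _), fun i => ?_⟩
  have hu : del k p 1 (dpow k p 0 (p - 1)) = 0 := del_dpow_ne (by decide) _
  rw [zero_add, pow_one, Derivation.commutator_apply]
  fin_cases i
  · simp [hamX_apply, hamY_apply, del_gen]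
  · simpa [hamX_apply, hamY_apply, del_gen, hu] using dpow_top_mem_maxIdeal (k := k) hp

theorem mem_HhatFilt_one {D : Witt k p} (h : D ∈ HhatFilt k p 0)
    (h' : ∀ i, D (gen k p i) ∈ maxIdeal k p ^ 2) : D ∈ HhatFilt k p 1 := ⟨h.1, h'⟩

/-- Modulo `Ĥ_(1)`, which acts trivially on `M`, `lower` is `y ∂_x`; this and the next two brackets
are the `gl_2` relations. -/
theorem lie_xdy_lower_sub_mem (hp : 5 ≤ p) :
    ⁅xdy k p, lower k p⁆ - (xdx k p - ydy k p) ∈ HhatFilt k p 1 := by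
  refine mem_HhatFilt_one (sub_mem ((HhatFilt k p 0).lie_mem (xdy_mem k hp) (lower_mem k hp))
    (sub_mem (xdx_mem k hp) (ydy_mem k hp))) fun i => ?_
  have hu : del k p 1 (dpow k p 0 (p - 1)) = 0 := del_dpow_ne (by decide) _
  rw [Derivation.sub_apply, Derivation.commutator_apply]
  fin_cases i
  · simp [lower_gen_zero hp, xdy_apply, xdx_apply, ydy_apply, del_gen]
  · have := gen_mul_dpow_top (k := k) (p := p) 0
    simp [lower_gen_zero hp, lower_gen_one hp, xdy_apply, xdx_apply, ydy_apply, del_gen, hu]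
    rw [← mul_assoc, this]
    simp

theorem lie_xdx_lower_add_mem (hp : 5 ≤ p) :
    ⁅xdx k p, lower k p⁆ + lower k p ∈ HhatFilt k p 1 := by
  refine mem_HhatFilt_one (add_mem ((HhatFilt k p 0).lie_mem (xdx_mem k hp) (lower_mem k hp))
    (lower_mem k hp)) fun i => ?_
  rw [Derivation.add_apply, Derivation.commutator_apply]
  fin_cases i
  · simp [lower_gen_zero hp, xdx_apply, del_gen]
  · have : xdx k p (gen k p 1) = 0 := by simp [xdx_apply, del_gen]
    simp only [Fin.mk_one, this, map_zero, sub_zero]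
    exact add_mem (witt_apply_mem_pow (xdx_mem k hp).2 (lower_gen_one_mem hp)) (lower_gen_one_mem hp)

theorem lie_ydy_lower_sub_mem (hp : 5 ≤ p) :
    ⁅ydy k p, lower k p⁆ - lower k p ∈ HhatFilt k p 1 := by
  refine mem_HhatFilt_one (sub_mem ((HhatFilt k p 0).lie_mem (ydy_mem k hp) (lower_mem k hp))
    (lower_mem k hp)) fun i => ?_
  rw [Derivation.sub_apply, Derivation.commutator_apply]
  fin_cases i
  · simp [lower_gen_zero hp, ydy_apply, del_gen]
  · have : ydy k p (gen k p 1) = gen k p 1 := by simp [ydy_apply, del_gen]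
    simp only [Fin.mk_one, this]
    exact sub_mem (sub_mem (witt_apply_mem_pow (ydy_mem k hp).2 (lower_gen_one_mem hp))
      (lower_gen_one_mem hp)) (lower_gen_one_mem hp)

end Structure

/-! ### Simple `gl_2`-modules and their maps to tensor modules -/

section SimpleModules

open Polynomial

variable {k : Type*} [Field k] {p : ℕ} [CharP k p] [Fact p.Prime]

/-- The usual highest weight induction, kept to bare operators. The coefficient `(l + 1) (a - b -
l)` shows where the string of powers of `f` can break. -/
theorem sl_two_lowering {W : Type*} [AddCommGroup W] [Module k W] {e f h₁ h₂ : Module.End k W}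
    (hef : ∀ w, e (f w) = f (e w) + (h₁ w - h₂ w)) (h₁f : ∀ w, h₁ (f w) = f (h₁ w) - f w)
    (h₂f : ∀ w, h₂ (f w) = f (h₂ w) + f w) {a b : k} {w : W} (he : e w = 0) (h₁w : h₁ w = a • w)
    (h₂w : h₂ w = b • w) (l : ℕ) :
    h₁ ((f ^ l) w) = (a - l) • (f ^ l) w ∧ h₂ ((f ^ l) w) = (b + l) • (f ^ l) w ∧
      e ((f ^ (l + 1)) w) = ((l + 1) * (a - b - l)) • (f ^ l) w := by
  induction l with
  | zero => simp [hef, he, h₁w, h₂w, sub_smul]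
  | succ l ih =>
    obtain ⟨i1, i2, i3⟩ := ih
    have j1 : h₁ ((f ^ (l + 1)) w) = (a - (l + 1 : ℕ)) • (f ^ (l + 1)) w := by
      rw [pow_succ', Module.End.mul_apply, h₁f, i1, map_smul]
      push_cast
      module
    have j2 : h₂ ((f ^ (l + 1)) w) = (b + (l + 1 : ℕ)) • (f ^ (l + 1)) w := by
      rw [pow_succ', Module.End.mul_apply, h₂f, i2, map_smul]
      push_cast
      module
    refine ⟨j1, j2, ?_⟩
    rw [pow_succ', Module.End.mul_apply, hef, j1, j2, i3, map_smul, ← Module.End.mul_apply,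
      ← pow_succ']
    push_cast
    module

variable {M : Type*} [AddCommGroup M] [Module k M] [LieRingModule (HhatFilt k p 0) M]
  [LieModule k (HhatFilt k p 0) M]

variable (M) in
/-- The action on `M` of a derivation in `Ĥ_(0)`. -/
abbrev act {D : Witt k p} (hD : D ∈ HhatFilt k p 0) : Module.End k M :=
  LieModule.toEnd k (HhatFilt k p 0) M ⟨D, hD⟩

section

variable (hinfl : ∀ D : HhatFilt k p 0, (D : Witt k p) ∈ HhatFilt k p 1 → ∀ m : M, ⁅D, m⁆ = 0)

include hinfl

theorem act_congr {D E : Witt k p} (hD : D ∈ HhatFilt k p 0) (hE : E ∈ HhatFilt k p 0)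
    (h : D - E ∈ HhatFilt k p 1) : act M hD = act M hE := by
  ext m
  have := hinfl ⟨D - E, sub_mem hD hE⟩ h m
  rw [show (⟨D - E, sub_mem hD hE⟩ : HhatFilt k p 0) = ⟨D, hD⟩ - ⟨E, hE⟩ from rfl, sub_lie,
    sub_eq_zero] at this
  exact this

theorem exists_act_eq (hp : 5 ≤ p) (D : HhatFilt k p 0) : ∃ α β γ δ : k, ∃ E ∈ HhatFilt k p 1,
    (D : Witt k p) = α • xdx k p + β • lower k p + γ • xdy k p + δ • ydy k p + E ∧
    ∀ n : M, ⁅D, n⁆ = α • act M (xdx_mem k hp) n + β • act M (lower_mem k hp) n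
      + γ • act M (xdy_mem k hp) n + δ • act M (ydy_mem k hp) n := by
  obtain ⟨α, β, γ, δ, h⟩ := exists_sub_mem_HhatFilt_one hp D.2
  refine ⟨α, β, γ, δ, _, h, by abel, fun n => ?_⟩
  let G : HhatFilt k p 0 := α • ⟨xdx k p, xdx_mem k hp⟩ + β • ⟨lower k p, lower_mem k hp⟩
    + γ • ⟨xdy k p, xdy_mem k hp⟩ + δ • ⟨ydy k p, ydy_mem k hp⟩
  have := LinearMap.congr_fun (act_congr (M := M) hinfl D.2 G.2 h) n
  refine Eq.trans this ?_
  change ⁅G, n⁆ = _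
  simp only [G, add_lie, smul_lie]
  rfl

theorem act_xdy_lower (hp : 5 ≤ p) (w : M) : act M (xdy_mem k hp) (act M (lower_mem k hp) w) =
    act M (lower_mem k hp) (act M (xdy_mem k hp) w)
      + (act M (xdx_mem k hp) w - act M (ydy_mem k hp) w) := by
  have := LinearMap.congr_fun (act_congr hinfl
    ((HhatFilt k p 0).lie_mem (xdy_mem k hp) (lower_mem k hp)) (sub_mem (xdx_mem k hp) (ydy_mem k hp))
    (lie_xdy_lower_sub_mem (k := k) hp)) w
  have e1 : act M ((HhatFilt k p 0).lie_mem (xdy_mem k hp) (lower_mem k hp)) w =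
    act M (xdy_mem k hp) (act M (lower_mem k hp) w) - act M (lower_mem k hp) (act M (xdy_mem k hp) w) :=
    lie_lie (⟨_, xdy_mem k hp⟩ : HhatFilt k p 0) (⟨_, lower_mem k hp⟩ : HhatFilt k p 0) w
  have e2 : act M (sub_mem (xdx_mem k hp) (ydy_mem k hp)) w =
      act M (xdx_mem k hp) w - act M (ydy_mem k hp) w :=
    sub_lie (⟨_, xdx_mem k hp⟩ : HhatFilt k p 0) (⟨_, ydy_mem k hp⟩ : HhatFilt k p 0) w
  rw [e1, e2, sub_eq_iff_eq_add'] at this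
  exact this

theorem act_xdx_lower (hp : 5 ≤ p) (w : M) : act M (xdx_mem k hp) (act M (lower_mem k hp) w) =
    act M (lower_mem k hp) (act M (xdx_mem k hp) w) - act M (lower_mem k hp) w := by
  have := LinearMap.congr_fun (act_congr hinfl
    ((HhatFilt k p 0).lie_mem (xdx_mem k hp) (lower_mem k hp)) (neg_mem (lower_mem k hp))
    (by rw [sub_neg_eq_add]; exact lie_xdx_lower_add_mem (k := k) hp)) w
  have e1 : act M ((HhatFilt k p 0).lie_mem (xdx_mem k hp) (lower_mem k hp)) w =
    act M (xdx_mem k hp) (act M (lower_mem k hp) w) - act M (lower_mem k hp) (act M (xdx_mem k hp) w) :=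
    lie_lie (⟨_, xdx_mem k hp⟩ : HhatFilt k p 0) (⟨_, lower_mem k hp⟩ : HhatFilt k p 0) w
  have e2 : act M (neg_mem (lower_mem k hp)) w = - act M (lower_mem k hp) w :=
    neg_lie (⟨_, lower_mem k hp⟩ : HhatFilt k p 0) w
  rw [e1, e2, sub_eq_iff_eq_add'] at this
  rw [this, sub_eq_add_neg]

theorem act_ydy_lower (hp : 5 ≤ p) (w : M) : act M (ydy_mem k hp) (act M (lower_mem k hp) w) =
    act M (lower_mem k hp) (act M (ydy_mem k hp) w) + act M (lower_mem k hp) w := by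
  have := LinearMap.congr_fun (act_congr hinfl
    ((HhatFilt k p 0).lie_mem (ydy_mem k hp) (lower_mem k hp)) (lower_mem k hp)
    (lie_ydy_lower_sub_mem (k := k) hp)) w
  have e1 : act M ((HhatFilt k p 0).lie_mem (ydy_mem k hp) (lower_mem k hp)) w =
    act M (ydy_mem k hp) (act M (lower_mem k hp) w) - act M (lower_mem k hp) (act M (ydy_mem k hp) w) :=
    lie_lie (⟨_, ydy_mem k hp⟩ : HhatFilt k p 0) (⟨_, lower_mem k hp⟩ : HhatFilt k p 0) w
  rw [e1, sub_eq_iff_eq_add'] at this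
  exact this

/-- Every element of `Ĥ_(0)` acts on `M` as a combination of four operators, so stability under
these makes a subspace a submodule. -/
theorem eq_bot_or_eq_top_of_stable (hp : 5 ≤ p)
    (hsimple : LieModule.IsIrreducible k (HhatFilt k p 0) M)
    (U : Submodule k M) (h₁ : ∀ u ∈ U, act M (xdx_mem k hp) u ∈ U)
    (h₂ : ∀ u ∈ U, act M (lower_mem k hp) u ∈ U) (h₃ : ∀ u ∈ U, act M (xdy_mem k hp) u ∈ U)
    (h₄ : ∀ u ∈ U, act M (ydy_mem k hp) u ∈ U) : U = ⊥ ∨ U = ⊤ := by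
  let U' : LieSubmodule k (HhatFilt k p 0) M :=
    { U with
      lie_mem := fun {D u} hu => by
        obtain ⟨α, β, γ, δ, -, -, -, h⟩ := exists_act_eq hinfl hp D
        rw [h]
        exact add_mem (add_mem (add_mem (U.smul_mem _ (h₁ u hu)) (U.smul_mem _ (h₂ u hu)))
          (U.smul_mem _ (h₃ u hu))) (U.smul_mem _ (h₄ u hu)) }
  rcases hsimple.eq_bot_or_eq_top U' with h | h
  · left
    exact congrArg LieSubmodule.toSubmodule h
  · right
    exact congrArg LieSubmodule.toSubmodule h

end

/-- The simple restricted `Ĥ_(0)`-module of highest weight `(a, b)`, with trivial action of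
`Ĥ_(1)`, has the basis `F ^ l m` for `0 ≤ l ≤ r`, where `r ≡ a - b` and `0 ≤ r < p`. -/
theorem exists_basis_lower_pow
    (hinfl : ∀ D : HhatFilt k p 0, (D : Witt k p) ∈ HhatFilt k p 1 → ∀ m : M, ⁅D, m⁆ = 0)
    (hp : 5 ≤ p) (hM : IsRestricted (HhatFilt k p 0) M)
    (hsimple : LieModule.IsIrreducible k (HhatFilt k p 0) M) {a b : k} {m : M}
    (hm : IsMaximalVector (HhatFilt k p 0) (borel_le_HhatFilt hp) a b m)
    {r : ℕ} (hrp : r < p) (hr : a - b = r) :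
    (act M (lower_mem k hp) ^ (r + 1)) m = 0 ∧
      ∃ B : Module.Basis (Fin (r + 1)) k M, ∀ l, B l = (act M (lower_mem k hp) ^ (l : ℕ)) m := by
  set f := act M (lower_mem k hp) with hf
  set e := act M (xdy_mem k hp) with he
  set h₁ := act M (xdx_mem k hp) with hh₁
  set h₂ := act M (ydy_mem k hp) with hh₂
  have em : e m = 0 := hm.nil_lie _ xdy_mem_nilpart
  have key := sl_two_lowering (act_xdy_lower hinfl hp) (act_xdx_lower hinfl hp)
    (act_ydy_lower hinfl hp) em hm.xdx_lie hm.ydy_lie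
  rw [hr] at key
  have hfp : (f ^ p) m = 0 := by
    have := hM ⟨lower k p, lower_mem k hp⟩ 0 (lower_pow_char hp)
    rw [map_zero] at this
    exact LinearMap.congr_fun this m
  have hfs : ∀ l, f ((f ^ l) m) = (f ^ (l + 1)) m := fun l => by
    rw [pow_succ', Module.End.mul_apply]
  have htop : (f ^ (r + 1)) m = 0 := by
    -- This tail of the string is stable because `e` sends its first vector to a multiple by `r - r
    -- = 0`. It cannot be all of `M`: the last power of `f` not killing `m` kills the tail.
    let U : Submodule k M := Submodule.span k (Set.range fun l => (f ^ (r + 1 + l)) m)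
    have hU : ∀ l, (f ^ (r + 1 + l)) m ∈ U := fun l => Submodule.subset_span ⟨l, rfl⟩
    have stable : ∀ A : Module.End k M, (∀ l, A ((f ^ (r + 1 + l)) m) ∈ U) → ∀ u ∈ U, A u ∈ U :=
      fun A hA u hu => by
        refine Submodule.span_induction (p := fun u _ => A u ∈ U) ?_ ?_ ?_ ?_ hu
        · rintro _ ⟨l, rfl⟩; exact hA l
        · rw [map_zero]; exact zero_mem _
        · intro u v _ _ hu hv; rw [map_add]; exact add_mem hu hv
        · intro c u _ hu; rw [map_smul]; exact U.smul_mem _ hu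
    rcases eq_bot_or_eq_top_of_stable hinfl hp hsimple U
      (stable _ fun l => by rw [(key _).1]; exact U.smul_mem _ (hU l))
      (stable _ fun l => by rw [hfs]; exact hU (l + 1))
      (stable _ fun l => by
        rcases l with _ | l
        · rw [add_zero, (key _).2.2]; simp
        · rw [← add_assoc, (key _).2.2]; exact U.smul_mem _ (hU l))
      (stable _ fun l => by rw [(key _).2.1]; exact U.smul_mem _ (hU l)) with h | h
    · simpa [h] using hU 0
    · exfalso
      classical
      have hex : ∃ q, (f ^ q) m = 0 := ⟨p, hfp⟩
      let q := Nat.find hex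
      have hq : (f ^ q) m = 0 := Nat.find_spec hex
      have hq0 : q ≠ 0 := fun h0 => hm.ne_zero (by rw [h0] at hq; exact hq)
      obtain ⟨q', hq'⟩ := Nat.exists_eq_succ_of_ne_zero hq0
      refine Nat.find_min hex (m := q') (by change q' < q; omega) ?_
      have : ∀ u ∈ U, (f ^ q') u = 0 := fun u hu => by
        refine Submodule.span_induction (p := fun u _ => (f ^ q') u = 0) ?_ ?_ ?_ ?_ hu
        · rintro _ ⟨l, rfl⟩
          rw [← Module.End.mul_apply, ← pow_add]
          exact end_pow_eq_zero_of_le (by omega) hq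
        · rw [map_zero]
        · intro u v _ _ hu hv; rw [map_add, hu, hv, add_zero]
        · intro c u _ hu; rw [map_smul, hu, smul_zero]
      exact this m (h ▸ Submodule.mem_top)
  refine ⟨htop, ?_⟩
  have cast_ne : ∀ l : ℕ, 0 < l → l < p → (l : k) ≠ 0 := fun l h h' h0 =>
    absurd (Nat.le_of_dvd h ((CharP.cast_eq_zero_iff k p l).1 h0)) (by omega)
  -- For `l < r < p` the factor `(l + 1) (r - l)` is invertible, so applying `e` propagates a
  -- vanishing down to `m`.
  have hne : ∀ l ≤ r, (f ^ l) m ≠ 0 := by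
    intro l
    induction l with
    | zero => exact fun _ => hm.ne_zero
    | succ l ih =>
      intro hl h0
      have := (key l).2.2
      rw [h0, map_zero, ← Nat.cast_succ, ← Nat.cast_sub (by omega)] at this
      rcases smul_eq_zero.1 this.symm with h | h
      · rcases mul_eq_zero.1 h with h | h
        · exact cast_ne _ (by omega) (by omega) h
        · exact cast_ne _ (by omega) (by omega) h
      · exact ih (by omega) h
  have hind : LinearIndependent k fun l : Fin (r + 1) => (f ^ (l : ℕ)) m := by
    refine Module.End.eigenvectors_linearIndependent' h₁ (fun l : Fin (r + 1) => a - (l : ℕ)) ?_ _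
      fun l => ⟨Module.End.mem_eigenspace_iff.2 (key l).1, hne l (by omega)⟩
    intro l l' h
    have h' : ((l : ℕ) : k) = (l' : ℕ) := sub_right_injective h
    rw [CharP.natCast_eq_natCast k p] at h'
    exact Fin.ext (Nat.ModEq.eq_of_lt_of_lt h' (by omega) (by omega))
  let U : Submodule k M := Submodule.span k (Set.range fun l : Fin (r + 1) => (f ^ (l : ℕ)) m)
  have hU : ∀ l < r + 1, (f ^ l) m ∈ U := fun l hl => Submodule.subset_span ⟨⟨l, hl⟩, rfl⟩
  have stable : ∀ A : Module.End k M, (∀ l < r + 1, A ((f ^ l) m) ∈ U) → ∀ u ∈ U, A u ∈ U :=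
    fun A hA u hu => by
      refine Submodule.span_induction (p := fun u _ => A u ∈ U) ?_ ?_ ?_ ?_ hu
      · rintro _ ⟨l, rfl⟩; exact hA l l.2
      · rw [map_zero]; exact zero_mem _
      · intro u v _ _ hu hv; rw [map_add]; exact add_mem hu hv
      · intro c u _ hu; rw [map_smul]; exact U.smul_mem _ hu
  have hspan : U = ⊤ := by
    refine (eq_bot_or_eq_top_of_stable hinfl hp hsimple U
      (stable _ fun l hl => by rw [(key _).1]; exact U.smul_mem _ (hU l hl))
      (stable _ fun l hl => by
        rw [hfs]
        rcases Nat.lt_or_ge (l + 1) (r + 1) with h | h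
        · exact hU _ h
        · rw [end_pow_eq_zero_of_le h htop]; exact zero_mem _)
      (stable _ fun l hl => by
        rcases l with _ | l
        · rw [pow_zero, Module.End.one_apply, em]; exact zero_mem _
        · rw [(key _).2.2]; exact U.smul_mem _ (hU l (by omega)))
      (stable _ fun l hl => by rw [(key _).2.1]; exact U.smul_mem _ (hU l hl))).resolve_left ?_
    intro h
    exact hm.ne_zero (by simpa [h] using hU 0 (by omega))
  exact ⟨Module.Basis.mk hind hspan.ge, fun l => Module.Basis.mk_apply _ _ l⟩

/-! ### The top component of a tensor module -/

variable (k p) in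
/-- The monomial `x ^ (p - 1) y ^ (p - 1)`. -/
def topMon : TruncPoly k p := gen k p 0 ^ (p - 1) * gen k p 1 ^ (p - 1)

theorem gen_mul_topMon (i : Fin 2) : gen k p i * topMon k p = 0 := by
  have hp := (Fact.out : p.Prime).pos
  fin_cases i
  · change gen k p 0 * topMon k p = 0
    rw [topMon, ← mul_assoc, ← pow_succ', Nat.sub_add_cancel hp, gen_pow, zero_mul]
  · change gen k p 1 * topMon k p = 0
    rw [topMon, mul_left_comm, ← pow_succ', Nat.sub_add_cancel hp, gen_pow, mul_zero]

theorem mul_topMon {f : TruncPoly k p} (hf : f ∈ maxIdeal k p) : f * topMon k p = 0 := by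
  rw [maxIdeal, Ideal.span, Submodule.mem_span_range_iff_exists_fun] at hf
  obtain ⟨c, rfl⟩ := hf
  rw [Finset.sum_mul]
  exact Finset.sum_eq_zero fun i _ => by rw [smul_eq_mul, mul_assoc, gen_mul_topMon, mul_zero]

theorem cast_p_sub_one : ((p - 1 : ℕ) : k) = -1 := by
  rw [Nat.cast_sub (Fact.out : p.Prime).one_le, CharP.cast_eq_zero, Nat.cast_one, zero_sub]

/-- The exponent `p - 1` equals `-1` in `k`; this is the source of the shift `c = b + 1`. -/
theorem gen_mul_del_topMon (i : Fin 2) : gen k p i * del k p i (topMon k p) = -topMon k p := by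
  have hc : ((p - 1 : ℕ) : TruncPoly k p) = -1 := by
    rw [← map_natCast (algebraMap k (TruncPoly k p)), cast_p_sub_one, map_neg, map_one]
  have hp1 : p - 1 = (p - 1 - 1) + 1 := by have := (Fact.out : p.Prime).two_le; omega
  have hs : ∀ z : TruncPoly k p, z * z ^ (p - 1 - 1) = z ^ (p - 1) := fun z => by
    rw [← pow_succ', ← hp1]
  fin_cases i
  · simp [topMon, Derivation.leibniz, Derivation.leibniz_pow, del_gen, hc]
    linear_combination gen k p 1 ^ (p - 1) * hs (gen k p 0)
  · simp [topMon, Derivation.leibniz, Derivation.leibniz_pow, del_gen, hc]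
    linear_combination gen k p 0 ^ (p - 1) * hs (gen k p 1)

theorem gen_mul_del_topMon_of_ne {i j : Fin 2} (hij : i ≠ j) :
    gen k p i * del k p j (topMon k p) = 0 := by
  have := congrArg (del k p j) (gen_mul_topMon (k := k) (p := p) i)
  rw [Derivation.leibniz, del_gen, if_neg hij.symm, smul_zero, add_zero, map_zero] at this
  exact this

theorem tensorRep_C_mul_X_pow (r c : ℕ) (D : Witt k p) (f : TruncPoly k p) (l : ℕ) :
    tensorRep k p r c D (C f * X ^ l) = C (D f) * X ^ l
      + (l : (TruncPoly k p)[X]) * (C f * X ^ (l - 1)) * slope k p D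
      + twist r c D * (C f * X ^ l) := by
  rw [tensorRep_apply, Derivation.leibniz, Derivation.leibniz_pow, prolong_C, prolong_X]
  simp only [smul_eq_mul, nsmul_eq_mul]
  ring

theorem C_smul_eq (a : k) (ψ : (TruncPoly k p)[X]) :
    a • ψ = C (algebraMap k (TruncPoly k p) a) * ψ := by
  rw [← smul_eq_C_mul, algebraMap_smul]

/-- The weight collects `-1` from the monomial, `r` from `(dx)^r`, `c` from the volume form and `-l`
from `t = dy/dx`. -/
theorem tensorRep_xdx_topMon (r c l : ℕ) :
    tensorRep k p r c (xdx k p) (C (topMon k p) * X ^ l) =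
      ((r : k) + c - 1 - l) • (C (topMon k p) * X ^ l) := by
  have h1 : xdx k p (gen k p 0) = gen k p 0 := by simp [xdx_apply, del_gen]
  have h2 : xdx k p (gen k p 1) = 0 := by simp [xdx_apply, del_gen]
  rw [tensorRep_C_mul_X_pow, twist, slope_apply, factor_apply, divergence_apply, h1, h2, xdx_apply,
    gen_mul_del_topMon, C_smul_eq]
  simp only [del_gen]
  rcases l with _ | l
  · simp
    ring
  · simp
    ring

theorem tensorRep_ydy_topMon (r c l : ℕ) :
    tensorRep k p r c (ydy k p) (C (topMon k p) * X ^ l) =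
      ((c : k) - 1 + l) • (C (topMon k p) * X ^ l) := by
  have h1 : ydy k p (gen k p 0) = 0 := by simp [ydy_apply, del_gen]
  have h2 : ydy k p (gen k p 1) = gen k p 1 := by simp [ydy_apply, del_gen]
  rw [tensorRep_C_mul_X_pow, twist, slope_apply, factor_apply, divergence_apply, h1, h2, ydy_apply,
    gen_mul_del_topMon, C_smul_eq]
  simp only [del_gen]
  rcases l with _ | l
  · simp
    ring
  · simp
    ring

theorem tensorRep_xdy_topMon (r c l : ℕ) :
    tensorRep k p r c (xdy k p) (C (topMon k p) * X ^ l) =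
      (l : k) • (C (topMon k p) * X ^ (l - 1)) := by
  have h1 : xdy k p (gen k p 0) = 0 := by simp [xdy_apply, del_gen]
  have h2 : xdy k p (gen k p 1) = gen k p 0 := by simp [xdy_apply, del_gen]
  rw [tensorRep_C_mul_X_pow, twist, slope_apply, factor_apply, divergence_apply, h1, h2, xdy_apply,
    gen_mul_del_topMon_of_ne (by decide), C_smul_eq]
  simp [del_gen]

/-- For `y ∂_x` the factor is `t` and the slope is `-t^2`, giving `r - l`. The correction in `lower`
has coefficient in `(x, y)^2`, and even its derivatives annihilate the top monomial. -/
theorem tensorRep_lower_topMon (hp : 5 ≤ p) (r c l : ℕ) :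
    tensorRep k p r c (lower k p) (C (topMon k p) * X ^ l) =
      ((r : k) - l) • (C (topMon k p) * X ^ (l + 1)) := by
  have h1 := lower_gen_zero (k := k) hp
  have h2 := lower_gen_one_mem (k := k) hp
  have h3 : lower k p (topMon k p) = 0 := by
    rw [lower_apply hp, gen_mul_del_topMon_of_ne (by decide), pow_two, ← mul_assoc,
      mul_assoc _ _ (del k p 1 _), gen_mul_del_topMon, mul_neg,
      mul_topMon (Ideal.mul_mem_left _ _ (gen_mem_maxIdeal 1)), neg_zero, smul_zero, sub_zero]
  have h4 : ∀ i, C (del k p i (lower k p (gen k p 1))) * C (topMon k p) = 0 := fun i => by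
    rw [← C_mul, mul_topMon, C_0]
    simpa using del_mem_pow (del k p i) h2
  have h5 := h4 0
  have h6 := h4 1
  rw [tensorRep_C_mul_X_pow, twist, slope_apply, factor_apply, divergence_apply, h1, h3, C_smul_eq]
  simp only [del_gen]
  rcases l with _ | l
  · simp
    linear_combination c * h6
  · simp
    linear_combination ((l : (TruncPoly k p)[X]) + 1) * X ^ l * h5 +
      ((l : (TruncPoly k p)[X]) + 1) * X ^ (l + 1) * h6 + c * X ^ (l + 1) * h6

theorem topMon_mem : topMon k p ∈ maxIdeal k p ^ (2 * p - 2) := by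
  rw [show 2 * p - 2 = (p - 1) + (p - 1) by omega, pow_add]
  exact Ideal.mul_mem_mul (Ideal.pow_mem_pow (gen_mem_maxIdeal 0) _)
    (Ideal.pow_mem_pow (gen_mem_maxIdeal 1) _)

theorem tensorRep_HhatFilt_one_topMon (r c : ℕ) {D : Witt k p} (hD : D ∈ HhatFilt k p 1)
    (ψ : (TruncPoly k p)[X]) : tensorRep k p r c D (C (topMon k p) * ψ) = 0 := by
  have := tensorRep_mem_map r c hD.2 (Ideal.mul_mem_right ψ _
    (Ideal.mem_map_of_mem C (topMon_mem (k := k) (p := p))))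
  have hp := (Fact.out : p.Prime).two_le
  rw [show 1 + (2 * p - 2) = 2 * p - 1 by omega, maxIdeal_pow_eq_bot, Ideal.map_bot] at this
  simpa using this

/-- The highest weight module of highest weight `(a, b)` maps to the top component of a tensor
module. -/
theorem exists_equivariant
    (hinfl : ∀ D : HhatFilt k p 0, (D : Witt k p) ∈ HhatFilt k p 1 → ∀ m : M, ⁅D, m⁆ = 0)
    (hp : 5 ≤ p) {a b : k} {m : M}
    (hm : IsMaximalVector (HhatFilt k p 0) (borel_le_HhatFilt hp) a b m)
    {r c : ℕ} (hr : a - b = r) (hc : (c : k) = b + 1)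
    (htop : (act M (lower_mem k hp) ^ (r + 1)) m = 0)
    (B : Module.Basis (Fin (r + 1)) k M) (hB : ∀ l, B l = (act M (lower_mem k hp) ^ (l : ℕ)) m) :
    ∃ Θ : M →ₗ[k] (TruncPoly k p)[X],
      (∀ l < r + 1, Θ ((act M (lower_mem k hp) ^ l) m) =
        (r.descFactorial l : k) • (C (topMon k p) * X ^ l)) ∧
      ∀ (D : HhatFilt k p 0) (n : M), Θ ⁅D, n⁆ = tensorRep k p r c D (Θ n) := by
  set f := act M (lower_mem k hp) with hf
  have em : act M (xdy_mem k hp) m = 0 := hm.nil_lie _ xdy_mem_nilpart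
  have key := sl_two_lowering (act_xdy_lower hinfl hp) (act_xdx_lower hinfl hp)
    (act_ydy_lower hinfl hp) em hm.xdx_lie hm.ydy_lie
  rw [hr] at key
  have ha : a = r + c - 1 := by rw [hc, ← hr]; ring
  have hb : b = c - 1 := by rw [hc]; ring
  have hfs : ∀ l, f ((f ^ l) m) = (f ^ (l + 1)) m := fun l => by
    rw [pow_succ', Module.End.mul_apply]
  -- Iterating the factor `r - l` by which `lower` acts yields the falling factorial.
  let Θ : M →ₗ[k] (TruncPoly k p)[X] := B.constr k fun l : Fin (r + 1) =>
    (r.descFactorial l : k) • (C (topMon k p) * X ^ (l : ℕ))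
  have hΘ : ∀ l < r + 1, Θ ((f ^ l) m) =
      (r.descFactorial l : k) • (C (topMon k p) * X ^ l) := fun l hl => by
    rw [← hB ⟨l, hl⟩, Module.Basis.constr_basis]
  have ext : ∀ (A : Module.End k M) (D : Witt k p), (∀ l < r + 1, Θ (A ((f ^ l) m)) =
      tensorRep k p r c D (Θ ((f ^ l) m))) → ∀ n, Θ (A n) = tensorRep k p r c D (Θ n) := by
    intro A D h n
    have : Θ ∘ₗ A = tensorRep k p r c D ∘ₗ Θ := B.ext fun l => by
      rw [hB]
      exact h l l.2
    exact LinearMap.congr_fun this n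
  have c1 := ext (act M (xdx_mem k hp)) (xdx k p) fun l hl => by
    rw [(key l).1, map_smul, hΘ l hl, map_smul, tensorRep_xdx_topMon, smul_comm, ha]
  have c4 := ext (act M (ydy_mem k hp)) (ydy k p) fun l hl => by
    rw [(key l).2.1, map_smul, hΘ l hl, map_smul, tensorRep_ydy_topMon, smul_comm, hb]
  have c2 := ext (act M (lower_mem k hp)) (lower k p) fun l hl => by
    rw [← hf, hfs, hΘ l hl, map_smul, tensorRep_lower_topMon hp]
    rcases Nat.lt_or_ge (l + 1) (r + 1) with h | h
    · rw [hΘ _ h, smul_smul, Nat.descFactorial_succ, Nat.cast_mul, Nat.cast_sub (by omega),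
        mul_comm]
    · obtain rfl : l = r := by omega
      rw [htop, map_zero, sub_self, zero_smul, smul_zero]
  have c3 := ext (act M (xdy_mem k hp)) (xdy k p) fun l hl => by
    rw [hΘ l hl, map_smul, tensorRep_xdy_topMon]
    rcases l with _ | l
    · rw [pow_zero, Module.End.one_apply, em]; simp
    · rw [(key l).2.2, map_smul, hΘ l (by omega), smul_smul, smul_smul, Nat.descFactorial_succ,
        Nat.cast_mul, Nat.cast_sub (by omega), Nat.add_sub_cancel]
      congr 1
      push_cast
      ring
  refine ⟨Θ, hΘ, fun D n => ?_⟩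
  obtain ⟨α, β, γ, δ, E, hE, hD, h⟩ := exists_act_eq hinfl hp D
  have hEn : tensorRep k p r c E (Θ n) = 0 := by
    have : tensorRep k p r c E ∘ₗ Θ = 0 := B.ext fun l => by
      rw [LinearMap.comp_apply, hB, hΘ l l.2, map_smul, tensorRep_HhatFilt_one_topMon r c hE,
        smul_zero, LinearMap.zero_apply]
    exact LinearMap.congr_fun this n
  rw [h, hD]
  simp only [map_add, map_smul, LinearMap.add_apply, LinearMap.smul_apply, hEn, c1, c2, c3, c4,
    add_zero]

end SimpleModules

/-! ### Generation of induced modules -/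

section Generation

attribute [local instance 100] LieRing.ofAssociativeRing

variable {k : Type*} [Field k] {p : ℕ} {L L' : LieSubalgebra k (Witt k p)}

/-- The restricted enveloping algebra is generated by the Lie algebra. -/
theorem RestrictedEnv.subalgebra_eq_top (S : Subalgebra k (RestrictedEnv L))
    (h : ∀ D, RestrictedEnv.ι L D ∈ S) : S = ⊤ := by
  let π : TensorAlgebra k L →ₐ[k] RestrictedEnv L :=
    (RestrictedEnv.mk L).comp (UniversalEnvelopingAlgebra.mkAlgHom k L)
  have h₁ : Function.Surjective (UniversalEnvelopingAlgebra.mkAlgHom k L) :=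
    fun z => RingCon.mkₐ_surjective _ z
  have h₂ : Function.Surjective (RestrictedEnv.mk L) := RingQuot.mkAlgHom_surjective k (PowRel L)
  have hπ : Function.Surjective π := h₂.comp h₁
  have hcomap : S.comap π = ⊤ := by
    rw [eq_top_iff, ← TensorAlgebra.adjoin_range_ι, Algebra.adjoin_le_iff]
    rintro _ ⟨D, rfl⟩
    exact h D
  rw [eq_top_iff]
  intro a _
  obtain ⟨t, rfl⟩ := hπ a
  have : t ∈ S.comap π := hcomap ▸ Algebra.mem_top
  exact this

variable {V : Type*} [AddCommGroup V] [Module k V] [LieRingModule L' V] [LieModule k L' V]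

namespace Induced

variable (h : L' ≤ L) (hV : IsRestricted L' V)

/-- The map `v ↦ 1 ⊗ v`. -/
def incl : V →ₗ[k] Induced h hV where
  toFun := tmul h hV 1
  map_add' v w := by rw [tmul, TensorProduct.tmul_add, map_add]; rfl
  map_smul' a v := by
    rw [tmul, TensorProduct.tmul_smul]
    rfl

theorem incl_apply (v : V) : incl h hV v = tmul h hV 1 v := rfl

theorem smul_incl (a : RestrictedEnv L) (v : V) : a • incl h hV v = tmul h hV a v := by
  change (balancing h hV).mkQ (a • (1 ⊗ₜ[k] v)) = (balancing h hV).mkQ (a ⊗ₜ[k] v)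
  rw [TensorProduct.smul_tmul', smul_eq_mul, mul_one]

/-- This is the balancing relation with `a = 1` and `w` the image of `D`. -/
theorem lie_incl (D : L') (v : V) :
    ⁅LieSubalgebra.inclusion h D, incl h hV v⁆ = incl h hV ⁅D, v⁆ := by
  have e : (balancing h hV).mkQ ((1 * RestrictedEnv.incl h (RestrictedEnv.ι L' D)) ⊗ₜ[k] v
      - 1 ⊗ₜ[k] (hV.rep (RestrictedEnv.ι L' D) v)) = 0 := by
    rw [Submodule.mkQ_apply, Submodule.Quotient.mk_eq_zero]
    exact Submodule.subset_span ⟨1, _, v, rfl⟩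
  rw [map_sub, sub_eq_zero, one_mul, RestrictedEnv.incl_ι, IsRestricted.rep_ι] at e
  rw [incl_apply, lie_tmul, mul_one]
  exact e

/-- An induced module is generated by `1 ⊗ V`. -/
theorem submodule_eq_top (S : Submodule k (Induced h hV)) (hS : ∀ v, incl h hV v ∈ S)
    (hL : ∀ (D : L), ∀ z ∈ S, ⁅D, z⁆ ∈ S) : S = ⊤ := by
  -- The elements of `u(L)` preserving `S` form a subalgebra; it contains `L`, hence is everything.
  let T : Subalgebra k (RestrictedEnv L) :=
    { carrier := {a | ∀ z ∈ S, a • z ∈ S}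
      mul_mem' := fun {a b} ha hb z hz => by rw [mul_smul]; exact ha _ (hb _ hz)
      add_mem' := fun {a b} ha hb z hz => by rw [add_smul]; exact add_mem (ha _ hz) (hb _ hz)
      algebraMap_mem' := fun c z hz => by
        rw [algebraMap_smul]; exact S.smul_mem _ hz }
  have hT : T = ⊤ := RestrictedEnv.subalgebra_eq_top T hL
  rw [eq_top_iff]
  intro z _
  obtain ⟨t, rfl⟩ := (balancing h hV).mkQ_surjective z
  induction t with
  | zero => rw [map_zero]; exact zero_mem S
  | add s t hs ht => rw [map_add]; exact add_mem (hs trivial) (ht trivial)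
  | tmul a v =>
    have ha : a ∈ T := hT ▸ Algebra.mem_top
    have := ha _ (hS v)
    rwa [smul_incl] at this

theorem isRestricted : IsRestricted L (Induced h hV) := by
  intro D E hDE
  have hpow : ∀ (n : ℕ) (z : Induced h hV),
      (LieModule.toEnd k L (Induced h hV) D ^ n) z = RestrictedEnv.ι L D ^ n • z := by
    intro n
    induction n with
    | zero => intro z; rw [pow_zero, pow_zero, one_smul]; rfl
    | succ n ih =>
      intro z
      rw [pow_succ', pow_succ', Module.End.mul_apply, ih, mul_smul]
      rfl
  ext z
  rw [hpow, RestrictedEnv.ι_pow D E hDE]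
  rfl

/-- The universal property of induced modules. -/
theorem exists_lift {W : Type*} [AddCommGroup W] [Module k W]
    (ρ : L →ₗ⁅k⁆ Module.End k W)
    (hρ : ∀ D E : L, ((E : Witt k p) : TruncPoly k p →ₗ[k] TruncPoly k p) =
      ((D : Witt k p) : Module.End k (TruncPoly k p)) ^ p → ρ D ^ p = ρ E)
    (θ : V →ₗ[k] W) (hθ : ∀ (D : L') v, θ ⁅D, v⁆ = ρ (LieSubalgebra.inclusion h D) (θ v)) :
    ∃ T : Induced h hV →ₗ[k] W, (∀ v, T (incl h hV v) = θ v) ∧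
      ∀ (D : L) z, T ⁅D, z⁆ = ρ D (T z) := by
  let ψ : RestrictedEnv L →ₐ[k] Module.End k W := RestrictedEnv.lift L ρ hρ
  have hψ : ∀ D, ψ (RestrictedEnv.ι L D) = ρ D := RestrictedEnv.lift_ι L ρ hρ
  have hθ' : ∀ (w : RestrictedEnv L') v,
      θ (hV.rep w v) = ψ (RestrictedEnv.incl h w) (θ v) := by
    let S : Subalgebra k (RestrictedEnv L') :=
      { carrier := {w | ∀ v, θ (hV.rep w v) = ψ (RestrictedEnv.incl h w) (θ v)}
        mul_mem' := fun {a b} ha hb v => by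
          rw [map_mul, map_mul, map_mul, Module.End.mul_apply, Module.End.mul_apply, ha, hb]
        add_mem' := fun {a b} ha hb v => by
          rw [map_add, map_add, map_add, LinearMap.add_apply, LinearMap.add_apply, map_add, ha, hb]
        algebraMap_mem' := fun c v => by
          simp only [AlgHom.commutes, Module.algebraMap_end_apply, map_smul] }
    have hS : S = ⊤ := RestrictedEnv.subalgebra_eq_top S fun D v => by
      rw [IsRestricted.rep_ι, RestrictedEnv.incl_ι, hψ, hθ]
    intro w v
    have hw : w ∈ S := hS ▸ Algebra.mem_top
    exact hw v
  let T₀ : RestrictedEnv L ⊗[k] V →ₗ[k] W :=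
    TensorProduct.lift ((LinearMap.lcomp k W θ).comp ψ.toLinearMap)
  have hT₀ : ∀ a v, T₀ (a ⊗ₜ[k] v) = ψ a (θ v) := fun a v => rfl
  have hsmul : ∀ (a : RestrictedEnv L) z, T₀ (a • z) = ψ a (T₀ z) := fun a z => by
    induction z with
    | zero => simp
    | add y z hy hz => rw [smul_add, map_add, map_add, map_add, hy, hz]
    | tmul b v =>
      rw [TensorProduct.smul_tmul', hT₀, hT₀, smul_eq_mul, map_mul, Module.End.mul_apply]
  have hker : (balancing h hV).restrictScalars k ≤ LinearMap.ker T₀ := by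
    intro z hz
    refine Submodule.span_induction (p := fun z _ => T₀ z = 0) ?_ ?_ ?_ ?_
      (show z ∈ balancing h hV from hz)
    · rintro _ ⟨a, w, v, rfl⟩
      rw [map_sub, hT₀, hT₀, hθ', map_mul, Module.End.mul_apply, sub_self]
    · rw [map_zero]
    · intro y z _ _ hy hz; rw [map_add, hy, hz, add_zero]
    · intro a z _ hz; rw [hsmul, hz, map_zero]
  let e := Submodule.Quotient.restrictScalarsEquiv k (balancing h hV)
  let T : Induced h hV →ₗ[k] W :=
    (Submodule.liftQ _ T₀ hker).comp e.symm.toLinearMap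
  have hT : ∀ z, T ((balancing h hV).mkQ z) = T₀ z := fun z => rfl
  refine ⟨T, fun v => ?_, fun D z => ?_⟩
  · rw [incl_apply, tmul, hT, hT₀, map_one, Module.End.one_apply]
  · obtain ⟨t, rfl⟩ := (balancing h hV).mkQ_surjective z
    have e2 : (⁅D, ((balancing h hV).mkQ t : Induced h hV)⁆ : Induced h hV) =
        (balancing h hV).mkQ (RestrictedEnv.ι L D • t) := rfl
    rw [e2, hT, hT, hsmul, hψ]

end Induced

end Generation

/-! ### A spanning set of `Z(M)` -/

section Spanning

variable {k : Type*} [Field k] {p : ℕ} [CharP k p] [Fact p.Prime]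
  {M : Type*} [AddCommGroup M] [Module k M] [LieRingModule (HhatFilt k p 0) M]
  [LieModule k (HhatFilt k p 0) M] (hM : IsRestricted (HhatFilt k p 0) M)

/-- The map `v ↦ 1 ⊗ v` to `Z(M)`. -/
abbrev zIncl : M →ₗ[k] Z hM := Induced.incl (HhatFilt_le k p 0) hM

/-- The action on `Z(M)` of a derivation in `Ĥ`. -/
abbrev zAct {D : Witt k p} (hD : D ∈ Hhat k p) : Module.End k (Z hM) :=
  LieModule.toEnd k (Hhat k p) (Z hM) ⟨D, hD⟩

variable (k p) in
theorem hamX_mem : hamX k p ∈ Hhat k p := ham_mem_Hhat _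

variable (k p) in
theorem hamY_mem : hamY k p ∈ Hhat k p := ham_mem_Hhat _

/-- The vector `D₁ ^ i D₂ ^ j ⊗ v` of `Z(M)`. -/
def zMon (i j : ℕ) : M →ₗ[k] Z hM :=
  ((zAct hM (hamX_mem k p) ^ i) ∘ₗ (zAct hM (hamY_mem k p) ^ j)) ∘ₗ zIncl hM

/-- The span of the vectors `D₁ ^ i D₂ ^ j ⊗ v` with `i, j < p` and `i + j < n`. -/
def zFilt (n : ℕ) : Submodule k (Z hM) :=
  Submodule.span k {z | ∃ i j v, i < p ∧ j < p ∧ i + j < n ∧ z = zMon hM i j v}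

variable {hM}

theorem zMon_mem_zFilt {n i j : ℕ} (hi : i < p) (hj : j < p) (hij : i + j < n) (v : M) :
    zMon hM i j v ∈ zFilt hM n := Submodule.subset_span ⟨i, j, v, hi, hj, hij, rfl⟩

theorem zFilt_mono {n n' : ℕ} (h : n ≤ n') : zFilt hM n ≤ zFilt hM n' := by
  refine Submodule.span_mono ?_
  rintro _ ⟨i, j, v, hi, hj, hij, rfl⟩
  exact ⟨i, j, v, hi, hj, by omega, rfl⟩

theorem map_mem_of_zFilt {n : ℕ} {U : Submodule k (Z hM)} (A : Module.End k (Z hM))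
    (hA : ∀ i j v, i < p → j < p → i + j < n → A (zMon hM i j v) ∈ U) :
    ∀ z ∈ zFilt hM n, A z ∈ U := fun z hz => by
  refine Submodule.span_induction (p := fun z _ => A z ∈ U) ?_ ?_ ?_ ?_ hz
  · rintro _ ⟨i, j, v, hi, hj, hij, rfl⟩; exact hA i j v hi hj hij
  · rw [map_zero]; exact zero_mem _
  · intro y z _ _ hy hz; rw [map_add]; exact add_mem hy hz
  · intro a z _ hz; rw [map_smul]; exact U.smul_mem _ hz

theorem zAct_zAct {D E : Witt k p} (hD : D ∈ Hhat k p) (hE : E ∈ Hhat k p) (z : Z hM) :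
    zAct hM hD (zAct hM hE z) = zAct hM hE (zAct hM hD z)
      + zAct hM ((Hhat k p).lie_mem hD hE) z := by
  rw [← sub_eq_iff_eq_add']
  exact (lie_lie (⟨D, hD⟩ : Hhat k p) (⟨E, hE⟩ : Hhat k p) z).symm

theorem zMon_succ_left (i j : ℕ) (v : M) :
    zAct hM (hamX_mem k p) (zMon hM i j v) = zMon hM (i + 1) j v := by
  rw [zMon, zMon, pow_succ']; rfl

theorem zMon_zero_succ (j : ℕ) (v : M) :
    zAct hM (hamY_mem k p) (zMon hM 0 j v) = zMon hM 0 (j + 1) v := by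
  rw [zMon, zMon, pow_succ']; rfl

theorem zMon_zero_zero (v : M) : zMon hM 0 0 v = zIncl hM v := rfl

theorem zAct_zIncl {D : Witt k p} (hD : D ∈ HhatFilt k p 0) (v : M) :
    zAct hM (HhatFilt_le k p 0 hD) (zIncl hM v) = zIncl hM (act M hD v) :=
  Induced.lie_incl (HhatFilt_le k p 0) hM ⟨D, hD⟩ v

theorem zMon_p_left (hp : 5 ≤ p) (j : ℕ) (v : M) : zMon hM p j v =
    zAct hM (HhatFilt_le k p 0 (ydy_mem k hp)) (zMon hM 0 j v) := by
  have := Induced.isRestricted (HhatFilt_le k p 0) hM ⟨_, hamX_mem k p⟩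
    ⟨_, HhatFilt_le k p 0 (ydy_mem k hp)⟩ (hamX_pow_char hp)
  rw [zMon, zMon, this]
  rfl

theorem zMon_zero_p (v : M) : zMon hM 0 p v = 0 := by
  have := Induced.isRestricted (HhatFilt_le k p 0) hM ⟨_, hamY_mem k p⟩ 0 hamY_pow_char
  rw [zMon, this, map_zero]
  rfl

/-- The action of `Ĥ` on `Z(M)` in terms of the action of `Ĥ_(0)`, `D₁` and `D₂`. -/
theorem zAct_mem_of {U : Submodule k (Z hM)} {z : Z hM}
    (h0 : ∀ D (hD : D ∈ HhatFilt k p 0), zAct hM (HhatFilt_le k p 0 hD) z ∈ U)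
    (hX : zAct hM (hamX_mem k p) z ∈ U) (hY : zAct hM (hamY_mem k p) z ∈ U)
    {D : Witt k p} (hD : D ∈ Hhat k p) : zAct hM hD z ∈ U := by
  obtain ⟨α, β, h⟩ := exists_sub_mem_HhatFilt_zero hD
  have e : (⟨D, hD⟩ : Hhat k p) = ⟨_, HhatFilt_le k p 0 h⟩
      + (α • ⟨_, hamX_mem k p⟩ + β • ⟨_, hamY_mem k p⟩) :=
    Subtype.ext (sub_add_cancel D _).symm
  have : zAct hM hD z = zAct hM (HhatFilt_le k p 0 h) z
      + (α • zAct hM (hamX_mem k p) z + β • zAct hM (hamY_mem k p) z) := by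
    rw [zAct, e, map_add, map_add, map_smul, map_smul]
    rfl
  rw [this]
  exact add_mem (h0 _ h) (add_mem (U.smul_mem _ hX) (U.smul_mem _ hY))

/-- Straightening by induction on word length, with the three claims proved together. Moving an
operator past the leftmost `D₁` or `D₂` leaves a commutator in `Ĥ` acting on a shorter word, which
costs at most one in length. Overflowing powers disappear since `D₁^p` acts as `y ∂_y` and `D₂^p` as
zero. -/
theorem zFilt_stable (hp : 5 ≤ p) (n : ℕ) :
    (∀ D (hD : D ∈ HhatFilt k p 0), ∀ z ∈ zFilt hM n,
      zAct hM (HhatFilt_le k p 0 hD) z ∈ zFilt hM n) ∧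
    (∀ z ∈ zFilt hM n, zAct hM (hamX_mem k p) z ∈ zFilt hM (n + 1)) ∧
    (∀ z ∈ zFilt hM n, zAct hM (hamY_mem k p) z ∈ zFilt hM (n + 1)) := by
  induction n with
  | zero =>
    refine ⟨fun D hD => map_mem_of_zFilt _ ?_, map_mem_of_zFilt _ ?_, map_mem_of_zFilt _ ?_⟩ <;>
      intro i j v hi hj hij <;> omega
  | succ n ih =>
    obtain ⟨ih0, ihX, ihY⟩ := ih
    have ihD : ∀ {D : Witt k p} (hD : D ∈ Hhat k p), ∀ z ∈ zFilt hM n,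
        zAct hM hD z ∈ zFilt hM (n + 1) := fun hD z hz =>
      zAct_mem_of (fun D hD => zFilt_mono (Nat.le_succ n) (ih0 D hD z hz)) (ihX z hz) (ihY z hz) hD
    have h0 : ∀ D (hD : D ∈ HhatFilt k p 0), ∀ z ∈ zFilt hM (n + 1),
        zAct hM (HhatFilt_le k p 0 hD) z ∈ zFilt hM (n + 1) := fun D hD =>
      map_mem_of_zFilt _ fun i j v hi hj hij => by
        rcases i with _ | i
        · rcases j with _ | j
          · rw [zMon_zero_zero, zAct_zIncl hD, ← zMon_zero_zero]
            exact zMon_mem_zFilt hi hj hij _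
          · have hz := zMon_mem_zFilt (hM := hM) (n := n) hi (show j < p by omega) (by omega) v
            rw [← zMon_zero_succ, zAct_zAct]
            exact add_mem (ihY _ (ih0 D hD _ hz)) (ihD _ _ hz)
        · have hz := zMon_mem_zFilt (hM := hM) (n := n) (show i < p by omega) hj (by omega) v
          rw [← zMon_succ_left, zAct_zAct]
          exact add_mem (ihX _ (ih0 D hD _ hz)) (ihD _ _ hz)
    have hX : ∀ z ∈ zFilt hM (n + 1), zAct hM (hamX_mem k p) z ∈ zFilt hM (n + 1 + 1) :=
      map_mem_of_zFilt _ fun i j v hi hj hij => by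
        rw [zMon_succ_left]
        rcases Nat.lt_or_ge (i + 1) p with h | h
        · exact zMon_mem_zFilt h hj (by omega) v
        · obtain h : i + 1 = p := by omega
          rw [h, zMon_p_left hp]
          have hz := zMon_mem_zFilt (hM := hM) (n := n + 1) (show 0 < p by omega) hj (by omega) v
          exact zFilt_mono (Nat.le_succ (n + 1)) (h0 (ydy k p) (ydy_mem k hp) _ hz)
    refine ⟨h0, hX, map_mem_of_zFilt _ fun i j v hi hj hij => ?_⟩
    rcases i with _ | i
    · rw [zMon_zero_succ]
      rcases Nat.lt_or_ge (j + 1) p with h | h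
      · exact zMon_mem_zFilt hi h (by omega) v
      · obtain h : j + 1 = p := by omega
        rw [h, zMon_zero_p]
        exact zero_mem _
    · have hz := zMon_mem_zFilt (hM := hM) (n := n) (show i < p by omega) hj (by omega) v
      rw [← zMon_succ_left, zAct_zAct]
      exact add_mem (hX _ (ihY _ hz)) (zFilt_mono (by omega)
        (ih0 _ (lie_hamY_hamX_mem (k := k) hp) _ hz))

/-- With `i, j < p` the bound `i + j < 2 * p` is no restriction, so the filtration is stationary
there and stable under `Ĥ`. -/
theorem zFilt_eq_top (hp : 5 ≤ p) : zFilt hM (2 * p) = ⊤ := by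
  have hmax : zFilt hM (2 * p + 1) ≤ zFilt hM (2 * p) := by
    refine Submodule.span_mono ?_
    rintro _ ⟨i, j, v, hi, hj, hij, rfl⟩
    exact ⟨i, j, v, hi, hj, by omega, rfl⟩
  obtain ⟨h0, hX, hY⟩ := zFilt_stable (hM := hM) hp (2 * p)
  refine Induced.submodule_eq_top _ _ _ (fun v => ?_) fun D z hz => ?_
  · exact zMon_mem_zFilt (hM := hM) (i := 0) (j := 0) (by omega) (by omega) (by omega) v
  · exact zAct_mem_of (fun D hD => h0 D hD z hz) (hmax (hX z hz)) (hmax (hY z hz)) D.2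

/-- The dimension of `Z(M)` is at most `p ^ 2 dim M`. -/
theorem span_zMon_basis (hp : 5 ≤ p) {ι : Type*} (B : Module.Basis ι k M) :
    Submodule.span k (Set.range fun q : (Fin p × Fin p) × ι => zMon hM q.1.1 q.1.2 (B q.2)) = ⊤ := by
  rw [eq_top_iff, ← zFilt_eq_top hp, zFilt, Submodule.span_le]
  rintro _ ⟨i, j, v, hi, hj, -, rfl⟩
  have : v ∈ Submodule.span k (Set.range B) := B.span_eq ▸ Submodule.mem_top
  refine Submodule.span_induction (p := fun v _ => zMon hM i j v ∈ Submodule.span k _) ?_ ?_ ?_ ?_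
    this
  · rintro _ ⟨l, rfl⟩
    exact Submodule.subset_span ⟨((⟨i, hi⟩, ⟨j, hj⟩), l), rfl⟩
  · rw [map_zero]; exact zero_mem _
  · intro v w _ _ hv hw; rw [map_add]; exact add_mem hv hw
  · intro a v _ hv; rw [map_smul]; exact Submodule.smul_mem _ _ hv

end Spanning

/-! ### Coefficients of the elements of a tensor module -/

section TensorCoefficients

open Polynomial

variable {k : Type*} [Field k] {p : ℕ} [CharP k p] [Fact p.Prime]

/-- The coefficients of `x ^ i y ^ j t ^ l` for `i, j < p` and `l ≤ r`. -/
def tensorCoeff (r : ℕ) :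
    (TruncPoly k p)[X] →ₗ[k] ((Fin p × Fin p) × Fin (r + 1) → k) :=
  LinearMap.pi fun q => (cf q.1.1 q.1.2).comp
    ((lcoeff (TruncPoly k p) (q.2 : ℕ)).restrictScalars k)

theorem tensorCoeff_apply (r : ℕ) (φ : (TruncPoly k p)[X]) (q : (Fin p × Fin p) × Fin (r + 1)) :
    tensorCoeff r φ q = cf q.1.1 q.1.2 (φ.coeff q.2) := rfl

theorem tensorCoeff_monomial (r : ℕ) (q : (Fin p × Fin p) × Fin (r + 1)) :
    tensorCoeff r (C (gen k p 0 ^ (q.1.1 : ℕ) * gen k p 1 ^ (q.1.2 : ℕ)) * X ^ (q.2 : ℕ)) =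
      Pi.single q 1 := by
  funext q'
  rw [tensorCoeff_apply, coeff_C_mul, coeff_X_pow, Pi.single_apply]
  by_cases h : q' = q
  · subst h
    rw [if_pos rfl, if_pos rfl, mul_one, cf_pow_mul_pow q'.1.1.2 q'.1.2.2, if_pos ⟨rfl, rfl⟩]
  · rw [if_neg h]
    by_cases hl : (q'.2 : ℕ) = q.2
    · rw [if_pos hl, mul_one, cf_pow_mul_pow q.1.1.2 q.1.2.2, if_neg]
      rintro ⟨h0, h1⟩
      exact h (Prod.ext (Prod.ext (Fin.ext h0) (Fin.ext h1)) (Fin.ext hl))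
    · rw [if_neg hl, mul_zero, map_zero]

theorem tensorRep_hamY (r c : ℕ) (f : TruncPoly k p) (l : ℕ) :
    tensorRep k p r c (hamY k p) (C f * X ^ l) = C (del k p 1 f) * X ^ l := by
  rw [tensorRep_C_mul_X_pow, twist, slope_apply, factor_apply, divergence_apply]
  simp [hamY_apply, del_gen]

theorem tensorRep_hamX (r c : ℕ) (f : TruncPoly k p) (l : ℕ) :
    tensorRep k p r c (hamX k p) (C f * X ^ l) =
      C (dpow k p 0 (p - 1) * gen k p 1 * del k p 1 f - del k p 0 f) * X ^ l
        + (l : (TruncPoly k p)[X]) * C (del k p 0 (dpow k p 0 (p - 1)) * gen k p 1 * f) * X ^ (l - 1)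
        + (l : (TruncPoly k p)[X]) * C (dpow k p 0 (p - 1) * f) * X ^ (l - 1) * X
        + (c : (TruncPoly k p)[X]) * C (dpow k p 0 (p - 1) * f) * X ^ l := by
  have hu : del k p 1 (dpow k p 0 (p - 1)) = 0 := del_dpow_ne (by decide) _
  have h0 : hamX k p (gen k p 0) = -1 := by simp [hamX_apply, del_gen]
  have h1 : hamX k p (gen k p 1) = dpow k p 0 (p - 1) * gen k p 1 := by simp [hamX_apply, del_gen]
  rw [tensorRep_C_mul_X_pow, twist, slope_apply, factor_apply, divergence_apply, h0, h1,
    hamX_apply]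
  simp [del_gen, hu]
  ring

theorem cast_ne_zero_of_lt {n : ℕ} (h : 0 < n) (h' : n < p) : (n : k) ≠ 0 := fun h0 =>
  absurd (Nat.le_of_dvd h ((CharP.cast_eq_zero_iff k p n).1 h0)) (by omega)

theorem natCast_mul_eq_smul (n : ℕ) (φ : (TruncPoly k p)[X]) :
    (n : (TruncPoly k p)[X]) * φ = (n : k) • φ := by
  rw [← nsmul_eq_mul, Nat.cast_smul_eq_nsmul]

/-- A subspace of a tensor module that is stable under `-∂_x + x^(p-1) y ∂_y` and `∂_y` and
contains `x ^ (p - 1) y ^ (p - 1) t ^ l` for `l ≤ r` contains `x ^ i y ^ j t ^ l` for `l ≤ r`. -/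
theorem monomial_mem_of_stable (hp : 5 ≤ p) {r c : ℕ} {U : Submodule k (TruncPoly k p)[X]}
    (htop : ∀ l < r + 1, C (topMon k p) * X ^ l ∈ U)
    (hX : ∀ φ ∈ U, tensorRep k p r c (hamX k p) φ ∈ U)
    (hY : ∀ φ ∈ U, tensorRep k p r c (hamY k p) φ ∈ U) {i j l : ℕ} (hi : i < p) (hj : j < p)
    (hl : l < r + 1) : C (gen k p 0 ^ i * gen k p 1 ^ j) * X ^ l ∈ U := by
  -- Descend in `y` along the edge `x^(p-1)` by applying `∂_y`; the exponents that appear as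
  -- coefficients are invertible.
  have step1 : ∀ n < p, ∀ l < r + 1, C (gen k p 0 ^ (p - 1) * gen k p 1 ^ (p - 1 - n)) * X ^ l ∈ U := by
    intro n
    induction n with
    | zero => exact fun _ l hl => htop l hl
    | succ n ih =>
      intro hn l hl
      have h := hY _ (ih (by omega) l hl)
      have e : p - 1 - n = (p - 1 - (n + 1)) + 1 := by omega
      have e2 : del k p 1 (gen k p 0 ^ (p - 1) * gen k p 1 ^ (p - 1 - n)) =
          ((p - 1 - n : ℕ) : k) • (gen k p 0 ^ (p - 1) * gen k p 1 ^ (p - 1 - (n + 1))) := by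
        rw [Derivation.leibniz, Derivation.leibniz_pow, Derivation.leibniz_pow, del_gen, del_gen,
          show p - 1 - (n + 1) = p - 1 - n - 1 by omega]
        simp [Nat.cast_smul_eq_nsmul]
        ring
      rw [tensorRep_hamY, e2, ← smul_C, smul_mul_assoc] at h
      exact (Submodule.smul_mem_iff _ (cast_ne_zero_of_lt (by omega) (by omega))).1 h
  have hu : ∀ j, ∀ l < r + 1, C (dpow k p 0 (p - 1) * gen k p 1 ^ j) * X ^ l ∈ U := by
    intro j l hl
    rw [show (p : ℤ) - 1 = (p - 1 : ℕ) by omega, dpow_nat, smul_mul_assoc, ← smul_C,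
      smul_mul_assoc]
    refine U.smul_mem _ ?_
    rcases Nat.lt_or_ge j p with h | h
    · have := step1 (p - 1 - j) (by omega) l hl
      rwa [show p - 1 - (p - 1 - j) = j by omega] at this
    · rw [pow_eq_zero_of_le h (gen_pow 1)]; simp
  have hu' : ∀ i j, ∀ l < r + 1, C (dpow k p 0 (p - 1) * (gen k p 0 ^ i * gen k p 1 ^ j)) * X ^ l ∈ U := by
    intro i j l hl
    rcases i with _ | i
    · rw [pow_zero, one_mul]; exact hu j l hl
    · rw [pow_succ', ← mul_assoc, ← mul_assoc, mul_comm (dpow k p 0 _), gen_mul_dpow_top]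
      simp
  have hdu : gen k p 0 * del k p 0 (dpow k p 0 (p - 1)) = -dpow k p 0 (p - 1) := by
    have h := congrArg (del k p 0) (gen_mul_dpow_top (k := k) (p := p) 0)
    rw [Derivation.leibniz, del_gen, if_pos rfl, map_zero, smul_eq_mul, smul_eq_mul, mul_one] at h
    exact eq_neg_of_add_eq_zero_left h
  -- Descend in `x` with `D₁`. Besides `-∂_x` it contributes at most a multiple of `x^(p-1) y^(j+1)
  -- t^(l-1)`, on the edge already reached; at `l = 0` its coefficient `l` vanishes.
  have step2 : ∀ n < p, ∀ j < p, ∀ l < r + 1,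
      C (gen k p 0 ^ (p - 1 - n) * gen k p 1 ^ j) * X ^ l ∈ U := by
    intro n
    induction n with
    | zero =>
      intro _ j hj l hl
      have := step1 (p - 1 - j) (by omega) l hl
      rwa [show p - 1 - (p - 1 - j) = j by omega] at this
    | succ n ih =>
      intro hn j hj l hl
      have h := hX _ (ih (by omega) j hj l hl)
      obtain ⟨i, hi⟩ : ∃ i, p - 1 - n = i + 1 := ⟨p - 1 - n - 1, by omega⟩
      rw [show p - 1 - (n + 1) = i by omega]
      have e1 : dpow k p 0 (p - 1) * (gen k p 0 ^ (i + 1) * gen k p 1 ^ j) = 0 := by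
        rw [pow_succ', ← mul_assoc, ← mul_assoc, mul_comm (dpow k p 0 _), gen_mul_dpow_top]
        simp
      have e2 : dpow k p 0 (p - 1) * gen k p 1 * del k p 1 (gen k p 0 ^ (i + 1) * gen k p 1 ^ j) = 0 := by
        rw [Derivation.leibniz, Derivation.leibniz_pow, Derivation.leibniz_pow, del_gen, del_gen]
        simp
        linear_combination gen k p 1 * gen k p 0 ^ i * (j * gen k p 1 ^ (j - 1)) *
          gen_mul_dpow_top (k := k) (p := p) 0
      have e3 : del k p 0 (dpow k p 0 (p - 1)) * gen k p 1 * (gen k p 0 ^ (i + 1) * gen k p 1 ^ j) =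
          -(dpow k p 0 (p - 1) * (gen k p 0 ^ i * gen k p 1 ^ (j + 1))) := by
        linear_combination gen k p 0 ^ i * gen k p 1 ^ (j + 1) * hdu
      have e4 : del k p 0 (gen k p 0 ^ (i + 1) * gen k p 1 ^ j) =
          ((i + 1 : ℕ) : k) • (gen k p 0 ^ i * gen k p 1 ^ j) := by
        rw [Derivation.leibniz, Derivation.leibniz_pow, Derivation.leibniz_pow, del_gen, del_gen,
          Nat.cast_smul_eq_nsmul]
        simp
        ring
      rw [hi, tensorRep_hamX, e1, e2, e3, e4, map_zero, mul_zero, mul_zero, zero_mul, zero_mul,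
        zero_mul, add_zero, add_zero, zero_sub, map_neg, map_neg, mul_assoc, natCast_mul_eq_smul,
        ← smul_C, neg_mul, neg_mul, smul_mul_assoc, smul_neg, ← neg_add, neg_mem_iff] at h
      have h2 := U.smul_mem (l : k) (hu' i (j + 1) (l - 1) (by omega))
      have h3 := (Submodule.add_mem_iff_left U h2).1 h
      exact (Submodule.smul_mem_iff _ (cast_ne_zero_of_lt (by omega) (by omega))).1 h3
  have := step2 (p - 1 - i) (by omega) j hj l hl
  rwa [show p - 1 - (p - 1 - i) = i by omega] at this

end TensorCoefficients

/-! ### The embedding of `Z(M)` into a tensor module -/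

section Embedding

open Polynomial

attribute [local instance 100] LieRing.ofAssociativeRing

variable {k : Type*} [Field k] {p : ℕ} [CharP k p] [Fact p.Prime]
  {M : Type*} [AddCommGroup M] [Module k M] [LieRingModule (HhatFilt k p 0) M]
  [LieModule k (HhatFilt k p 0) M]

/-- For `M` of highest weight `(a, b)` with `a - b ≡ r` and `r < p`, the module `Z(M)` has
dimension `p ^ 2 (r + 1)` and embeds into a tensor module. -/
theorem exists_embedding (hp : 5 ≤ p) (hM : IsRestricted (HhatFilt k p 0) M)
    (hinfl : ∀ D : HhatFilt k p 0, (D : Witt k p) ∈ HhatFilt k p 1 → ∀ m : M, ⁅D, m⁆ = 0)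
    (hsimple : LieModule.IsIrreducible k (HhatFilt k p 0) M) {a b : k} {m : M}
    (hm : IsMaximalVector (HhatFilt k p 0) (borel_le_HhatFilt hp) a b m)
    {r c : ℕ} (hrp : r < p) (hr : a - b = r) (hc : (c : k) = b + 1) :
    ∃ T : Z hM →ₗ[k] (TruncPoly k p)[X],
      (∀ z, tensorCoeff r (T z) = 0 → z = 0) ∧ T (zIncl hM m) = C (topMon k p) ∧
      (∀ (D : Hhat k p) z, T ⁅D, z⁆ = tensorRep k p r c D (T z)) ∧
      Module.finrank k (Z hM) = p ^ 2 * (r + 1) := by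
  obtain ⟨htop, B, hB⟩ := exists_basis_lower_pow hinfl hp hM hsimple hm hrp hr
  obtain ⟨Θ, hΘ, hΘD⟩ := exists_equivariant hinfl hp hm hr hc htop B hB
  obtain ⟨T, hT, hTD⟩ := Induced.exists_lift (HhatFilt_le k p 0) hM
    ((tensorRep k p r c).comp (Hhat k p).incl) (fun D E h => tensorRep_pow_char h r c) Θ hΘD
  have hrange : ∀ D (hD : D ∈ Hhat k p), ∀ φ ∈ LinearMap.range T,
      tensorRep k p r c D φ ∈ LinearMap.range T := by
    rintro D hD _ ⟨z, rfl⟩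
    exact ⟨⁅(⟨D, hD⟩ : Hhat k p), z⁆, hTD _ _⟩
  have htopr : ∀ l < r + 1, C (topMon k p) * X ^ l ∈ LinearMap.range T := fun l hl => by
    have h1 : (r.descFactorial l : k) ≠ 0 := by
      rw [Ne, CharP.cast_eq_zero_iff k p]
      intro h
      have h2 := (Fact.out : p.Prime).dvd_factorial.1
        (h.trans ⟨_, (Nat.factorial_mul_descFactorial (show l ≤ r by omega)).symm.trans
          (mul_comm _ _)⟩)
      omega
    refine (Submodule.smul_mem_iff _ h1).1 ?_
    rw [← hΘ l hl, ← hT]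
    exact ⟨_, rfl⟩
  have hsurj : Function.Surjective ((tensorCoeff r).comp T) := by
    rw [← LinearMap.range_eq_top, eq_top_iff, ← (Pi.basisFun k _).span_eq, Submodule.span_le]
    rintro _ ⟨q, rfl⟩
    rw [Pi.basisFun_apply, ← tensorCoeff_monomial, LinearMap.range_comp]
    exact Submodule.mem_map_of_mem (monomial_mem_of_stable hp htopr (hrange _ (hamX_mem k p))
      (hrange _ (hamY_mem k p)) q.1.1.2 q.1.2.2 q.2.2)
  have hspan := span_zMon_basis (hM := hM) hp B
  have hfin : Module.Finite k (Z hM) := by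
    refine ⟨⟨(Set.finite_range fun q : (Fin p × Fin p) × Fin (r + 1) =>
      zMon hM q.1.1 q.1.2 (B q.2)).toFinset, ?_⟩⟩
    rw [Set.Finite.coe_toFinset, hspan]
  have hcard : Fintype.card ((Fin p × Fin p) × Fin (r + 1)) = p ^ 2 * (r + 1) := by
    simp [pow_two]
  -- The spanning vectors bound the dimension above and the surjection onto coefficients bounds it
  -- below; equality then forces injectivity.
  have hle : Module.finrank k (Z hM) ≤ p ^ 2 * (r + 1) := by
    rw [← hcard, ← finrank_top, ← hspan]
    exact finrank_range_le_card _
  have heq : Module.finrank k (Z hM) = p ^ 2 * (r + 1) := by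
    refine le_antisymm hle ?_
    have := LinearMap.finrank_le_finrank_of_surjective hsurj
    rwa [Module.finrank_fintype_fun_eq_card, hcard] at this
  have hinj : Function.Injective ((tensorCoeff r).comp T) := by
    refine (LinearMap.injective_iff_surjective_of_finrank_eq_finrank ?_).2 hsurj
    rw [heq, Module.finrank_fintype_fun_eq_card, hcard]
  refine ⟨T, fun z hz => hinj (by rw [LinearMap.comp_apply, hz, map_zero]), ?_, hTD, heq⟩
  have := hΘ 0 (by omega)
  rw [hT]
  simpa using this

end Embedding

/-! ### Vectors of a tensor module killed by `N` -/

section Singular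

open Polynomial

variable {k : Type*} [Field k] {p : ℕ} [CharP k p] [Fact p.Prime]

theorem coeff_zero_tensorRep (r c : ℕ) (D : Witt k p) (φ : (TruncPoly k p)[X]) :
    (tensorRep k p r c D φ).coeff 0 = D (φ.coeff 0) + del k p 0 (D (gen k p 1)) * φ.coeff 1
      + (r * del k p 0 (D (gen k p 0)) + c * divergence k p D) * φ.coeff 0 := by
  rw [tensorRep_apply, prolong_apply, coeff_add, coeff_add, coeff_coefDer, mul_coeff_zero,
    mul_coeff_zero, coeff_derivative, twist, slope_apply, factor_apply]
  simp

/-- The slope is quadratic in `t` and multiplies the `t`-derivative, so three consecutive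
coefficients of `φ` interact. -/
theorem coeff_succ_tensorRep (r c : ℕ) (D : Witt k p) (φ : (TruncPoly k p)[X]) (l : ℕ) :
    (tensorRep k p r c D φ).coeff (l + 1) = D (φ.coeff (l + 1))
      + del k p 0 (D (gen k p 1)) * ((l + 2) * φ.coeff (l + 2))
      + (del k p 1 (D (gen k p 1)) - del k p 0 (D (gen k p 0))) * ((l + 1) * φ.coeff (l + 1))
      - del k p 1 (D (gen k p 0)) * (l * φ.coeff l)
      + (r * del k p 0 (D (gen k p 0)) + c * divergence k p D) * φ.coeff (l + 1)
      + r * del k p 1 (D (gen k p 0)) * φ.coeff l := by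
  have h1 : slope k p D * derivative φ = C (del k p 0 (D (gen k p 1))) * derivative φ
      + C (del k p 1 (D (gen k p 1)) - del k p 0 (D (gen k p 0))) * (X * derivative φ)
      - C (del k p 1 (D (gen k p 0))) * (X * (X * derivative φ)) := by
    rw [slope_apply]; ring
  have h2 : twist r c D * φ = C (r * del k p 0 (D (gen k p 0)) + c * divergence k p D) * φ
      + C (r * del k p 1 (D (gen k p 0))) * (X * φ) := by
    rw [twist, factor_apply, nsmul_eq_mul, nsmul_eq_mul]
    simp only [map_add, map_mul, map_natCast]
    ring
  rw [tensorRep_apply, prolong_apply, h1, h2]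
  simp only [coeff_add, coeff_sub, coeff_C_mul, coeff_X_mul, coeff_coefDer]
  rcases l with _ | l
  · simp only [coeff_X_mul_zero, coeff_derivative]
    push_cast
    ring
  · simp only [coeff_X_mul, coeff_derivative]
    push_cast
    ring

theorem ham_mem_nilpart (g : TruncPoly k p) (h0 : ham k p g (gen k p 0) ∈ maxIdeal k p ^ 2)
    (h1 : ham k p g (gen k p 1) ∈ maxIdeal k p ^ 2) : ham k p g ∈ nilpart k p :=
  Submodule.mem_sup_left ⟨ham_mem_Hhat g, fun i => by fin_cases i <;> assumption⟩

/-- A factor `x` kills the correction with `x^(p-1)`, leaving an ordinary Hamiltonian field. -/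
theorem ham_mul_apply (g f : TruncPoly k p) : ham k p (gen k p 0 * g) f =
    (g + gen k p 0 * del k p 0 g) * del k p 1 f - gen k p 0 * del k p 1 g * del k p 0 f := by
  rw [ham_apply, ← mul_assoc, mul_comm (dpow k p 0 _), gen_mul_dpow_top]
  simp [Derivation.leibniz, del_gen]
  ring

theorem gen_mul_gen_mem (i j : Fin 2) : gen k p i * gen k p j ∈ maxIdeal k p ^ 2 := by
  rw [pow_two]; exact Ideal.mul_mem_mul (gen_mem_maxIdeal i) (gen_mem_maxIdeal j)

/-- The equations expressing that a section is killed by `N`. -/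
theorem singular_equations {r c : ℕ} {φ : (TruncPoly k p)[X]}
    (h : ∀ D ∈ nilpart k p, tensorRep k p r c D φ = 0) :
    (∀ l, gen k p 0 * del k p 1 (φ.coeff l) + (l + 1) * φ.coeff (l + 1) = 0) ∧
    (∀ l, gen k p 0 * (gen k p 0 * (3 * del k p 1 (φ.coeff l)))
      + gen k p 0 * (6 * ((l + 1) * φ.coeff (l + 1))) = 0) ∧
    (gen k p 0 * (gen k p 0 * del k p 0 (φ.coeff 0)) + gen k p 0 * (2 * r * φ.coeff 0) = 0) ∧
    (∀ l, gen k p 1 * (gen k p 1 * del k p 1 (φ.coeff (l + 1))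
        - 2 * (gen k p 0 * del k p 0 (φ.coeff (l + 1)))
        + 4 * (l + 1) * φ.coeff (l + 1) - 2 * r * φ.coeff (l + 1))
      + gen k p 0 * (2 * (l - r) * φ.coeff l) = 0) ∧
    (gen k p 1 * (gen k p 1 * del k p 1 (φ.coeff 0) - 2 * (gen k p 0 * del k p 0 (φ.coeff 0))
      - 2 * r * φ.coeff 0) = 0) ∧
    (gen k p 1 * (gen k p 1 * (gen k p 1 * del k p 1 (φ.coeff 0)
      - 3 * (gen k p 0 * del k p 0 (φ.coeff 0)) - 3 * r * φ.coeff 0)) = 0) := by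
  have d2 : ∀ i, del k p i 2 = 0 := fun i => (del k p i).map_natCast 2
  have d3 : ∀ i, del k p i 3 = 0 := fun i => (del k p i).map_natCast 3
  have m00 := gen_mul_gen_mem (k := k) (p := p) 0 0
  have m01 := gen_mul_gen_mem (k := k) (p := p) 0 1
  have m11 := gen_mul_gen_mem (k := k) (p := p) 1 1
  have A : ∀ l, gen k p 0 * del k p 1 (φ.coeff l) + (l + 1) * φ.coeff (l + 1) = 0 := by
    have e0 : xdy k p (gen k p 0) = 0 := by simp [xdy_apply, del_gen]
    have e1 : xdy k p (gen k p 1) = gen k p 0 := by simp [xdy_apply, del_gen]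
    have hD := h _ xdy_mem_nilpart
    intro l
    have hl := congrArg (fun ψ => ψ.coeff l) hD
    rcases l with _ | l
    · simp only [coeff_zero_tensorRep, divergence_apply, e0, e1, xdy_apply] at hl
      simpa [del_gen] using hl
    · simp only [coeff_succ_tensorRep, divergence_apply, e0, e1, xdy_apply] at hl
      simp [del_gen] at hl
      push_cast
      linear_combination hl
  have hham : ∀ g : TruncPoly k p, ham k p (gen k p 0 * g) (gen k p 0) ∈ maxIdeal k p ^ 2 →
      ham k p (gen k p 0 * g) (gen k p 1) ∈ maxIdeal k p ^ 2 →
      tensorRep k p r c (ham k p (gen k p 0 * g)) φ = 0 :=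
    fun g h0 h1 => h _ (ham_mem_nilpart _ h0 h1)
  -- The other equations come from the Hamiltonians `x^3`, `x^2 y`, `x y^2` (in positive `t`-degree,
  -- then in degree zero) and `x y^3`.
  refine ⟨A, ?_, ?_, ?_, ?_, ?_⟩
  · have e0 : ham k p (gen k p 0 * (gen k p 0 * gen k p 0)) (gen k p 0) = 0 := by
      simp [ham_mul_apply, del_gen, Derivation.leibniz]
    have e1 : ham k p (gen k p 0 * (gen k p 0 * gen k p 0)) (gen k p 1) =
        3 * (gen k p 0 * gen k p 0) := by
      simp [ham_mul_apply, del_gen, Derivation.leibniz]; ring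
    have hD := hham (gen k p 0 * gen k p 0) (by rw [e0]; exact zero_mem _)
      (by rw [e1]; exact Ideal.mul_mem_left _ _ m00)
    intro l
    have hl := congrArg (fun ψ => ψ.coeff l) hD
    rcases l with _ | l
    · simp only [coeff_zero_tensorRep, divergence_apply, e0, e1, ham_mul_apply] at hl
      simp [del_gen, Derivation.leibniz, d3] at hl
      push_cast
      linear_combination hl
    · simp only [coeff_succ_tensorRep, divergence_apply, e0, e1, ham_mul_apply] at hl
      simp [del_gen, Derivation.leibniz, d3] at hl
      push_cast
      linear_combination hl
  · have e0 : ham k p (gen k p 0 * (gen k p 0 * gen k p 1)) (gen k p 0) =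
        -(gen k p 0 * gen k p 0) := by
      simp [ham_mul_apply, del_gen, Derivation.leibniz]
    have e1 : ham k p (gen k p 0 * (gen k p 0 * gen k p 1)) (gen k p 1) =
        2 * (gen k p 0 * gen k p 1) := by
      simp [ham_mul_apply, del_gen, Derivation.leibniz]; ring
    have hD := hham (gen k p 0 * gen k p 1) (by rw [e0]; exact neg_mem m00)
      (by rw [e1]; exact Ideal.mul_mem_left _ _ m01)
    have hl := congrArg (fun ψ => ψ.coeff 0) hD
    simp only [coeff_zero_tensorRep, divergence_apply, e0, e1, ham_mul_apply] at hl
    simp [del_gen, Derivation.leibniz, d2] at hl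
    -- The derivative `∂_x (2xy) = 2y` brings in `φ.coeff 1`; the equation of `x ∂_y` removes it.
    have hA := A 0
    simp at hA
    linear_combination 2 * gen k p 1 * hA - hl
  · have e0 : ham k p (gen k p 0 * (gen k p 1 * gen k p 1)) (gen k p 0) =
        -(2 * (gen k p 0 * gen k p 1)) := by
      simp [ham_mul_apply, del_gen, Derivation.leibniz]; ring
    have e1 : ham k p (gen k p 0 * (gen k p 1 * gen k p 1)) (gen k p 1) =
        gen k p 1 * gen k p 1 := by
      simp [ham_mul_apply, del_gen, Derivation.leibniz]
    have hD := hham (gen k p 1 * gen k p 1)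
      (by rw [e0]; exact neg_mem (Ideal.mul_mem_left _ _ m01)) (by rw [e1]; exact m11)
    intro l
    have hl := congrArg (fun ψ => ψ.coeff (l + 1)) hD
    simp only [coeff_succ_tensorRep, divergence_apply, e0, e1, ham_mul_apply] at hl
    simp [del_gen, Derivation.leibniz, d2] at hl
    linear_combination hl
  · have e0 : ham k p (gen k p 0 * (gen k p 1 * gen k p 1)) (gen k p 0) =
        -(2 * (gen k p 0 * gen k p 1)) := by
      simp [ham_mul_apply, del_gen, Derivation.leibniz]; ring
    have e1 : ham k p (gen k p 0 * (gen k p 1 * gen k p 1)) (gen k p 1) =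
        gen k p 1 * gen k p 1 := by
      simp [ham_mul_apply, del_gen, Derivation.leibniz]
    have hD := hham (gen k p 1 * gen k p 1)
      (by rw [e0]; exact neg_mem (Ideal.mul_mem_left _ _ m01)) (by rw [e1]; exact m11)
    have hl := congrArg (fun ψ => ψ.coeff 0) hD
    simp only [coeff_zero_tensorRep, divergence_apply, e0, e1, ham_mul_apply] at hl
    simp [del_gen, Derivation.leibniz, d2] at hl
    linear_combination hl
  · have e0 : ham k p (gen k p 0 * (gen k p 1 * (gen k p 1 * gen k p 1))) (gen k p 0) =
        -(3 * gen k p 1 * (gen k p 0 * gen k p 1)) := by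
      simp [ham_mul_apply, del_gen, Derivation.leibniz]; ring
    have e1 : ham k p (gen k p 0 * (gen k p 1 * (gen k p 1 * gen k p 1))) (gen k p 1) =
        gen k p 1 * (gen k p 1 * gen k p 1) := by
      simp [ham_mul_apply, del_gen, Derivation.leibniz]
    have hD := hham (gen k p 1 * (gen k p 1 * gen k p 1))
      (by rw [e0]; exact neg_mem (Ideal.mul_mem_left _ _ m01))
      (by rw [e1]; exact Ideal.mul_mem_left _ _ m11)
    have hl := congrArg (fun ψ => ψ.coeff 0) hD
    simp only [coeff_zero_tensorRep, divergence_apply, e0, e1, ham_mul_apply] at hl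
    simp [del_gen, Derivation.leibniz, d3] at hl
    linear_combination hl

theorem cf_natCast_mul (i j n : ℕ) (f : TruncPoly k p) : cf i j ((n : TruncPoly k p) * f) = n * cf i j f := by
  rw [← nsmul_eq_mul, map_nsmul, nsmul_eq_mul]

theorem cf_gen_mul_del_zero {i : ℕ} (hi : i < p) (j : ℕ) (f : TruncPoly k p) :
    cf i j (gen k p 0 * del k p 0 f) = i * cf i j f := by
  rcases i with _ | i
  · rw [cf_zero_gen_mul, Nat.cast_zero, zero_mul]
  · rw [cf_gen_zero_mul hi, cf_del_zero, Nat.cast_succ]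

theorem cf_gen_mul_del_one (i : ℕ) {j : ℕ} (hj : j < p) (f : TruncPoly k p) :
    cf i j (gen k p 1 * del k p 1 f) = j * cf i j f := by
  rcases j with _ | j
  · rw [cf_gen_mul_zero, Nat.cast_zero, zero_mul]
  · rw [cf_gen_one_mul i hj, cf_del_one, Nat.cast_succ]

/-- Up to components of degree greater than `r` in `t`, the only sections killed by `N` are the
multiples of `x ^ (p - 1) y ^ (p - 1)`. -/
theorem tensorCoeff_eq_of_singular (hp : 5 ≤ p) {r c : ℕ} (hr : 2 ≤ r) (hrp : r < p)
    {φ : (TruncPoly k p)[X]} (h : ∀ D ∈ nilpart k p, tensorRep k p r c D φ = 0) :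
    tensorCoeff r φ = cf (p - 1) (p - 1) (φ.coeff 0) • tensorCoeff r (C (topMon k p)) := by
  obtain ⟨h1, h2, h3, h4, h5, h6⟩ := singular_equations h
  have n2 : (2 : k) ≠ 0 := two_ne_zero_of_le hp
  have n3 : (3 : k) ≠ 0 := by
    exact_mod_cast cast_ne_zero_of_lt (k := k) (p := p) (n := 3) (by omega) (by omega)
  have nr : (r : k) ≠ 0 := cast_ne_zero_of_lt (by omega) hrp
  have nr1 : (r : k) - 1 ≠ 0 := by
    have := cast_ne_zero_of_lt (k := k) (p := p) (n := r - 1) (by omega) (by omega)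
    rwa [Nat.cast_sub (by omega), Nat.cast_one] at this
  have cfn : ∀ (i j n : ℕ) (f : TruncPoly k p), cf i j ((n : TruncPoly k p) * f) = n * cf i j f := cf_natCast_mul
  -- Eliminating `φ.coeff (l + 1)` between the equations of `x ∂_y` and `x^3` leaves `3 x^2 ∂_y φ_l
  -- = 0`.
  have s1 : ∀ i j l, i + 2 < p → cf i (j + 1) (φ.coeff l) = 0 := by
    intro i j l hi
    rcases Nat.lt_or_ge (j + 1) p with hj | hj
    · have e : gen k p 0 * (gen k p 0 * ((3 : ℕ) * del k p 1 (φ.coeff l))) = 0 := by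
        push_cast
        linear_combination 2 * gen k p 0 * 3 * h1 l - h2 l
      have := congrArg (cf (i + 2) j) e
      rw [cf_gen_zero_mul (by omega), cf_gen_zero_mul (by omega), cf_natCast_mul, cf_del_one,
        map_zero] at this
      have hj' : ((j : k) + 1) ≠ 0 := by
        exact_mod_cast cast_ne_zero_of_lt (k := k) (p := p) (n := j + 1) (by omega) hj
      simpa [n3, hj'] using this
    · exact cf_eq_zero (Or.inr hj) _
  -- In the `x y^2` equation everything else is divisible by `y`, so at `y^0` only `2 (l - r) x φ_l`
  -- remains.
  have s2 : ∀ i l, i + 1 < p → l < r → cf i 0 (φ.coeff l) = 0 := by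
    intro i l hi hl
    have e := congrArg (cf (i + 1) 0) (h4 l)
    rw [map_add, cf_gen_mul_zero, cf_gen_zero_mul hi, zero_add, map_zero] at e
    have e2 : 2 * ((l : TruncPoly k p) - r) * φ.coeff l = -((2 * (r - l) : ℕ) * φ.coeff l) := by
      rw [Nat.cast_mul, Nat.cast_sub hl.le]
      push_cast
      ring
    rw [e2, map_neg, cf_natCast_mul, neg_eq_zero, Nat.cast_mul] at e
    have hl' : ((r - l : ℕ) : k) ≠ 0 := cast_ne_zero_of_lt (by omega) (by omega)
    exact (mul_eq_zero.1 e).resolve_left (mul_ne_zero (by exact_mod_cast n2) hl')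
  -- The equation of `x ∂_y` determines `φ_(l+1)` from `φ_l`, as `l + 1 ≤ r < p` is invertible.
  have hA : ∀ i j l, cf i j (gen k p 0 * del k p 1 (φ.coeff l)) = 0 → l < r →
      cf i j (φ.coeff (l + 1)) = 0 := by
    intro i j l h0 hl
    have e := congrArg (cf i j) (h1 l)
    rw [← Nat.cast_succ, map_add, h0, zero_add, cf_natCast_mul, map_zero] at e
    exact (mul_eq_zero.1 e).resolve_left (cast_ne_zero_of_lt (by omega) (by omega))
  have s4 : ∀ i j l, i + 1 < p → l < r → cf i j (φ.coeff (l + 1)) = 0 := by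
    intro i j l hi hl
    refine hA i j l ?_ hl
    rcases i with _ | i
    · exact cf_zero_gen_mul _ _
    · rw [cf_gen_zero_mul (by omega), cf_del_one, s1 i j l hi, mul_zero]
  have s5 : ∀ i j, i + 1 < p → cf i j (φ.coeff 0) = 0 := by
    intro i j hi
    rcases Nat.lt_or_ge (i + 2) p with hi2 | hi2
    · rcases j with _ | j
      · exact s2 i 0 hi (by omega)
      · exact s1 i j 0 hi2
    -- The column `i = p - 2` escapes the previous steps; the `x^2 y` equation gives it the factor
    -- `-2 + 2r`, nonzero because `r ≠ 1` in `k`.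
    · have e := congrArg (cf (i + 1) j) h3
      have hi' : (i : k) = -2 := by
        have : ((i + 2 : ℕ) : k) = 0 := by
          rw [show i + 2 = p by omega, CharP.cast_eq_zero]
        push_cast at this
        linear_combination this
      have e2 := cfn i j (2 * r) (φ.coeff 0)
      push_cast at e2
      rw [map_add, cf_gen_zero_mul hi, cf_gen_zero_mul hi, cf_gen_mul_del_zero (by omega), e2, hi',
        map_zero] at e
      have e3 : (2 * ((r : k) - 1)) * cf i j (φ.coeff 0) = 0 := by linear_combination e
      exact (mul_eq_zero.1 e3).resolve_left (mul_ne_zero n2 nr1)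
  have s6 : ∀ j l, l < r → cf (p - 1) j (φ.coeff (l + 1)) = 0 := by
    intro j l hl
    refine hA _ j l ?_ hl
    obtain ⟨q, hq⟩ : ∃ q, p - 1 = q + 1 := ⟨p - 2, by omega⟩
    rw [hq, cf_gen_zero_mul (by omega), cf_del_one]
    rcases l with _ | l
    · rw [s5 q _ (by omega), mul_zero]
    · rw [s4 q _ l (by omega) (by omega), mul_zero]
  -- On the edge `x^(p-1)` the equations of `x y^2` and `x y^3` have factors `j + 2 - 2r` and `j + 3
  -- - 3r`, with difference `r - 1`. The second needs `j + 2 < p`; at `j = p - 2` the first alone is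
  -- `-2r`.
  have s7 : ∀ j, j + 1 < p → cf (p - 1) j (φ.coeff 0) = 0 := by
    intro j hj
    have e := congrArg (cf (p - 1) (j + 1)) h5
    have e2 := cfn (p - 1) j (2 * r) (φ.coeff 0)
    have e3 := cfn (p - 1) j 2 (gen k p 0 * del k p 0 (φ.coeff 0))
    push_cast at e2 e3
    rw [cf_gen_one_mul _ hj, map_sub, map_sub, cf_gen_mul_del_one _ (by omega), e3, e2,
      cf_gen_mul_del_zero (by omega), cast_p_sub_one, map_zero] at e
    rcases Nat.lt_or_ge (j + 2) p with hj2 | hj2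
    · have e' := congrArg (cf (p - 1) (j + 2)) h6
      have e2' := cfn (p - 1) j (3 * r) (φ.coeff 0)
      have e3' := cfn (p - 1) j 3 (gen k p 0 * del k p 0 (φ.coeff 0))
      push_cast at e2' e3'
      rw [cf_gen_one_mul _ hj2, cf_gen_one_mul _ hj, map_sub, map_sub,
        cf_gen_mul_del_one _ (by omega), e3', e2', cf_gen_mul_del_zero (by omega), cast_p_sub_one,
        map_zero] at e'
      have e4 : ((r : k) - 1) * cf (p - 1) j (φ.coeff 0) = 0 := by linear_combination e - e'
      exact (mul_eq_zero.1 e4).resolve_left nr1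
    · have hj' : (j : k) = -2 := by
        have : ((j + 2 : ℕ) : k) = 0 := by
          rw [show j + 2 = p by omega, CharP.cast_eq_zero]
        push_cast at this
        linear_combination this
      rw [hj'] at e
      have e4 : (2 * (r : k)) * cf (p - 1) j (φ.coeff 0) = 0 := by linear_combination -e
      exact (mul_eq_zero.1 e4).resolve_left (mul_ne_zero n2 nr)
  funext q
  obtain ⟨⟨⟨i, hi⟩, ⟨j, hj⟩⟩, ⟨l, hl⟩⟩ := q
  rw [Pi.smul_apply, tensorCoeff_apply, tensorCoeff_apply, smul_eq_mul, coeff_C]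
  dsimp only
  rcases l with _ | l
  · rw [if_pos rfl, topMon, cf_pow_mul_pow (by omega) (by omega)]
    rcases Nat.lt_or_ge (i + 1) p with hi' | hi'
    · rw [s5 i j hi', if_neg (by omega), mul_zero]
    obtain rfl : i = p - 1 := by omega
    rcases Nat.lt_or_ge (j + 1) p with hj' | hj'
    · rw [s7 j hj', if_neg (by omega), mul_zero]
    obtain rfl : j = p - 1 := by omega
    rw [if_pos ⟨rfl, rfl⟩, mul_one]
  · rw [if_neg (by omega), map_zero, mul_zero]
    rcases Nat.lt_or_ge (i + 1) p with hi' | hi'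
    · exact s4 i j l hi' (by omega)
    · obtain rfl : i = p - 1 := by omega
      exact s6 j l (by omega)

end Singular

/-! ### Maximal vectors and simplicity of `Z(M)` -/

section Simplicity

open Polynomial

variable {k : Type*} [Field k] {p : ℕ} [CharP k p] [Fact p.Prime]
  {M : Type*} [AddCommGroup M] [Module k M] [LieRingModule (HhatFilt k p 0) M]
  [LieModule k (HhatFilt k p 0) M]

theorem nilpart_le_HhatFilt (hp : 5 ≤ p) : nilpart k p ≤ (HhatFilt k p 0).toSubmodule :=
  nilpart_le_borel.trans (borel_le_HhatFilt hp)

/-- An element of `Ĥ` annihilating a vector. -/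
theorem zAct_nilpart_eq_zero {hM : IsRestricted (HhatFilt k p 0) M} (hp : 5 ≤ p) {z : Z hM}
    (he : zAct hM (HhatFilt_le k p 0 (xdy_mem k hp)) z = 0)
    (h1 : ∀ D (hD : D ∈ HhatFilt k p 1), zAct hM (HhatFilt_le k p 1 hD) z = 0) :
    ∀ D (hD : D ∈ nilpart k p),
      zAct hM (HhatFilt_le k p 0 (nilpart_le_HhatFilt hp hD)) z = 0 := by
  intro D hD
  obtain ⟨E, hE, F, hF, rfl⟩ := Submodule.mem_sup.1 hD
  obtain ⟨s, rfl⟩ := Submodule.mem_span_singleton.1 hF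
  have h2 : zAct hM (HhatFilt_le k p 0 (nilpart_le_HhatFilt hp hD)) z =
      zAct hM (HhatFilt_le k p 1 hE) z
        + s • zAct hM (HhatFilt_le k p 0 (xdy_mem k hp)) z := by
    change ⁅((⟨E, HhatFilt_le k p 1 hE⟩ : Hhat k p)
      + s • (⟨xdy k p, HhatFilt_le k p 0 (xdy_mem k hp)⟩ : Hhat k p)), z⁆ = _
    rw [add_lie, smul_lie]
    rfl
  rw [h2, he, h1 E hE, smul_zero, add_zero]

/-- If the vectors of `Z(M)` killed by `N` are the multiples of `1 ⊗ m` and `Z(M)` embeds into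
a tensor module, then `Z(M)` is simple. -/
theorem isIrreducible_of_singular (hp : 5 ≤ p) {hM : IsRestricted (HhatFilt k p 0) M}
    (hsimple : LieModule.IsIrreducible k (HhatFilt k p 0) M) {m : M}
    {r c : ℕ} (T : Z hM →ₗ[k] (TruncPoly k p)[X]) (hT : ∀ z, T z = 0 → z = 0)
    (hTD : ∀ (D : Hhat k p) z, T ⁅D, z⁆ = tensorRep k p r c D (T z))
    (hm : zIncl hM m ≠ 0)
    (hsing : ∀ z, (∀ D (hD : D ∈ nilpart k p),
      zAct hM (HhatFilt_le k p 0 (nilpart_le_HhatFilt hp hD)) z = 0) → ∃ μ : k, z = μ • zIncl hM m) :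
    LieModule.IsIrreducible k (Hhat k p) (Z hM) := by
  have : Nontrivial (Z hM) := ⟨⟨_, 0, hm⟩⟩
  refine LieModule.IsIrreducible.mk fun U hU => ?_
  obtain ⟨z₀, hz₀, hz₀'⟩ := U.toSubmodule.ne_bot_iff.1 fun h => hU ((LieSubmodule.toSubmodule_eq_bot U).1 h)
  -- Depth is measured on the image under `T`; it is bounded because `(x, y)^(2p-1) = 0` and `T` is
  -- injective.
  let P : ℕ → Prop := fun n => ∃ z ∈ U, z ≠ 0 ∧ T z ∈ (maxIdeal k p ^ n).map C
  have hP0 : P 0 := ⟨z₀, hz₀, hz₀', by simp [Ideal.map_top]⟩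
  have hPtop : ¬ P (2 * p - 1) := by
    rintro ⟨z, -, hz, hTz⟩
    rw [maxIdeal_pow_eq_bot, Ideal.map_bot] at hTz
    exact hz (hT z hTz)
  obtain ⟨n, hn, hn'⟩ : ∃ n, P n ∧ ¬ P (n + 1) := by
    by_contra! hc
    exact hPtop (Nat.rec hP0 (fun n hn => hc n hn) (2 * p - 1))
  obtain ⟨z, hzU, hz, hTz⟩ := hn
  set e := zAct hM (HhatFilt_le k p 0 (xdy_mem k hp)) with he
  have hep : (e ^ p) z = 0 := by
    have := Induced.isRestricted (HhatFilt_le k p 0) hM ⟨_, HhatFilt_le k p 0 (xdy_mem k hp)⟩ 0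
      xdy_pow_char
    rw [map_zero] at this
    exact LinearMap.congr_fun this z
  have hex : ∃ q, (e ^ q) z = 0 := ⟨p, hep⟩
  have hmem : ∀ q, (e ^ q) z ∈ U ∧ T ((e ^ q) z) ∈ (maxIdeal k p ^ n).map C := by
    intro q
    induction q with
    | zero => exact ⟨hzU, hTz⟩
    | succ q ih =>
      rw [pow_succ', Module.End.mul_apply]
      refine ⟨U.lie_mem ih.1, ?_⟩
      have h := tensorRep_mem_map r c (xdy_mem k hp).2 ih.2
      rw [zero_add] at h
      exact (hTD _ _).symm ▸ h
  classical
  -- The last nonzero power of `x ∂_y` on `z` keeps the maximal depth, so `Ĥ_(1)`, which strictly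
  -- increases depth, also kills that vector.
  obtain ⟨q, hq⟩ := Nat.exists_eq_succ_of_ne_zero (n := Nat.find hex) fun h0 => hz (by
    have := Nat.find_spec hex
    rwa [h0] at this)
  have hv0 : (e ^ q) z ≠ 0 := Nat.find_min hex (by omega)
  have hv1 : e ((e ^ q) z) = 0 := by
    have := Nat.find_spec hex
    rwa [hq, pow_succ', Module.End.mul_apply] at this
  obtain ⟨μ, hμ⟩ := hsing _ (zAct_nilpart_eq_zero hp hv1 fun D hD => by
    by_contra h0
    refine hn' ⟨_, U.lie_mem (hmem q).1, h0, ?_⟩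
    have h := tensorRep_mem_map r c hD.2 (hmem q).2
    rw [add_comm] at h
    exact (hTD _ _).symm ▸ h)
  have hμ0 : μ ≠ 0 := fun h0 => hv0 (by rw [hμ, h0, zero_smul])
  have hmU : zIncl hM m ∈ U := by
    have h := (hmem q).1
    rw [hμ] at h
    exact (Submodule.smul_mem_iff U.toSubmodule hμ0).1 h
  -- The vectors `v` with `1 ⊗ v` in `U` form a submodule of the simple module `M` containing `m`.
  let W : LieSubmodule k (HhatFilt k p 0) M :=
    { U.toSubmodule.comap (zIncl hM) with
      lie_mem := fun {D v} hv => by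
        change zIncl hM ⁅D, v⁆ ∈ U
        rw [← Induced.lie_incl]
        exact U.lie_mem hv }
  have hW : W = ⊤ := by
    refine (hsimple.eq_bot_or_eq_top W).resolve_left fun h0 => ?_
    have h : m ∈ W := hmU
    rw [h0, LieSubmodule.mem_bot] at h
    exact hm (by rw [h, map_zero])
  have hU' : U.toSubmodule = ⊤ :=
    Induced.submodule_eq_top (HhatFilt_le k p 0) hM U.toSubmodule (fun v => by
      have h : v ∈ W := hW ▸ LieSubmodule.mem_top v
      exact h) fun D z hz => U.lie_mem hz
  exact (LieSubmodule.toSubmodule_eq_top U).1 hU'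

end Simplicity

end HamPhi

end

/-! ### Maximal vectors, simplicity and dimension. -/

theorem mainTheorem4 {k : Type*} [Field k] [IsAlgClosed k] {p : ℕ} [Fact p.Prime] [CharP k p]
    (hp : 5 ≤ p) (a b : ℤ) (hab : 2 ≤ a - b) (hab' : a - b ≤ p - 1)
    {M : Type*} [AddCommGroup M] [Module k M] [LieRingModule (HamPhi.HhatFilt k p 0) M]
    [LieModule k (HamPhi.HhatFilt k p 0) M]
    (hM : HamPhi.IsRestricted (HamPhi.HhatFilt k p 0) M)
    (hinfl : ∀ D : HamPhi.HhatFilt k p 0, (D : HamPhi.Witt k p) ∈ HamPhi.HhatFilt k p 1 →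
      ∀ m : M, ⁅D, m⁆ = 0)
    (hsimple : LieModule.IsIrreducible k (HamPhi.HhatFilt k p 0) M)
    (m : M)
    (hm : HamPhi.IsMaximalVector (HamPhi.HhatFilt k p 0) (HamPhi.borel_le_HhatFilt hp)
      (a : k) (b : k) m) :
    (∀ v : HamPhi.Z hM,
      (∃ c d : k, HamPhi.IsMaximalVector (HamPhi.Hhat k p) (HamPhi.borel_le_Hhat hp) c d v) ↔
        ∃ μ : k, μ ≠ 0 ∧ v = μ • HamPhi.Induced.tmul (HamPhi.HhatFilt_le k p 0) hM 1 m) ∧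
    LieModule.IsIrreducible k (HamPhi.Hhat k p) (HamPhi.Z hM) ∧
    (Module.finrank k (HamPhi.Z hM) : ℤ) = p ^ 2 * (a - b + 1) := by
  obtain ⟨r, hr⟩ : ∃ r : ℕ, a - b = r := ⟨(a - b).toNat, by omega⟩
  obtain ⟨c, hc⟩ : ∃ c : ℕ, (c : k) = (b : k) + 1 := by
    have hp0 : (p : ℤ) ≠ 0 := by omega
    -- The tensor power `c` must be a natural number, while only its class in `k` matters, so `b +
    -- 1` is reduced modulo `p`.
    refine ⟨((b + 1) % p).toNat, ?_⟩
    rw [← Int.cast_natCast, Int.toNat_of_nonneg (Int.emod_nonneg _ hp0), Int.emod_def]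
    push_cast
    rw [CharP.cast_eq_zero, zero_mul, sub_zero]
  have hr' : (a : k) - (b : k) = r := by exact_mod_cast congrArg (Int.cast : ℤ → k) hr
  obtain ⟨T, hT0, hTm, hTD, hdim⟩ :=
    HamPhi.exists_embedding hp hM hinfl hsimple hm (r := r) (c := c) (by omega) hr' hc
  have hm0 : HamPhi.zIncl hM m ≠ 0 := fun h0 => by
    have h := hTm
    rw [h0, map_zero] at h
    have h1 := HamPhi.cf_pow_mul_pow (k := k) (p := p) (a := p - 1) (b := p - 1) (by omega)
      (by omega) (p - 1) (p - 1)
    rw [if_pos ⟨rfl, rfl⟩, ← HamPhi.topMon, Polynomial.C_eq_zero.1 h.symm, map_zero] at h1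
    exact zero_ne_one h1
  have hsing : ∀ z, (∀ D (hD : D ∈ HamPhi.nilpart k p), HamPhi.zAct hM (HamPhi.HhatFilt_le k p 0
      (HamPhi.nilpart_le_HhatFilt hp hD)) z = 0) → ∃ μ : k, z = μ • HamPhi.zIncl hM m := by
    intro z hz
    have h := HamPhi.tensorCoeff_eq_of_singular hp (r := r) (c := c) (φ := T z) (by omega)
      (by omega) fun D hD => by
        rw [← hTD ⟨D, HamPhi.HhatFilt_le k p 0 (HamPhi.nilpart_le_HhatFilt hp hD)⟩]
        exact (congrArg T (hz D hD)).trans (map_zero T)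
    refine ⟨HamPhi.cf (p - 1) (p - 1) ((T z).coeff 0), sub_eq_zero.1 (hT0 _ ?_)⟩
    rw [map_sub, map_sub, map_smul, map_smul, hTm, h, sub_self]
  refine ⟨fun v => ⟨?_, ?_⟩, ?_, ?_⟩
  · rintro ⟨c', d', hv⟩
    obtain ⟨μ, hμ⟩ := hsing v fun D hD => hv.nil_lie D hD
    exact ⟨μ, fun h0 => hv.ne_zero (by rw [hμ, h0, zero_smul]), hμ⟩
  · rintro ⟨μ, hμ, rfl⟩
    -- `Ĥ_(0)` acts on `1 ⊗ m` through `M`, so each eigenvalue of `m`, including zero on `N`,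
    -- carries over.
    have key : ∀ {D : HamPhi.Witt k p} (hD : D ∈ HamPhi.HhatFilt k p 0) {s : k},
        HamPhi.act M hD m = s • m →
        HamPhi.zAct hM (HamPhi.HhatFilt_le k p 0 hD) (μ • HamPhi.zIncl hM m) =
          s • μ • HamPhi.zIncl hM m := fun hD s h => by
      rw [map_smul, HamPhi.zAct_zIncl hD, h, map_smul, smul_comm]
    refine ⟨a, b, smul_ne_zero hμ hm0, key _ hm.xdx_lie, key _ hm.ydy_lie, fun D hD => ?_⟩
    have h := key (HamPhi.nilpart_le_HhatFilt hp hD) (s := 0) (by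
      rw [zero_smul]; exact hm.nil_lie D hD)
    rwa [zero_smul] at h
  · exact HamPhi.isIrreducible_of_singular hp hsimple T
      (fun z hz => hT0 z (by rw [hz, map_zero])) hTD hm0 hsing
  · rw [hdim, hr]
    push_cast
    ring
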